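/- Let $\mathbb O$ be the octonions, $M_2(\mathbb O)$ the $2\times2$ octonionic matrices, $M^\dagger$ the conjugate transpose of $M$, and $\mathfrak h_2(\mathbb O)=\{X\in M_2(\mathbb O): X^\dagger=X\}$. For $X=\begin{pmatrix}\alpha&x\\ \bar x&\beta\end{pmatrix}\in\mathfrak h_2(\mathbb O)$ put $\det X=\alpha\beta-\|x\|^2$. Identify $\mathfrak h_2(\mathbb O)$ with $\mathbb R^{10}$ by $$(x_0,\dots,x_9)\leftrightarrow\begin{pmatrix}x_0+x_9&x\\ \bar x&x_0-x_9\end{pmatrix},\qquad x=x_1+x_2e_1+\dots+x_8e_7 .$$ For $M\in M_2(\mathbb O)$ let $\phi_M:\mathfrak h_2(\mathbb O)\to\mathfrak h_2(\mathbb O)$ be the linear map $\phi_M(X)=\frac12\big((MX)M^\dagger+M(XM^\dagger)\big)$. Let $SL(2,\mathbb O)\subset GL(10,\mathbb R)$ be the group generated, under composition, by all invertible $\phi_M$ with $\det\phi_M(X)=\det X$ for all $X$. Say that the entries of $M=\begin{pmatrix}a&b\\c&d\end{pmatrix}$ share one imaginary direction if there is a $q\in\mathbb O$ with $\mathrm{Re}\,q=0$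 and $a,b,c,d\in\mathbb R+\mathbb Rq$. Let $\mathfrak{sl}(2,\mathbb O)=M_2'(\mathbb O)\oplus C(\mathbb O')\oplus\mathfrak{Der}(\mathbb O)$ (a direct sum of real vector spaces), where $M_2'(\mathbb O)$ is the space of traceless matrices in $M_2(\mathbb O)$, $C(\mathbb O')$ is the space of the maps $C_p(x)=px-xp$ with $\mathrm{Re}\,p=0$, and $\mathfrak{Der}(\mathbb O)\cong\mathfrak g_2$ is the space of derivations of $\mathbb O$. It acts on $\mathfrak h_2(\mathbb O)$: $N\in M_2'(\mathbb O)$ by $X\mapsto NX+XN^\dagger$, and the elements of $C(\mathbb O')$ and $\mathfrak{Der}(\mathbb O)$ entrywise. Let $\varphi:\mathfrak{sl}(2,\mathbb O)\to M_{10}(\mathbb R)$ send an element to the matrix of its action on $\mathfrak h_2(\mathbb O)\cong\mathbb R^{10}$, and define the bracket of $\mathfrak{sl}(2,\mathbb O)$ by $[m,n]=\varphi^{-1}\big(\varphi(m)\varphi(n)-\varphi(n)\varphi(m)\big)$. Let $\mathfrak{so}(9,1)=\{A\in M_{10}(\mathbb R):\eta A=-(\eta A)^T\}$ with $\eta=\mathrm{diag}(1,-1,\dots,-1)$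 and the commutator bracket. For nonzero purely imaginary octonions $a,b$ with $ab=-ba$ put $r(t)=a+\frac43\|a\|^2t\,b$, $u(t)=\frac12+\frac{\sqrt3}{2\|r(t)\|}r(t)$, $$G^t_{a,b}(x)=u(t)^{-1}\Big(u(0)\Big(u(t)\big(u(0)^{-1}x\,u(0)\big)u(t)^{-1}\Big)u(0)^{-1}\Big)u(t),$$ $$D_{a,b}(x)=[[a,b],x]-3\big((ab)x-a(bx)\big).$$ **Theorem.** 1. If the entries of $M$ share one imaginary direction, then $\phi_M$ is invertible and determinant-preserving if and only if $\|ad-bc\|=1$. The set of all finite compositions of such maps $\phi_M$ is a group, and equals $SL(2,\mathbb O)$. 2. $\varphi$ is injective with image $\mathfrak{so}(9,1)$, so that the bracket of $\mathfrak{sl}(2,\mathbb O)$ is well defined and $\varphi:\mathfrak{sl}(2,\mathbb O)\to\mathfrak{so}(9,1)$ is an isomorphism of Lie algebras. 3. With the topology inherited from $GL(10,\mathbb R)$, $SL(2,\mathbb O)$ carries a structure of ($45$-dimensional, real, smooth) Lie group for which the inclusion into $GL(10,\mathbb R)$ is a smooth embedding. Its Lie algebra is isomorphic to $\mathfrak{sl}(2,\mathbb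 O)$, by an isomorphism under which the differential at the identity of the inclusion into $GL(10,\mathbb R)$ becomes $\varphi$. 4. For all nonzero purely imaginary $a,b$ with $ab=-ba$, and with $I$ the identity matrix, the maps $$\phi_{u(t)^{-1}I}\circ\phi_{u(0)I}\circ\phi_{u(t)I}\circ\phi_{u(0)^{-1}I}\qquad(t\in\mathbb R)$$ lie in $SL(2,\mathbb O)$ and act on the entries of $X\in\mathfrak h_2(\mathbb O)$ by $G^t_{a,b}$. They form a curve through the identity at $t=0$, whose tangent vector there is $\varphi(D_{a,b})$ with $D_{a,b}\in\mathfrak{Der}(\mathbb O)$. These $D_{a,b}$ span $\mathfrak{Der}(\mathbb O)$. -/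

import Mathlib

open scoped Manifold ContDiff Matrix

noncomputable section

/-! ### The octonions -/

/-- The octonions `x = x₀ + x₁ e₁ + ⋯ + x₇ e₇`, given by their eight real coordinates. -/
@[ext] structure Octonion : Type where
  x0 : ℝ
  x1 : ℝ
  x2 : ℝ
  x3 : ℝ
  x4 : ℝ
  x5 : ℝ
  x6 : ℝ
  x7 : ℝ

namespace Octonion

instance : Zero Octonion := ⟨⟨0, 0, 0, 0, 0, 0, 0, 0⟩⟩

instance : One Octonion := ⟨⟨1, 0, 0, 0, 0, 0, 0, 0⟩⟩

instance : Add Octonion := ⟨fun x y =>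
  ⟨x.x0 + y.x0, x.x1 + y.x1, x.x2 + y.x2, x.x3 + y.x3,
    x.x4 + y.x4, x.x5 + y.x5, x.x6 + y.x6, x.x7 + y.x7⟩⟩

instance : Neg Octonion := ⟨fun x =>
  ⟨-x.x0, -x.x1, -x.x2, -x.x3, -x.x4, -x.x5, -x.x6, -x.x7⟩⟩

instance : SMul ℝ Octonion := ⟨fun r x =>
  ⟨r * x.x0, r * x.x1, r * x.x2, r * x.x3, r * x.x4, r * x.x5, r * x.x6, r * x.x7⟩⟩

/-- The multiplication with `eᵢ² = -1` for `i = 1, …, 7` and `eᵢ eⱼ = eₖ = - eⱼ eᵢ` for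
`(i, j, k)` a cyclic permutation of one of the oriented lines
`(1,2,7), (1,3,5), (1,6,4), (2,6,3), (2,5,4), (3,4,7), (5,6,7)` of the Fano plane. -/
instance : Mul Octonion := ⟨fun x y =>
  ⟨x.x0 * y.x0 - x.x1 * y.x1 - x.x2 * y.x2 - x.x3 * y.x3
      - x.x4 * y.x4 - x.x5 * y.x5 - x.x6 * y.x6 - x.x7 * y.x7,
    x.x0 * y.x1 + x.x1 * y.x0 + (x.x2 * y.x7 - x.x7 * y.x2)
      + (x.x3 * y.x5 - x.x5 * y.x3) + (x.x6 * y.x4 - x.x4 * y.x6),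
    x.x0 * y.x2 + x.x2 * y.x0 + (x.x7 * y.x1 - x.x1 * y.x7)
      + (x.x6 * y.x3 - x.x3 * y.x6) + (x.x5 * y.x4 - x.x4 * y.x5),
    x.x0 * y.x3 + x.x3 * y.x0 + (x.x5 * y.x1 - x.x1 * y.x5)
      + (x.x2 * y.x6 - x.x6 * y.x2) + (x.x4 * y.x7 - x.x7 * y.x4),
    x.x0 * y.x4 + x.x4 * y.x0 + (x.x1 * y.x6 - x.x6 * y.x1)
      + (x.x2 * y.x5 - x.x5 * y.x2) + (x.x7 * y.x3 - x.x3 * y.x7),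
    x.x0 * y.x5 + x.x5 * y.x0 + (x.x1 * y.x3 - x.x3 * y.x1)
      + (x.x4 * y.x2 - x.x2 * y.x4) + (x.x6 * y.x7 - x.x7 * y.x6),
    x.x0 * y.x6 + x.x6 * y.x0 + (x.x4 * y.x1 - x.x1 * y.x4)
      + (x.x3 * y.x2 - x.x2 * y.x3) + (x.x7 * y.x5 - x.x5 * y.x7),
    x.x0 * y.x7 + x.x7 * y.x0 + (x.x1 * y.x2 - x.x2 * y.x1)
      + (x.x3 * y.x4 - x.x4 * y.x3) + (x.x5 * y.x6 - x.x6 * y.x5)⟩⟩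

/-- Octonionic conjugation `x ↦ x̄`. -/
instance : Star Octonion := ⟨fun x =>
  ⟨x.x0, -x.x1, -x.x2, -x.x3, -x.x4, -x.x5, -x.x6, -x.x7⟩⟩

@[simp] theorem zero_x0 : (0 : Octonion).x0 = 0 := rfl
@[simp] theorem one_x0 : (1 : Octonion).x0 = 1 := rfl
@[simp] theorem add_x0 (x y : Octonion) : (x + y).x0 = x.x0 + y.x0 := rfl
@[simp] theorem neg_x0 (x : Octonion) : (-x).x0 = -x.x0 := rfl
@[simp] theorem smul_x0 (r : ℝ) (x : Octonion) : (r • x).x0 = r * x.x0 := rfl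
@[simp] theorem star_x0 (x : Octonion) : (star x).x0 = x.x0 := rfl
@[simp] theorem mul_x0 (x y : Octonion) : (x * y).x0 =
    x.x0 * y.x0 - x.x1 * y.x1 - x.x2 * y.x2 - x.x3 * y.x3
      - x.x4 * y.x4 - x.x5 * y.x5 - x.x6 * y.x6 - x.x7 * y.x7 := rfl

@[simp] theorem zero_x1 : (0 : Octonion).x1 = 0 := rfl
@[simp] theorem one_x1 : (1 : Octonion).x1 = 0 := rfl
@[simp] theorem add_x1 (x y : Octonion) : (x + y).x1 = x.x1 + y.x1 := rfl
@[simp] theorem neg_x1 (x : Octonion) : (-x).x1 = -x.x1 := rfl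
@[simp] theorem smul_x1 (r : ℝ) (x : Octonion) : (r • x).x1 = r * x.x1 := rfl
@[simp] theorem star_x1 (x : Octonion) : (star x).x1 = -x.x1 := rfl
@[simp] theorem mul_x1 (x y : Octonion) : (x * y).x1 =
    x.x0 * y.x1 + x.x1 * y.x0 + (x.x2 * y.x7 - x.x7 * y.x2)
      + (x.x3 * y.x5 - x.x5 * y.x3) + (x.x6 * y.x4 - x.x4 * y.x6) := rfl

@[simp] theorem zero_x2 : (0 : Octonion).x2 = 0 := rfl
@[simp] theorem one_x2 : (1 : Octonion).x2 = 0 := rfl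
@[simp] theorem add_x2 (x y : Octonion) : (x + y).x2 = x.x2 + y.x2 := rfl
@[simp] theorem neg_x2 (x : Octonion) : (-x).x2 = -x.x2 := rfl
@[simp] theorem smul_x2 (r : ℝ) (x : Octonion) : (r • x).x2 = r * x.x2 := rfl
@[simp] theorem star_x2 (x : Octonion) : (star x).x2 = -x.x2 := rfl
@[simp] theorem mul_x2 (x y : Octonion) : (x * y).x2 =
    x.x0 * y.x2 + x.x2 * y.x0 + (x.x7 * y.x1 - x.x1 * y.x7)
      + (x.x6 * y.x3 - x.x3 * y.x6) + (x.x5 * y.x4 - x.x4 * y.x5) := rfl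

@[simp] theorem zero_x3 : (0 : Octonion).x3 = 0 := rfl
@[simp] theorem one_x3 : (1 : Octonion).x3 = 0 := rfl
@[simp] theorem add_x3 (x y : Octonion) : (x + y).x3 = x.x3 + y.x3 := rfl
@[simp] theorem neg_x3 (x : Octonion) : (-x).x3 = -x.x3 := rfl
@[simp] theorem smul_x3 (r : ℝ) (x : Octonion) : (r • x).x3 = r * x.x3 := rfl
@[simp] theorem star_x3 (x : Octonion) : (star x).x3 = -x.x3 := rfl
@[simp] theorem mul_x3 (x y : Octonion) : (x * y).x3 =
    x.x0 * y.x3 + x.x3 * y.x0 + (x.x5 * y.x1 - x.x1 * y.x5)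
      + (x.x2 * y.x6 - x.x6 * y.x2) + (x.x4 * y.x7 - x.x7 * y.x4) := rfl

@[simp] theorem zero_x4 : (0 : Octonion).x4 = 0 := rfl
@[simp] theorem one_x4 : (1 : Octonion).x4 = 0 := rfl
@[simp] theorem add_x4 (x y : Octonion) : (x + y).x4 = x.x4 + y.x4 := rfl
@[simp] theorem neg_x4 (x : Octonion) : (-x).x4 = -x.x4 := rfl
@[simp] theorem smul_x4 (r : ℝ) (x : Octonion) : (r • x).x4 = r * x.x4 := rfl
@[simp] theorem star_x4 (x : Octonion) : (star x).x4 = -x.x4 := rfl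
@[simp] theorem mul_x4 (x y : Octonion) : (x * y).x4 =
    x.x0 * y.x4 + x.x4 * y.x0 + (x.x1 * y.x6 - x.x6 * y.x1)
      + (x.x2 * y.x5 - x.x5 * y.x2) + (x.x7 * y.x3 - x.x3 * y.x7) := rfl

@[simp] theorem zero_x5 : (0 : Octonion).x5 = 0 := rfl
@[simp] theorem one_x5 : (1 : Octonion).x5 = 0 := rfl
@[simp] theorem add_x5 (x y : Octonion) : (x + y).x5 = x.x5 + y.x5 := rfl
@[simp] theorem neg_x5 (x : Octonion) : (-x).x5 = -x.x5 := rfl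
@[simp] theorem smul_x5 (r : ℝ) (x : Octonion) : (r • x).x5 = r * x.x5 := rfl
@[simp] theorem star_x5 (x : Octonion) : (star x).x5 = -x.x5 := rfl
@[simp] theorem mul_x5 (x y : Octonion) : (x * y).x5 =
    x.x0 * y.x5 + x.x5 * y.x0 + (x.x1 * y.x3 - x.x3 * y.x1)
      + (x.x4 * y.x2 - x.x2 * y.x4) + (x.x6 * y.x7 - x.x7 * y.x6) := rfl

@[simp] theorem zero_x6 : (0 : Octonion).x6 = 0 := rfl
@[simp] theorem one_x6 : (1 : Octonion).x6 = 0 := rfl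
@[simp] theorem add_x6 (x y : Octonion) : (x + y).x6 = x.x6 + y.x6 := rfl
@[simp] theorem neg_x6 (x : Octonion) : (-x).x6 = -x.x6 := rfl
@[simp] theorem smul_x6 (r : ℝ) (x : Octonion) : (r • x).x6 = r * x.x6 := rfl
@[simp] theorem star_x6 (x : Octonion) : (star x).x6 = -x.x6 := rfl
@[simp] theorem mul_x6 (x y : Octonion) : (x * y).x6 =
    x.x0 * y.x6 + x.x6 * y.x0 + (x.x4 * y.x1 - x.x1 * y.x4)
      + (x.x3 * y.x2 - x.x2 * y.x3) + (x.x7 * y.x5 - x.x5 * y.x7) := rfl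

@[simp] theorem zero_x7 : (0 : Octonion).x7 = 0 := rfl
@[simp] theorem one_x7 : (1 : Octonion).x7 = 0 := rfl
@[simp] theorem add_x7 (x y : Octonion) : (x + y).x7 = x.x7 + y.x7 := rfl
@[simp] theorem neg_x7 (x : Octonion) : (-x).x7 = -x.x7 := rfl
@[simp] theorem smul_x7 (r : ℝ) (x : Octonion) : (r • x).x7 = r * x.x7 := rfl
@[simp] theorem star_x7 (x : Octonion) : (star x).x7 = -x.x7 := rfl
@[simp] theorem mul_x7 (x y : Octonion) : (x * y).x7 =
    x.x0 * y.x7 + x.x7 * y.x0 + (x.x1 * y.x2 - x.x2 * y.x1)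
      + (x.x3 * y.x4 - x.x4 * y.x3) + (x.x5 * y.x6 - x.x6 * y.x5) := rfl

instance : AddCommGroup Octonion where
  add_assoc := fun x y z => by ext <;> simp [add_assoc]
  zero_add := fun x => by ext <;> simp
  add_zero := fun x => by ext <;> simp
  add_comm := fun x y => by ext <;> simp [add_comm]
  neg_add_cancel := fun x => by ext <;> simp
  nsmul := nsmulRec
  zsmul := zsmulRec

instance : NonAssocRing Octonion where
  left_distrib := fun x y z => by ext <;> simp <;> ring
  right_distrib := fun x y z => by ext <;> simp <;> ring
  zero_mul := fun x => by ext <;> simp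
  mul_zero := fun x => by ext <;> simp
  one_mul := fun x => by ext <;> simp
  mul_one := fun x => by ext <;> simp
  neg_add_cancel := neg_add_cancel
  zsmul := zsmulRec

instance : Module ℝ Octonion where
  one_smul := fun x => by ext <;> simp
  mul_smul := fun r s x => by ext <;> simp [mul_assoc]
  smul_zero := fun r => by ext <;> simp
  smul_add := fun r x y => by ext <;> simp [mul_add]
  add_smul := fun r s x => by ext <;> simp [add_mul]
  zero_smul := fun x => by ext <;> simp

instance : StarRing Octonion where
  star_involutive := fun x => by ext <;> simp
  star_mul := fun x y => by ext <;> simp <;> ring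
  star_add := fun x y => by ext <;> simp <;> ring

instance : StarModule ℝ Octonion where
  star_smul := fun r x => by ext <;> simp

instance : IsScalarTower ℝ Octonion Octonion where
  smul_assoc := fun r x y => by ext <;> simp <;> ring

instance : SMulCommClass ℝ Octonion Octonion where
  smul_comm := fun r x y => by ext <;> simp <;> ring

/-- The real part. -/
def re (x : Octonion) : ℝ := x.x0

/-- The squared norm `‖x‖² = x₀² + ⋯ + x₇²`. -/
def normSq (x : Octonion) : ℝ :=
  x.x0 ^ 2 + x.x1 ^ 2 + x.x2 ^ 2 + x.x3 ^ 2 + x.x4 ^ 2 + x.x5 ^ 2 + x.x6 ^ 2 + x.x7 ^ 2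

/-- The inverse `x⁻¹ = ‖x‖⁻² x̄` (with `0⁻¹ = 0`). -/
instance : Inv Octonion := ⟨fun x => (normSq x)⁻¹ • star x⟩

/-- The commutator `[a, b] = ab - ba`. -/
def commutatorOf (a b : Octonion) : Octonion := a * b - b * a

/-- The associator `[a, b, c] = (ab)c - a(bc)`. -/
def associatorOf (a b c : Octonion) : Octonion := (a * b) * c - a * (b * c)

end Octonion

open Octonion

/-! ### Hermitian `2 × 2` matrices and the transformations `φ_M` -/

/-- `2 × 2` matrices with octonionic entries. -/
abbrev M2O : Type := Matrix (Fin 2) (Fin 2) Octonion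

/-- The real vector space `𝔥₂(𝕆)` of Hermitian `2 × 2` octonionic matrices. -/
def h2O : Submodule ℝ M2O where
  carrier := {X | Xᴴ = X}
  add_mem' := fun {X Y} hX hY => by
    simp only [Set.mem_ofPred_eq] at hX hY ⊢
    rw [Matrix.conjTranspose_add, hX, hY]
  zero_mem' := by simp
  smul_mem' := fun r X hX => by
    simp only [Set.mem_ofPred_eq] at hX ⊢
    rw [Matrix.conjTranspose_smul, hX, star_trivial]

theorem mem_h2O {X : M2O} : X ∈ h2O ↔ Xᴴ = X := Iff.rfl

/-- The determinant `αβ - x x̄` of a Hermitian matrix with rows `(α, x)` and `(x̄, β)`. This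
octonion is real, and is read as a real number. -/
def hdet (X : h2O) : ℝ := re ((X : M2O) 0 0 * (X : M2O) 1 1 - (X : M2O) 0 1 * (X : M2O) 1 0)

theorem phi_mem (M : M2O) {X : M2O} (hX : X ∈ h2O) :
    (1 / 2 : ℝ) • ((M * X) * Mᴴ + M * (X * Mᴴ)) ∈ h2O := by
  rw [mem_h2O] at hX ⊢
  rw [Matrix.conjTranspose_smul, Matrix.conjTranspose_add, Matrix.conjTranspose_mul,
    Matrix.conjTranspose_mul, Matrix.conjTranspose_mul, Matrix.conjTranspose_mul,
    Matrix.conjTranspose_conjTranspose, hX, star_trivial, add_comm]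

/-- The transformation `φ_M(X) = ½((MX)M† + M(XM†))` of `𝔥₂(𝕆)`. -/
def phi (M : M2O) : h2O →ₗ[ℝ] h2O where
  toFun X := ⟨(1 / 2 : ℝ) • ((M * (X : M2O)) * Mᴴ + M * ((X : M2O) * Mᴴ)), phi_mem M X.2⟩
  map_add' X Y := by
    apply Subtype.ext
    simp only [Submodule.coe_add, Matrix.mul_add, Matrix.add_mul, ← smul_add]
    congr 1
    abel
  map_smul' r X := by
    apply Subtype.ext
    simp only [Submodule.coe_smul, Matrix.mul_smul, Matrix.smul_mul, RingHom.id_apply,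
      ← smul_add]
    rw [smul_comm]

/-- `φ_M` preserves the determinant. -/
def PreservesDet (M : M2O) : Prop := ∀ X : h2O, hdet (phi M X) = hdet X

/-- The four entries of `M` share one imaginary direction: they are of the form `μ + ν q` with
`μ, ν` real and one purely imaginary octonion `q`. -/
def SharesDirection (M : M2O) : Prop :=
  ∃ q : Octonion, re q = 0 ∧ ∃ μ ν : Fin 2 → Fin 2 → ℝ,
    ∀ i j, M i j = μ i j • (1 : Octonion) + ν i j • q

/-! ### The identification `𝔥₂(𝕆) ≅ ℝ¹⁰` and the group `SL(2,𝕆)` -/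

/-- The octonion `x₁ + x₂ e₁ + ⋯ + x₈ e₇`. -/
def offDiag (v : Fin 10 → ℝ) : Octonion :=
  ⟨v 1, v 2, v 3, v 4, v 5, v 6, v 7, v 8⟩

/-- The Hermitian matrix with rows `(x₀ + x₉, x)` and `(x̄, x₀ - x₉)`, where
`x = x₁ + x₂ e₁ + ⋯ + x₈ e₇`. -/
def hermOf (v : Fin 10 → ℝ) : M2O :=
  !![(v 0 + v 9) • (1 : Octonion), offDiag v; star (offDiag v), (v 0 - v 9) • (1 : Octonion)]

theorem hermOf_mem (v : Fin 10 → ℝ) : hermOf v ∈ h2O := by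
  rw [mem_h2O]
  ext i j : 1
  fin_cases i <;> fin_cases j <;> simp [hermOf, Matrix.conjTranspose_apply]

/-- The coordinates `(x₀, …, x₉)` of a Hermitian matrix. -/
def coordOf (X : M2O) : Fin 10 → ℝ :=
  ![(re (X 0 0) + re (X 1 1)) / 2, (X 0 1).x0, (X 0 1).x1, (X 0 1).x2, (X 0 1).x3, 
    (X 0 1).x4, (X 0 1).x5, (X 0 1).x6, (X 0 1).x7, (re (X 0 0) - re (X 1 1)) / 2]

/-- A conjugation-invariant octonion is real. -/
theorem eq_re_of_star {x : Octonion} (h : star x = x) : x = re x • (1 : Octonion) := by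
  rw [Octonion.ext_iff] at h
  simp at h
  obtain ⟨h1, h2, h3, h4, h5, h6, h7⟩ := h
  ext <;> simp [re] <;> linarith

/-- The linear identification of `𝔥₂(𝕆)` with `ℝ¹⁰`; the determinant becomes the Lorentz form
`x₀² - x₁² - ⋯ - x₉²`. -/
def coord : h2O ≃ₗ[ℝ] (Fin 10 → ℝ) where
  toFun X := coordOf X
  invFun v := ⟨hermOf v, hermOf_mem v⟩
  map_add' X Y := by
    ext i
    fin_cases i <;> simp [coordOf, re] <;> ring
  map_smul' r X := by
    ext i
    fin_cases i <;> simp [coordOf, re] <;> ring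
  left_inv X := by
    apply Subtype.ext
    have hX := mem_h2O.1 X.2
    have e00 : star ((X : M2O) 0 0) = (X : M2O) 0 0 := congrFun (congrFun hX 0) 0
    have e11 : star ((X : M2O) 1 1) = (X : M2O) 1 1 := congrFun (congrFun hX 1) 1
    have e10 : star ((X : M2O) 0 1) = (X : M2O) 1 0 := congrFun (congrFun hX 1) 0
    have eo : offDiag (coordOf (X : M2O)) = (X : M2O) 0 1 := by
      ext <;> rfl
    have d0 : (re ((X : M2O) 0 0) + re ((X : M2O) 1 1)) / 2
        + (re ((X : M2O) 0 0) - re ((X : M2O) 1 1)) / 2 = re ((X : M2O) 0 0) := by ring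
    have d1 : (re ((X : M2O) 0 0) + re ((X : M2O) 1 1)) / 2
        - (re ((X : M2O) 0 0) - re ((X : M2O) 1 1)) / 2 = re ((X : M2O) 1 1) := by ring
    change hermOf (coordOf (X : M2O)) = (X : M2O)
    have c0 : coordOf (X : M2O) 0 = (re ((X : M2O) 0 0) + re ((X : M2O) 1 1)) / 2 := rfl
    have c9 : coordOf (X : M2O) 9 = (re ((X : M2O) 0 0) - re ((X : M2O) 1 1)) / 2 := rfl
    rw [hermOf, eo, e10, c0, c9, d0, d1, ← eq_re_of_star e00, ← eq_re_of_star e11]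
    exact (Matrix.eta_fin_two _).symm
  right_inv v := by
    ext i
    fin_cases i <;>
      simp [coordOf, hermOf, re, offDiag]

/-- `GL(10,ℝ)`: the invertible elements of the algebra of linear endomorphisms of `ℝ¹⁰`, with its
usual topology and Lie group structure. -/
abbrev GL10 : Type := ((Fin 10 → ℝ) →L[ℝ] (Fin 10 → ℝ))ˣ

/-- `g ∈ GL(10,ℝ)` is the transformation `T` of `𝔥₂(𝕆) ≅ ℝ¹⁰`. -/
def Represents (g : GL10) (T : h2O →ₗ[ℝ] h2O) : Prop :=
  ∀ X : h2O, (g : (Fin 10 → ℝ) →L[ℝ] (Fin 10 → ℝ)) (coord X) = coord (T X)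

/-- The invertible determinant-preserving transformations `φ_M`. -/
def generators : Set GL10 := {g | ∃ M : M2O, PreservesDet M ∧ Represents g (phi M)}

/-- Those among the generators whose matrix `M` has entries sharing one imaginary direction. -/
def directedGenerators : Set GL10 :=
  {g | ∃ M : M2O, SharesDirection M ∧ PreservesDet M ∧ Represents g (phi M)}

/-- The group generated, under composition, by all invertible determinant-preserving `φ_M`. It
carries the topology of a subspace of `GL(10,ℝ)`. -/
def SL2O : Subgroup GL10 := Subgroup.closure generators

/-! ### The Lie algebras `𝔰𝔩(2,𝕆)` and `𝔰𝔬(9,1)` -/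

/-- `M₂'(𝕆)`: the traceless octonionic matrices. -/
def M2prime : Submodule ℝ M2O := LinearMap.ker (Matrix.traceLinearMap (Fin 2) ℝ Octonion)

/-- The purely imaginary octonions. -/
def imO : Submodule ℝ Octonion where
  carrier := {d | re d = 0}
  add_mem' := fun {x y} hx hy => by
    simp only [Set.mem_ofPred_eq, re, add_x0] at hx hy ⊢
    rw [hx, hy, add_zero]
  zero_mem' := rfl
  smul_mem' := fun r x hx => by
    simp only [Set.mem_ofPred_eq, re, smul_x0] at hx ⊢
    rw [hx, mul_zero]

/-- The map `d ↦ C_d = L_d - R_d`, so `C_d(x) = dx - xd`. -/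
def commMap : Octonion →ₗ[ℝ] Module.End ℝ Octonion :=
  LinearMap.mul ℝ Octonion - (LinearMap.mul ℝ Octonion).flip

/-- `C(𝕆') = {C_d : d imaginary}`. -/
def commMaps : Submodule ℝ (Module.End ℝ Octonion) := imO.map commMap

/-- `Der(𝕆)`: the derivations of the octonions. -/
def derO : Submodule ℝ (Module.End ℝ Octonion) where
  carrier := {D | ∀ x y, D (x * y) = D x * y + x * D y}
  add_mem' := fun {D D'} h h' x y => by
    simp only [LinearMap.add_apply, h x y, h' x y, add_mul, mul_add]
    abel
  zero_mem' := fun x y => by simp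
  smul_mem' := fun r D h x y => by
    simp only [LinearMap.smul_apply, h x y, smul_add, smul_mul_assoc, mul_smul_comm]

/-- The vector space `𝔰𝔩(2,𝕆) = M₂'(𝕆) ⊕ C(𝕆') ⊕ Der(𝕆)`. -/
def sl2O : Type := M2prime × commMaps × derO

namespace sl2O

instance : AddCommGroup sl2O := inferInstanceAs (AddCommGroup (M2prime × commMaps × derO))

instance : Module ℝ sl2O := inferInstanceAs (Module ℝ (M2prime × commMaps × derO))

theorem star_commMaps (C : commMaps) (x : Octonion) :
    (C : Module.End ℝ Octonion) (star x) = star ((C : Module.End ℝ Octonion) x) := by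
  obtain ⟨C, d, hd, rfl⟩ := C
  have hd' : star d = -d := by
    have h0 : d.x0 = 0 := hd
    ext <;> simp [h0]
  simp only [commMap, LinearMap.sub_apply, LinearMap.mul_apply', LinearMap.flip_apply, star_sub,
    star_mul, hd']
  simp only [mul_neg, neg_mul]
  abel

theorem derO_one (D : derO) : (D : Module.End ℝ Octonion) 1 = 0 := by
  have h := D.2 1 1
  simpa using h

theorem derO_im (D : derO) (x : Octonion) : re ((D : Module.End ℝ Octonion) x) = 0 := by
  have him : ∀ y : Octonion, re y = 0 → re ((D : Module.End ℝ Octonion) y) = 0 := by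
    intro y hy
    have hy0 : y.x0 = 0 := hy
    have hyy : y * y = (-normSq y) • (1 : Octonion) := by
      ext <;> simp [normSq, hy0] <;> ring
    have h := D.2 y y
    rw [hyy, map_smul, derO_one, smul_zero] at h
    by_contra hne
    have hz0 : ((D : Module.End ℝ Octonion) y).x0 ≠ 0 := hne
    have hy' : y = 0 := by
      rw [Octonion.ext_iff] at h
      simp only [zero_x0, zero_x1, zero_x2, zero_x3, zero_x4, zero_x5, zero_x6, zero_x7,
        add_x1, add_x2, add_x3, add_x4, add_x5, add_x6, add_x7,
        mul_x1, mul_x2, mul_x3, mul_x4, mul_x5, mul_x6, mul_x7, hy0] at h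
      obtain ⟨-, h1, h2, h3, h4, h5, h6, h7⟩ := h
      ext
      · exact hy0
      all_goals
        apply mul_left_cancel₀ hz0
        simp only [zero_x1, zero_x2, zero_x3, zero_x4, zero_x5, zero_x6, zero_x7]
        linarith
    rw [hy', map_zero] at hz0
    exact hz0 rfl
  have hdec : x = re x • (1 : Octonion) + (x - re x • (1 : Octonion)) := by abel
  rw [hdec, map_add, map_smul, derO_one, smul_zero, zero_add]
  apply him
  rw [sub_eq_add_neg]
  simp [re]

theorem star_derO (D : derO) (x : Octonion) :
    (D : Module.End ℝ Octonion) (star x) = star ((D : Module.End ℝ Octonion) x) := by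
  have hs : ∀ y : Octonion, star y = (2 * re y) • (1 : Octonion) - y := by
    intro y
    rw [sub_eq_add_neg]
    ext <;> simp [re]
    ring
  rw [hs x, hs ((D : Module.End ℝ Octonion) x), map_sub, map_smul, derO_one, derO_im]
  simp

/-- The action of `𝔰𝔩(2,𝕆)` on Hermitian matrices, as a matrix: `N ∈ M₂'(𝕆)` acts by
`X ↦ N X + X N†`, while `C ∈ C(𝕆')` and `D ∈ Der(𝕆)` act on the entries of `X`. -/
def actFun (m : sl2O) (X : M2O) : M2O :=
  (m.1 : M2O) * X + X * (m.1 : M2O)ᴴ + X.map (m.2.1 : Module.End ℝ Octonion)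
    + X.map (m.2.2 : Module.End ℝ Octonion)

theorem actFun_mem (m : sl2O) {X : M2O} (hX : X ∈ h2O) : actFun m X ∈ h2O := by
  rw [mem_h2O] at hX ⊢
  have h1 : ∀ f : Module.End ℝ Octonion, (∀ x, f (star x) = star (f x)) →
      (X.map f)ᴴ = X.map f := by
    intro f hf
    conv_rhs => rw [← hX]
    ext i j : 1
    simp [Matrix.conjTranspose_apply, hf]
  rw [actFun, Matrix.conjTranspose_add, Matrix.conjTranspose_add, Matrix.conjTranspose_add,
    Matrix.conjTranspose_mul, Matrix.conjTranspose_mul, Matrix.conjTranspose_conjTranspose, hX,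
    h1 _ (star_commMaps m.2.1), h1 _ (star_derO m.2.2)]
  abel

/-- The action of `𝔰𝔩(2,𝕆)` on `𝔥₂(𝕆)`. -/
def act : sl2O →ₗ[ℝ] Module.End ℝ h2O where
  toFun m :=
    { toFun := fun X => ⟨actFun m X, actFun_mem m X.2⟩
      map_add' := fun X Y => by
        apply Subtype.ext
        ext i j : 1
        simp only [actFun, Submodule.coe_add, Matrix.mul_add, Matrix.add_mul, Matrix.add_apply,
          Matrix.map_apply, map_add]
        abel
      map_smul' := fun r X => by
        apply Subtype.ext
        ext i j : 1
        simp only [actFun, Submodule.coe_smul, Matrix.mul_smul, Matrix.smul_mul, Matrix.add_apply,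
          Matrix.smul_apply, Matrix.map_apply, map_smul, RingHom.id_apply, smul_add] }
  map_add' m n := by
    ext X : 1
    apply Subtype.ext
    ext i j : 1
    have e1 : ((m + n).1 : M2O) = (m.1 : M2O) + (n.1 : M2O) := rfl
    have e2 : ((m + n).2.1 : Module.End ℝ Octonion) = m.2.1 + n.2.1 := rfl
    have e3 : ((m + n).2.2 : Module.End ℝ Octonion) = m.2.2 + n.2.2 := rfl
    simp only [actFun, e1, e2, e3, LinearMap.coe_mk, AddHom.coe_mk, LinearMap.add_apply,
      Submodule.coe_add, Matrix.conjTranspose_add, Matrix.mul_add, Matrix.add_mul,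
      Matrix.add_apply, Matrix.map_apply]
    abel
  map_smul' r m := by
    ext X : 1
    apply Subtype.ext
    ext i j : 1
    have e1 : ((r • m).1 : M2O) = r • (m.1 : M2O) := rfl
    have e2 : ((r • m).2.1 : Module.End ℝ Octonion) = r • m.2.1.1 := rfl
    have e3 : ((r • m).2.2 : Module.End ℝ Octonion) = r • m.2.2.1 := rfl
    simp only [actFun, e1, e2, e3, LinearMap.coe_mk, AddHom.coe_mk, LinearMap.smul_apply,
      Submodule.coe_smul, Matrix.conjTranspose_smul, star_trivial, Matrix.mul_smul,
      Matrix.smul_mul, Matrix.add_apply, Matrix.smul_apply, Matrix.map_apply, smul_add,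
      RingHom.id_apply]

/-- The map `φ` from `𝔰𝔩(2,𝕆)` to `10 × 10` real matrices: the matrix of the action on
`𝔥₂(𝕆) ≅ ℝ¹⁰`. -/
def toMat : sl2O →ₗ[ℝ] Matrix (Fin 10) (Fin 10) ℝ :=
  LinearMap.toMatrix'.toLinearMap ∘ₗ coord.conj.toLinearMap ∘ₗ act

/-- The same as an endomorphism of `ℝ¹⁰`. -/
def toEnd (m : sl2O) : (Fin 10 → ℝ) →L[ℝ] (Fin 10 → ℝ) :=
  LinearMap.toContinuousLinearMap (Matrix.toLin' (toMat m))

/-- The bracket of `𝔰𝔩(2,𝕆)`, defined by `[m, n] = φ⁻¹(φ(m) φ(n) - φ(n) φ(m))`. -/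
instance : Bracket sl2O sl2O :=
  ⟨fun m n => Function.invFun toMat (toMat m * toMat n - toMat n * toMat m)⟩

/-- A derivation of the octonions, as an element of `𝔰𝔩(2,𝕆)`. -/
def ofDer (D : derO) : sl2O := ((0 : M2prime), (0 : commMaps), D)

end sl2O

/-- The matrix `η = diag(1, -1, …, -1)`. -/
def eta : Matrix (Fin 10) (Fin 10) ℝ := Matrix.diagonal fun i => if i = 0 then 1 else -1

/-- `𝔰𝔬(9,1) = {A ∈ M₁₀(ℝ) : ηA = -(ηA)ᵀ}`, under the bracket `AB - BA`. -/
def so91 : Submodule ℝ (Matrix (Fin 10) (Fin 10) ℝ) where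
  carrier := {A | eta * A = -(eta * A)ᵀ}
  add_mem' := fun {A B} h h' => by
    simp only [Set.mem_ofPred_eq] at h h' ⊢
    rw [Matrix.mul_add, Matrix.transpose_add, neg_add, ← h, ← h']
  zero_mem' := by simp
  smul_mem' := fun r A h => by
    simp only [Set.mem_ofPred_eq] at h ⊢
    rw [Matrix.mul_smul, Matrix.transpose_smul, ← smul_neg, ← h]

/-! ### The curves `G^t_{a,b}` -/

/-- `u(t) = 1/2 + √3 / (2 ‖r‖) r`, where `r = a + (4/3) ‖a‖² t b`. -/
def uCurve (a b : Octonion) (t : ℝ) : Octonion :=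
  (1 / 2 : ℝ) • (1 : Octonion) +
    (√3 / (2 * √(normSq (a + (4 / 3 * normSq a * t) • b)))) • (a + (4 / 3 * normSq a * t) • b)

/-- `G^t_{a,b}(x) = u(t)⁻¹ (u(0) (u(t) (u(0)⁻¹ x u(0)) u(t)⁻¹) u(0)⁻¹) u(t)`. -/
def gCurve (a b : Octonion) (t : ℝ) (x : Octonion) : Octonion :=
  let u := uCurve a b t
  let u₀ := uCurve a b 0
  (u⁻¹ * ((u₀ * ((u * ((u₀⁻¹ * x) * u₀)) * u⁻¹)) * u₀⁻¹)) * u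

/-- The scalar matrix `u · id`. -/
def scalarMat (u : Octonion) : M2O := !![u, 0; 0, u]

/-- `D` is the derivation `D_{a,b}(x) = [[a, b], x] - 3 [a, b, x]`. -/
def IsCanonicalDer (a b : Octonion) (D : derO) : Prop :=
  ∀ x, (D : Module.End ℝ Octonion) x =
    commutatorOf (commutatorOf a b) x - (3 : ℝ) • associatorOf a b x

/-- Two nonzero imaginary octonions that anti-commute. -/
def AnticommutingImaginary (a b : Octonion) : Prop :=
  a ≠ 0 ∧ b ≠ 0 ∧ re a = 0 ∧ re b = 0 ∧ a * b = -(b * a)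

/-- The model space of the manifold structure on `SL(2,𝕆)`. -/
abbrev E45 : Type := EuclideanSpace ℝ (Fin 45)

end

noncomputable section

open Octonion

/-! ### Euclidean and alternative structure of the octonions -/

namespace Octonion

/-! The group is shown to be the restricted Lorentz group of the form `det` on `ℝ¹⁰`: the linear
maps that preserve the form, the orientation and the direction of time
(`SL2O_eq_restrictedLorentz`).

Upper bound. A determinant-preserving `φ_M` preserves the form by polarization and the direction of
time by completing a square. The hard point is that its determinant is `+1` (`det_phi`). Two Lorentz
maps `A`, `B` with `A + B` invertible have equal determinants, because `Aᵀη(A + B) = (A + B)ᵀηB`. So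
`φ_M` is compared with a product of triangular and diagonal transformations modelled on the Schur
complement factorization of `M`; each factor is a square, hence has positive determinant.
Injectivity of the sum comes from octonion algebra. Testing the determinant on a few matrices forces
`[a,c,b] = 0`, and `[a,c,d] = 0` if `a ≠ 0`. If `ac ≠ ca`, all four entries then lie in the
associative algebra generated by `a` and `c`, where `φ_M` behaves as over the quaternions, while on
the orthogonal complement the Cayley–Dickson rules turn it into a left multiplication. If real
column operations and transposition never produce a noncommuting first column, all entries commute,
so they share one imaginary direction, and the comparison takes place in one associative algebra.

Lower bound. A Hermitian `V` shares one direction, and for `det V = ±1` the map `η φ_V` is, up to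
sign, a Lorentz reflection (`coord_phi_hermOf`). One such map brings the image of the time axis
back, and Householder reflections reduce the rest to `1` or `η`; the determinant excludes `η`.
Inverses of these maps are of the same kind, so finite compositions suffice.

Lie structure. The Cayley transform is a chart of `GL(10,ℝ)` at `1` that straightens the Lorentz
group to the skew endomorphisms; where it is defined the determinant is automatically `1`. Left
translates of this slice give the embedded Lie group, and symmetry of second derivatives gives the
bracket. On the algebra side, skewness fixes the shape of an endomorphism of `𝔥₂(𝕆)` up to a skew
map of `𝕆` that kills `1`, and such maps are exactly `C(𝕆') ⊕ Der(𝕆)`: seven linear relations cut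
out the derivations, and the `C_d` realize every value of the seven defects.

Curves. Differentiating `G^t` at `0` reduces to one identity in `a`, `b`, `x` (`tangent_identity`).
Spanning follows from `∑ₖ D_{eₖ, D eₖ} = 12 D`. -/

@[simp] theorem sub_x0 (x y : Octonion) : (x - y).x0 = x.x0 - y.x0 := by
  rw [sub_eq_add_neg]; simp [sub_eq_add_neg]
@[simp] theorem sub_x1 (x y : Octonion) : (x - y).x1 = x.x1 - y.x1 := by
  rw [sub_eq_add_neg]; simp [sub_eq_add_neg]
@[simp] theorem sub_x2 (x y : Octonion) : (x - y).x2 = x.x2 - y.x2 := by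
  rw [sub_eq_add_neg]; simp [sub_eq_add_neg]
@[simp] theorem sub_x3 (x y : Octonion) : (x - y).x3 = x.x3 - y.x3 := by
  rw [sub_eq_add_neg]; simp [sub_eq_add_neg]
@[simp] theorem sub_x4 (x y : Octonion) : (x - y).x4 = x.x4 - y.x4 := by
  rw [sub_eq_add_neg]; simp [sub_eq_add_neg]
@[simp] theorem sub_x5 (x y : Octonion) : (x - y).x5 = x.x5 - y.x5 := by
  rw [sub_eq_add_neg]; simp [sub_eq_add_neg]
@[simp] theorem sub_x6 (x y : Octonion) : (x - y).x6 = x.x6 - y.x6 := by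
  rw [sub_eq_add_neg]; simp [sub_eq_add_neg]
@[simp] theorem sub_x7 (x y : Octonion) : (x - y).x7 = x.x7 - y.x7 := by
  rw [sub_eq_add_neg]; simp [sub_eq_add_neg]

/-- The Euclidean inner product of octonions. -/
def ip (x y : Octonion) : ℝ :=
  x.x0 * y.x0 + x.x1 * y.x1 + x.x2 * y.x2 + x.x3 * y.x3
    + x.x4 * y.x4 + x.x5 * y.x5 + x.x6 * y.x6 + x.x7 * y.x7

theorem ip_comm (x y : Octonion) : ip x y = ip y x := by simp only [ip]; ring

theorem ip_add_left (x y z : Octonion) : ip (x + y) z = ip x z + ip y z := by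
  simp [ip]; ring
theorem ip_add_right (x y z : Octonion) : ip x (y + z) = ip x y + ip x z := by
  simp [ip]; ring
theorem ip_sub_left (x y z : Octonion) : ip (x - y) z = ip x z - ip y z := by
  simp [ip]; ring
theorem ip_sub_right (x y z : Octonion) : ip x (y - z) = ip x y - ip x z := by
  simp [ip]; ring
theorem ip_smul_left (r : ℝ) (x y : Octonion) : ip (r • x) y = r * ip x y := by
  simp [ip]; ring
theorem ip_smul_right (r : ℝ) (x y : Octonion) : ip x (r • y) = r * ip x y := by
  simp [ip]; ring
theorem ip_neg_left (x y : Octonion) : ip (-x) y = -ip x y := by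
  simp [ip]; ring
theorem ip_neg_right (x y : Octonion) : ip x (-y) = -ip x y := by
  simp [ip]; ring
@[simp] theorem ip_zero_left (x : Octonion) : ip 0 x = 0 := by simp [ip]
@[simp] theorem ip_zero_right (x : Octonion) : ip x 0 = 0 := by simp [ip]

theorem ip_self (x : Octonion) : ip x x = normSq x := by simp only [ip, normSq]; ring

theorem normSq_nonneg (x : Octonion) : 0 ≤ normSq x := by simp only [normSq]; positivity

theorem normSq_eq_zero {x : Octonion} : normSq x = 0 ↔ x = 0 := by
  constructor
  · intro h
    simp only [normSq] at h
    have h' : ∀ r : ℝ, 0 ≤ r ^ 2 := fun r => sq_nonneg r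
    ext <;> simp only [zero_x0, zero_x1, zero_x2, zero_x3, zero_x4, zero_x5, zero_x6, zero_x7] <;>
      rw [← pow_eq_zero_iff (two_ne_zero)] <;>
      linarith [h' x.x0, h' x.x1, h' x.x2, h' x.x3, h' x.x4, h' x.x5, h' x.x6, h' x.x7]
  · rintro rfl; simp [normSq]

theorem normSq_pos {x : Octonion} (h : x ≠ 0) : 0 < normSq x :=
  lt_of_le_of_ne (normSq_nonneg x) fun h' => h (normSq_eq_zero.1 h'.symm)

theorem eq_of_ip_right {x y : Octonion} (h : ∀ z, ip x z = ip y z) : x = y := by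
  rw [← sub_eq_zero, ← normSq_eq_zero, ← ip_self, ip_sub_left, h, sub_self]

theorem eq_zero_of_ip {x : Octonion} (h : ∀ z, ip x z = 0) : x = 0 :=
  eq_of_ip_right (by simpa using h)

@[simp] theorem normSq_zero : normSq 0 = 0 := normSq_eq_zero.2 rfl
@[simp] theorem normSq_one : normSq 1 = 1 := by simp [normSq]
@[simp] theorem normSq_star (x : Octonion) : normSq (star x) = normSq x := by simp [normSq]
theorem normSq_smul (r : ℝ) (x : Octonion) : normSq (r • x) = r ^ 2 * normSq x := by
  simp [normSq]; ring

theorem normSq_add (x y : Octonion) : normSq (x + y) = normSq x + 2 * ip x y + normSq y := by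
  simp only [← ip_self, ip_add_left, ip_add_right, ip_comm y x]; ring

theorem normSq_sub (x y : Octonion) : normSq (x - y) = normSq x - 2 * ip x y + normSq y := by
  simp only [← ip_self, ip_sub_left, ip_sub_right, ip_comm y x]; ring

theorem star_eq (x : Octonion) : star x = (2 * re x) • (1 : Octonion) - x := by
  ext <;> simp [re]; ring

theorem re_eq_ip (x : Octonion) : re x = ip x 1 := by simp [re, ip]

/-- From this coordinate identity, its mirror images under conjugation and its polarization come the
alternative laws and the Cayley–Dickson rules. -/
theorem star_mul_mul (x y : Octonion) : star x * (x * y) = normSq x • y := by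
  ext <;> simp [normSq] <;> ring

theorem mul_star_mul (x y : Octonion) : x * (star x * y) = normSq x • y := by
  simpa using star_mul_mul (star x) y
theorem mul_mul_star (x y : Octonion) : (y * x) * star x = normSq x • y := by
  simpa using congrArg star (mul_star_mul x (star y))
theorem mul_star_mul' (x y : Octonion) : (y * star x) * x = normSq x • y := by
  simpa using mul_mul_star (star x) y
theorem mul_star_self (x : Octonion) : x * star x = normSq x • (1 : Octonion) := by
  simpa using mul_mul_star x 1
theorem star_mul_self (x : Octonion) : star x * x = normSq x • (1 : Octonion) := by
  simpa using mul_star_mul' x 1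

theorem normSq_mul (x y : Octonion) : normSq (x * y) = normSq x * normSq y := by
  simp only [normSq, mul_x0, mul_x1, mul_x2, mul_x3, mul_x4, mul_x5, mul_x6, mul_x7]; ring

/-! The adjoints of left and right multiplications. -/

theorem ip_star (x y : Octonion) : ip (star x) (star y) = ip x y := by simp [ip]

theorem ip_mul_left (x y z : Octonion) : ip (x * y) z = ip y (star x * z) := by
  simp [ip]; ring
theorem ip_mul_right (x y z : Octonion) : ip (x * y) z = ip x (z * star y) := by
  rw [← ip_star, star_mul, ip_mul_left, ← ip_star x]
  simp
theorem ip_mul_mul_left (x y z : Octonion) : ip (x * y) (x * z) = normSq x * ip y z := by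
  rw [ip_mul_left, star_mul_mul, ip_smul_right]
theorem ip_mul_mul_right (x y z : Octonion) : ip (y * x) (z * x) = normSq x * ip y z := by
  rw [ip_mul_right, mul_mul_star, ip_smul_right]

/-- The linearized form of `x̄ (x z) = ‖x‖² z`. -/
theorem star_mul_mul_add (x y z : Octonion) :
    star x * (y * z) + star y * (x * z) = (2 * ip x y) • z := by
  have h := star_mul_mul (x + y) z
  rw [normSq_add, star_add] at h
  simp only [add_mul, mul_add, star_mul_mul, add_smul] at h
  have h' : normSq x • z + (star x * (y * z) + star y * (x * z)) + normSq y • z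
      = normSq x • z + (2 * ip x y) • z + normSq y • z := by rw [← h]; abel
  exact add_left_cancel (add_right_cancel h')
theorem mul_mul_star_add (x y z : Octonion) :
    (z * y) * star x + (z * x) * star y = (2 * ip x y) • z := by
  have h := congrArg star (star_mul_mul_add (star x) (star y) (star z))
  simpa [ip_star] using h

theorem mul_star_add (x y : Octonion) :
    x * star y + y * star x = (2 * ip x y) • (1 : Octonion) := by
  simpa [add_comm] using mul_mul_star_add x y 1

theorem associatorOf_add_left (a b c d : Octonion) :
    associatorOf (a + b) c d = associatorOf a c d + associatorOf b c d := by
  simp only [associatorOf, add_mul]; abel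
theorem associatorOf_smul_left (r : ℝ) (a c d : Octonion) :
    associatorOf (r • a) c d = r • associatorOf a c d := by
  simp only [associatorOf, smul_mul_assoc, smul_sub]
theorem associatorOf_add_mid (a b c d : Octonion) :
    associatorOf c (a + b) d = associatorOf c a d + associatorOf c b d := by
  simp only [associatorOf, add_mul, mul_add]; abel
theorem associatorOf_add_right (a b c d : Octonion) :
    associatorOf c d (a + b) = associatorOf c d a + associatorOf c d b := by
  simp only [associatorOf, mul_add]; abel
theorem associatorOf_smul_right (r : ℝ) (a c d : Octonion) :
    associatorOf c d (r • a) = r • associatorOf c d a := by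
  simp only [associatorOf, smul_sub, mul_smul_comm]
@[simp] theorem associatorOf_one_left (a b : Octonion) : associatorOf 1 a b = 0 := by
  simp [associatorOf]
@[simp] theorem associatorOf_one_right (a b : Octonion) : associatorOf a b 1 = 0 := by
  simp [associatorOf]

theorem star_associatorOf' (a b c : Octonion) :
    star (associatorOf a b c) = -associatorOf (star c) (star b) (star a) := by
  simp [associatorOf]

/-- Substituting `x̄ = 2 Re x - x` into `x̄(xy) = (x̄x)y` cancels the real part. -/
theorem left_alt (x y : Octonion) : x * (x * y) = (x * x) * y := by
  have h := star_mul_mul x y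
  have h' := congrArg (· * y) (star_mul_self x)
  simp only [star_eq, sub_mul, smul_mul_assoc, one_mul] at h h'
  exact sub_right_injective (h.trans h'.symm)
theorem right_alt (x y : Octonion) : (y * x) * x = y * (x * x) := by
  simpa using congrArg star (left_alt (star x) (star y))

@[simp] theorem associatorOf_self_left (a b : Octonion) : associatorOf a a b = 0 := by
  rw [associatorOf, ← left_alt, sub_self]
@[simp] theorem associatorOf_self_right (a b : Octonion) : associatorOf a b b = 0 := by
  rw [associatorOf, right_alt, sub_self]

theorem associatorOf_swap_left (a b c : Octonion) :
    associatorOf a b c = -associatorOf b a c := by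
  have h := associatorOf_self_left (a + b) c
  rw [associatorOf_add_left, associatorOf_add_mid, associatorOf_add_mid, associatorOf_self_left,
    associatorOf_self_left, zero_add, add_zero] at h
  exact eq_neg_of_add_eq_zero_left h
theorem associatorOf_swap_right (a b c : Octonion) :
    associatorOf a b c = -associatorOf a c b := by
  have h := associatorOf_self_right a (b + c)
  rw [associatorOf_add_right, associatorOf_add_mid, associatorOf_add_mid, associatorOf_self_right,
    associatorOf_self_right, zero_add, add_zero] at h
  exact eq_neg_of_add_eq_zero_right h
theorem associatorOf_rotate (a b c : Octonion) :
    associatorOf a b c = associatorOf b c a := by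
  rw [associatorOf_swap_left, associatorOf_swap_right b a c, neg_neg]
@[simp] theorem associatorOf_self_outer (a b : Octonion) : associatorOf a b a = 0 := by
  rw [associatorOf_swap_left, associatorOf_self_right, neg_zero]
theorem flexible (x y : Octonion) : (x * y) * x = x * (y * x) :=
  sub_eq_zero.1 (associatorOf_self_outer x y)

theorem associatorOf_star_left (a b c : Octonion) :
    associatorOf (star a) b c = -associatorOf a b c := by
  rw [star_eq, sub_eq_add_neg, ← neg_one_smul ℝ a, associatorOf_add_left, associatorOf_smul_left,
    associatorOf_smul_left, associatorOf_one_left, smul_zero, zero_add, neg_one_smul]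
theorem associatorOf_star_mid (a b c : Octonion) :
    associatorOf a (star b) c = -associatorOf a b c := by
  rw [associatorOf_swap_left, associatorOf_star_left, ← associatorOf_swap_left]
theorem associatorOf_star_right (a b c : Octonion) :
    associatorOf a b (star c) = -associatorOf a b c := by
  rw [associatorOf_swap_right, associatorOf_star_mid, neg_neg, ← neg_neg (associatorOf a c b),
    ← associatorOf_swap_right]
theorem star_associatorOf (a b c : Octonion) :
    star (associatorOf a b c) = -associatorOf a b c := by
  rw [star_associatorOf', associatorOf_star_left, associatorOf_star_mid, associatorOf_star_right,
    neg_neg, neg_neg, associatorOf_rotate, associatorOf_swap_right, ← associatorOf_rotate]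
-- Left multiplications are moved to the other side as adjoints. Together with the alternation of
-- the associator this makes `⟨[a,b,c], d⟩` alternating in all four variables.
theorem ip_associatorOf_swap (a b c d : Octonion) :
    ip (associatorOf a b c) d = -ip (associatorOf a b d) c := by
  rw [associatorOf, ip_sub_left, ip_mul_left (a * b), ip_mul_left a, ip_mul_left b, star_mul,
    ← ip_sub_right]
  have h : star b * (star a * d) - star b * star a * d = associatorOf a b d := by
    rw [← neg_neg (associatorOf a b d), ← associatorOf_star_left, ← associatorOf_star_mid,
      associatorOf_swap_left, associatorOf, neg_sub]
  rw [← neg_sub, h, ip_neg_right, ip_comm]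

theorem mul_eq_zero_iff {x y : Octonion} : x * y = 0 ↔ x = 0 ∨ y = 0 := by
  rw [← normSq_eq_zero, normSq_mul, _root_.mul_eq_zero, normSq_eq_zero, normSq_eq_zero]

theorem ip_associatorOf_mid (a b c : Octonion) : ip (associatorOf a b c) b = 0 := by
  rw [ip_associatorOf_swap, associatorOf_self_right, ip_zero_left, neg_zero]
theorem ip_associatorOf_right (a b c : Octonion) : ip (associatorOf a b c) c = 0 := by
  rw [associatorOf_rotate, ip_associatorOf_mid]
/-- The associator is orthogonal to products of two of its entries. -/
theorem ip_associatorOf_mul (a b c : Octonion) : ip (associatorOf a b c) (b * c) = 0 := by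
  have h : ∀ x : Octonion, ip (a * x) x = normSq x * ip a 1 := fun x => by
    simpa using ip_mul_mul_right x a 1
  rw [associatorOf, ip_sub_left, ip_mul_mul_right, h, h, normSq_mul]
  ring

end Octonion

/-! ### Hermitian matrices by entries and the formula for `φ_M` -/

namespace Octonion

theorem add_star_self (z : Octonion) : z + star z = (2 * re z) • (1 : Octonion) := by
  rw [star_eq, add_sub_cancel]

theorem re_mul_star (x y : Octonion) : re (x * star y) = ip x y := by
  rw [re_eq_ip, ip_mul_right, star_star, one_mul]

end Octonion

/-- The Hermitian matrix with rows `(α, x)` and `(x̄, β)`. -/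
def hm (α : ℝ) (x : Octonion) (β : ℝ) : h2O :=
  ⟨!![α • (1 : Octonion), x; star x, β • (1 : Octonion)], by
    rw [mem_h2O]
    ext i j : 1
    fin_cases i <;> fin_cases j <;> simp [Matrix.conjTranspose_apply]⟩

theorem eq_hm {X : h2O} {α β : ℝ} {x : Octonion} (h0 : (X : M2O) 0 0 = α • (1 : Octonion))
    (h1 : (X : M2O) 0 1 = x) (h2 : (X : M2O) 1 1 = β • (1 : Octonion)) : X = hm α x β := by
  apply Subtype.ext
  have hX := mem_h2O.1 X.2
  have e10 : star ((X : M2O) 0 1) = (X : M2O) 1 0 := congrFun (congrFun hX 1) 0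
  rw [Matrix.eta_fin_two (X : M2O), ← e10, h0, h1, h2]
  rfl

theorem exists_hm (X : h2O) : ∃ α x β, X = hm α x β := by
  have hX := mem_h2O.1 X.2
  have e00 : star ((X : M2O) 0 0) = (X : M2O) 0 0 := congrFun (congrFun hX 0) 0
  have e11 : star ((X : M2O) 1 1) = (X : M2O) 1 1 := congrFun (congrFun hX 1) 1
  exact ⟨_, _, _, eq_hm (eq_re_of_star e00) rfl (eq_re_of_star e11)⟩

theorem hm_injective {α α' β β' : ℝ} {x x' : Octonion} (h : hm α x β = hm α' x' β') :
    α = α' ∧ x = x' ∧ β = β' := by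
  have h' := congrArg (fun X : h2O => (X : M2O)) h
  refine ⟨?_, congrFun (congrFun h' 0) 1, ?_⟩
  · have := congrArg Octonion.x0 (congrFun (congrFun h' 0) 0)
    simpa [hm] using this
  · have := congrArg Octonion.x0 (congrFun (congrFun h' 1) 1)
    simpa [hm] using this

theorem hm_add (α α' β β' : ℝ) (x x' : Octonion) :
    hm α x β + hm α' x' β' = hm (α + α') (x + x') (β + β') :=
  eq_hm (by simp [hm, add_smul]) (by simp [hm]) (by simp [hm, add_smul])

theorem smul_hm (r α β : ℝ) (x : Octonion) : r • hm α x β = hm (r * α) (r • x) (r * β) :=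
  eq_hm (by simp [hm, mul_smul]) (by simp [hm]) (by simp [hm, mul_smul])

theorem hm_zero : hm 0 0 0 = 0 := (eq_hm (by simp) (by simp) (by simp)).symm

theorem hdet_hm (α β : ℝ) (x : Octonion) : hdet (hm α x β) = α * β - normSq x := by
  simp [hdet, hm, re, normSq]; ring

theorem coord_hm (α β : ℝ) (x : Octonion) : coord (hm α x β) =
    ![(α + β) / 2, x.x0, x.x1, x.x2, x.x3, x.x4, x.x5, x.x6, x.x7, (α - β) / 2] := by
  change coordOf (hm α x β : M2O) = _
  simp [coordOf, hm, re]

theorem phi_hm (a b c d x : Octonion) (α β : ℝ) : phi !![a, b; c, d] (hm α x β) =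
    hm (α * normSq a + β * normSq b + 2 * ip (a * x) b)
      (α • (a * star c) + β • (b * star d)
        + (1 / 2 : ℝ) • ((b * star x) * star c + b * (star x * star c)
          + (a * x) * star d + a * (x * star d)))
      (α * normSq c + β * normSq d + 2 * ip (c * x) d) := by
  -- The four cross terms are two pairs `z + z̄`, with `z = (ax)b̄` and `z = a(xb̄)`; both have real
  -- part `⟨ax, b⟩`.
  have key : ∀ a b : Octonion, b * star x * star a + a * x * star b
      + (a * (x * star b) + b * (star x * star a)) = (4 * ip (a * x) b) • (1 : Octonion) := by
    intro a b
    have h1 := add_star_self (a * x * star b)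
    have h2 := add_star_self (a * (x * star b))
    rw [re_mul_star] at h1
    rw [← star_star (x * star b), re_mul_star, star_mul, star_star, ← ip_mul_right] at h2
    simp only [star_mul, star_star] at h1 h2
    have h3 := congrArg₂ (· + ·) h1 h2
    simp only [← add_smul] at h3
    rw [show 4 * ip (a * x) b = 2 * ip (a * x) b + 2 * ip (a * x) b by ring, ← h3]
    abel
  -- Octonion products are replaced by variables, so that `module` only has to handle real linear
  -- combinations.
  have atoms : ∀ (r s : ℝ) (e p q u v : Octonion), (1 / 2 : ℝ) • (α • r • e + p + (q + β • s • e)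
      + (α • r • e + u + (v + β • s • e))) = (α * r + β * s) • e + (1 / 2 : ℝ) • (p + q + (u + v)) := by
    intros; module
  have atoms' : ∀ e f p q u v : Octonion, (1 / 2 : ℝ) • (α • e + p + (q + β • f)
      + (α • e + u + (v + β • f))) = α • e + β • f + (1 / 2 : ℝ) • (p + v + q + u) := by
    intros; module
  have ent : ∀ a b : Octonion, ((1 / 2 : ℝ) • ((α • a + b * star x) * star a
      + (a * x + β • b) * star b + (a * (α • star a + x * star b)
      + b * (star x * star a + β • star b)))) =
      (α * normSq a + β * normSq b + 2 * ip (a * x) b) • (1 : Octonion) := by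
    intro a b
    have h := key a b
    simp only [add_mul, mul_add, smul_mul_assoc, mul_smul_comm, mul_star_self]
    have h' : (1 / 2 : ℝ) • (b * star x * star a + a * x * star b
      + (a * (x * star b) + b * (star x * star a))) = (2 * ip (a * x) b) • (1 : Octonion) := by
      rw [h, smul_smul]; congr 1; ring
    rw [add_smul, ← h']
    exact atoms _ _ _ _ _ _ _
  have off : (1 / 2 : ℝ) • ((α • a + b * star x) * star c + (a * x + β • b) * star d
      + (a * (α • star c + x * star d) + b * (star x * star c + β • star d))) =
      α • (a * star c) + β • (b * star d) + (1 / 2 : ℝ) • ((b * star x) * star c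
        + b * (star x * star c) + (a * x) * star d + a * (x * star d)) := by
    simp only [add_mul, mul_add, smul_mul_assoc, mul_smul_comm]
    exact atoms' _ _ _ _ _ _
  have hmul : ∀ p q r s : Octonion, ((phi !![p, q; r, s] (hm α x β) : h2O) : M2O) =
      (1 / 2 : ℝ) • (!![α • p + q * star x, p * x + β • q; α • r + s * star x, r * x + β • s]
          * !![star p, star r; star q, star s] + !![p, q; r, s] *
        !![α • star p + x * star q, α • star r + x * star s;
          star x * star p + β • star q, star x * star r + β • star s]) := by
    intro p q r s
    have h1 : (!![p, q; r, s])ᴴ = !![star p, star r; star q, star s] := by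
      ext i j : 1
      fin_cases i <;> fin_cases j <;> rfl
    simp only [phi, hm, LinearMap.coe_mk, AddHom.coe_mk, h1, Matrix.mul_fin_two, mul_smul_comm,
      smul_mul_assoc, mul_one, one_mul]
  apply eq_hm
  · rw [hmul, Matrix.mul_fin_two, Matrix.mul_fin_two]
    exact ent a b
  · rw [hmul, Matrix.mul_fin_two, Matrix.mul_fin_two]
    exact off
  · rw [hmul, Matrix.mul_fin_two, Matrix.mul_fin_two]
    exact ent c d

/-- The contribution of the off-diagonal entry `x` to the off-diagonal entry of `φ_M(X)`. -/
def phiOff (a b c d x : Octonion) : Octonion :=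
  (1 / 2 : ℝ) • ((b * star x) * star c + b * (star x * star c)
    + (a * x) * star d + a * (x * star d))

theorem phi_hm' (a b c d x : Octonion) (α β : ℝ) : phi !![a, b; c, d] (hm α x β) =
    hm (α * normSq a + β * normSq b + 2 * ip (a * x) b)
      (α • (a * star c) + β • (b * star d) + phiOff a b c d x)
      (α * normSq c + β * normSq d + 2 * ip (c * x) d) := phi_hm a b c d x α β

/-! ### Associator conditions forced by preservation of the determinant -/

namespace Octonion

theorem mul_add_mul_comm (x y : Octonion) :
    x * y + y * x = (2 * ip x (star y) - 4 * re x * re y) • (1 : Octonion)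
      + (2 * re y) • x + (2 * re x) • y := by
  have h := mul_star_add x (star y)
  have h2 : star y * star x = (4 * re x * re y) • (1 : Octonion) - (2 * re y) • x
      - (2 * re x) • y + y * x := by
    have aux : ∀ (r s : ℝ) (e x y p : Octonion), (r • s • e - r • x) - (s • y - p)
        = (s * r) • e - r • x - s • y + p := by intros; module
    rw [star_eq, star_eq x, sub_mul, mul_sub, mul_sub, smul_mul_assoc, smul_mul_assoc,
      mul_smul_comm, mul_smul_comm, mul_one, one_mul, mul_one, aux]
    congr 4; ring
  rw [star_star, h2] at h
  have aux : ∀ (r s t u : ℝ) (e x y p q : Octonion), p + (s • e - t • x - u • y + q) = r • e →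
      p + q = (r - s) • e + t • x + u • y := by
    intro r s t u e x y p q h
    rw [sub_smul, ← h]; abel
  exact aux _ _ _ _ _ _ _ _ _ h

theorem ip_associatorOf_mul' (a b c : Octonion) : ip (associatorOf a b c) (a * b) = 0 := by
  rw [← associatorOf_rotate, ip_associatorOf_mul]

theorem ip_associatorOf_mul'' (a b c : Octonion) : ip (associatorOf a b c) (a * c) = 0 := by
  rw [associatorOf_swap_right, ip_neg_left, ip_associatorOf_mul', neg_zero]

/-- The products `(ab)c` and `a(bc) = (ab)c - [a,b,c]` have the same norm, which fixes the cross
term. -/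
theorem ip_associatorOf_mul_mul (a b c : Octonion) :
    ip ((a * b) * c) (associatorOf a b c) = normSq (associatorOf a b c) / 2 := by
  have h1 : a * (b * c) = (a * b) * c - associatorOf a b c := by rw [associatorOf]; abel
  have h2 := congrArg normSq h1
  rw [normSq_sub, normSq_mul, normSq_mul, normSq_mul, normSq_mul] at h2
  linarith

/-- The associator `[a, b, c]` has inner product `½‖[a, b, c]‖²` with `b (a c)`. -/
theorem ip_mul_associatorOf (a b c : Octonion) :
    ip (b * (a * c)) (associatorOf a b c) = normSq (associatorOf a b c) / 2 := by
  have h1 : b * (a * c) = (b * a) * c + associatorOf a b c := by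
    rw [associatorOf_swap_left a b c, associatorOf]; abel
  have h2 := congrArg (fun z => ip (z * c) (associatorOf a b c)) (mul_add_mul_comm a b)
  simp only [add_mul, smul_mul_assoc, one_mul, ip_add_left, ip_smul_left] at h2
  rw [ip_associatorOf_mul_mul, ip_comm c, ip_comm (a * c), ip_comm (b * c),
    ip_associatorOf_right, ip_associatorOf_mul, ip_associatorOf_mul''] at h2
  rw [h1, ip_add_left, ip_self]
  linarith

end Octonion

variable {a b c d : Octonion}

/-- Test on the identity matrix. -/
theorem preservesDet_scalar (h : PreservesDet !![a, b; c, d]) :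
    normSq a * normSq d + normSq b * normSq c - 2 * ip (a * star c) (b * star d) = 1 := by
  have h1 := h (hm 1 0 1)
  rw [phi_hm', hdet_hm, hdet_hm] at h1
  simp only [phiOff, star_zero, mul_zero, zero_mul, smul_zero, add_zero, ip_zero_left, one_mul,
    one_smul, normSq_add, normSq_mul, normSq_star, normSq_zero] at h1
  linarith

/-- Test on matrices with zero diagonal. -/
theorem preservesDet_off (h : PreservesDet !![a, b; c, d]) (x : Octonion) :
    normSq (phiOff a b c d x) - 4 * ip (a * x) b * ip (c * x) d = normSq x := by
  have h1 := h (hm 0 x 0)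
  rw [phi_hm', hdet_hm, hdet_hm] at h1
  simp only [zero_mul, zero_smul, zero_add] at h1
  linarith

theorem ip_phiOff (x : Octonion) : 2 * ip (a * star c) (phiOff a b c d x) =
    normSq c * ip (a * x) b + ip (a * star c) (b * (star x * star c))
      + ip (a * star c) ((a * x) * star d) + normSq a * ip (c * x) d := by
  rw [phiOff, ip_smul_right, ip_add_right, ip_add_right, ip_add_right, ip_mul_mul_right,
    ip_mul_mul_left, ip_mul_right a x b, normSq_star, ip_mul_left c x d,
    show ip (star c) (x * star d) = ip x (star c * d) by rw [ip_comm, ip_mul_right, star_star]]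
  ring

/-- Test on the matrix with diagonal `(1, 0)` and off-diagonal entry `x`. Subtracting the test with
zero diagonal leaves a linear form in `x`, whose vanishing is an identity of two associators. -/
theorem preservesDet_mixed (h : PreservesDet !![a, b; c, d]) :
    star a * associatorOf a c d = star c * associatorOf a c b := by
  apply eq_of_ip_right
  intro x
  have h1 := h (hm 1 x 0)
  have h0 := preservesDet_off h x
  have h2 := ip_phiOff (a := a) (b := b) (c := c) (d := d) x
  rw [phi_hm', hdet_hm, hdet_hm] at h1
  simp only [zero_mul, zero_smul, add_zero, one_mul, one_smul, normSq_add, normSq_mul,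
    normSq_star] at h1
  have e1 : ip (star a * associatorOf a c d) x =
      normSq a * ip (c * x) d - ip (a * star c) ((a * x) * star d) := by
    rw [show associatorOf a c d = -associatorOf a (star c) d by
      rw [associatorOf_star_mid, neg_neg], associatorOf, neg_sub, mul_sub, star_mul_mul,
      ip_sub_left, ip_smul_left, ip_mul_left c x d, ip_comm x,
      ip_comm (a * star c), ip_mul_right (a * x), star_star, ip_mul_left a x, ip_comm x]
  have e2 : ip (star c * associatorOf a c b) x =
      -(normSq c * ip (a * x) b - ip (a * star c) (b * (star x * star c))) := by
    rw [show associatorOf a c b = associatorOf c (star a) b by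
      rw [associatorOf_star_mid, associatorOf_swap_left], associatorOf, mul_sub, star_mul_mul,
      ip_sub_left, ip_smul_left, ip_mul_left a x b, ip_comm x (star a * b),
      ip_comm (a * star c), ip_mul_left b, ip_mul_right (star x),
      ← ip_star (star x), star_star, star_mul, star_mul, star_mul, star_star, star_star,
      star_star, ip_comm x]
    ring
  rw [e1, e2]
  linarith

/-- The off-diagonal test at `x = ā`, where `a x` is real and the failure of associativity is the
single associator `w = [b,a,c]`. The scalar condition removes the terms without `w`. -/
theorem preservesDet_quadratic (h : PreservesDet !![a, b; c, d]) :
    normSq (associatorOf a c b) = 4 * normSq a * ip (associatorOf a c b) d := by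
  have hD := preservesDet_off h (star a)
  have hC := preservesDet_scalar h
  rw [← associatorOf_rotate b a c]
  set w := associatorOf b a c with hw
  set q := b * (a * star c) with hq
  have hp : (b * a) * star c = q - w := by
    have := associatorOf_star_right b a c
    rw [associatorOf, ← hw] at this
    rw [sub_eq_iff_eq_add.1 this, sub_eq_neg_add]
  have hqn : normSq q = normSq b * (normSq a * normSq c) := by
    rw [hq, normSq_mul, normSq_mul, normSq_star]
  have hqw : ip q w = normSq w / 2 := by
    have h2 := congrArg normSq hp
    rw [normSq_sub, hqn, normSq_mul, normSq_mul, normSq_star] at h2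
    linarith
  have hoff : phiOff a b c d (star a) = q - (1 / 2 : ℝ) • w + normSq a • star d := by
    have aux : ∀ (r : ℝ) (e f g : Octonion), (1 / 2 : ℝ) • (e - f + e + r • g + r • g)
        = e - (1 / 2 : ℝ) • f + r • g := by intros; module
    rw [phiOff, star_star, hp, mul_star_self, mul_star_mul, smul_mul_assoc, one_mul, ← hq, aux]
  have hwd : ip w (star d) = -ip w d := by
    rw [← ip_star, star_star, hw, star_associatorOf, ip_neg_left]
  -- After moving `b` to the other side, the two terms combine through `b̄ + b = 2 Re b`.
  have hqd : ip q (star d) + ip (a * star c) (b * star d) = 2 * re b * ip (c * star a) d := by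
    rw [hq, ip_mul_left, ← ip_add_right, ← add_mul, add_comm, add_star_self, smul_mul_assoc,
      one_mul, ip_smul_right, ← ip_star, star_mul, star_star, star_star]
  rw [hoff, normSq_add, normSq_sub, normSq_smul, normSq_smul, ip_sub_left, ip_smul_left,
    ip_smul_right, ip_smul_right, ip_smul_right, hqw, hwd, hqn, normSq_star, normSq_star,
    mul_star_self, ip_smul_left, ip_comm 1, ← re_eq_ip] at hD
  linear_combination (-4) * hD + 4 * normSq a * hC + 8 * normSq a * hqd

/-- If `φ_M` preserves the determinant, the associators of the first column with the other
entries vanish. -/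
theorem preservesDet_associator (h : PreservesDet !![a, b; c, d]) :
    associatorOf a c b = 0 := by
  have h1 := preservesDet_quadratic h
  -- With `w = [a,c,b]`, multiplying the mixed condition by `a` and pairing with `b` gives `‖w‖² =
  -- 2‖a‖²⟨w, d⟩`. The quadratic condition has `4` in place of `2`, so `w = 0`.
  have h2 := congrArg (fun z => ip (a * z) b) (preservesDet_mixed h)
  simp only [mul_star_mul, ip_smul_left] at h2
  rw [ip_associatorOf_swap, ip_mul_left, ip_mul_left, star_star, star_eq a, sub_mul,
    smul_mul_assoc, one_mul, mul_sub, mul_smul_comm, ip_sub_right, ip_smul_right,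
    ip_associatorOf_mul, ip_comm _ (c * (a * b)), ip_mul_associatorOf] at h2
  rw [← normSq_eq_zero]
  linarith

theorem preservesDet_associator' (h : PreservesDet !![a, b; c, d]) (ha : a ≠ 0) :
    associatorOf a c d = 0 := by
  have h1 := preservesDet_mixed h
  rw [preservesDet_associator h, mul_zero, Octonion.mul_eq_zero_iff] at h1
  rcases h1 with h1 | h1
  · exact absurd (star_eq_zero.1 h1) ha
  · exact h1

/-! ### Algebras generated by two octonions and their orthogonal complements -/

namespace Octonion

theorem mul_self_eq (x : Octonion) : x * x = (2 * re x) • x - normSq x • (1 : Octonion) := by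
  have h := mul_star_self x
  rw [star_eq, mul_sub, mul_smul_comm, mul_one] at h
  rw [← h, sub_sub_cancel]

theorem associatorOf_mul_right (p r : Octonion) : associatorOf p r (p * r) = 0 :=
  eq_zero_of_ip fun z => by rw [ip_associatorOf_swap, ip_associatorOf_mul', neg_zero]

/-- The subalgebra generated by two octonions, as a subspace. -/
def alg (p r : Octonion) : Submodule ℝ Octonion := Submodule.span ℝ {1, p, r, p * r}

section alg
variable {p r : Octonion}

theorem one_mem_alg : 1 ∈ alg p r := Submodule.subset_span (by simp)
theorem left_mem_alg : p ∈ alg p r := Submodule.subset_span (by simp)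
theorem right_mem_alg : r ∈ alg p r := Submodule.subset_span (by simp)
theorem mul_mem_alg' : p * r ∈ alg p r := Submodule.subset_span (by simp)

theorem alg_induction {P : Octonion → Prop} (h1 : P 1) (hp : P p) (hr : P r) (hpr : P (p * r))
    (hadd : ∀ x y, P x → P y → P (x + y)) (hsmul : ∀ (t : ℝ) x, P x → P (t • x)) {x : Octonion}
    (hx : x ∈ alg p r) : P x := by
  refine Submodule.span_induction (p := fun x _ => P x) ?_ ?_ (fun x y _ _ => hadd x y)
    (fun t x _ => hsmul t x) hx
  · rintro x (rfl | rfl | rfl | rfl) <;> assumption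
  · simpa using hsmul 0 1 h1

theorem mul_self_mem_alg {x : Octonion} (hx : x ∈ alg p r) : x * x ∈ alg p r := by
  rw [mul_self_eq]
  exact sub_mem (Submodule.smul_mem _ _ hx) (Submodule.smul_mem _ _ one_mem_alg)

theorem star_mem_alg {x : Octonion} (hx : x ∈ alg p r) : star x ∈ alg p r := by
  rw [star_eq]
  exact sub_mem (Submodule.smul_mem _ _ one_mem_alg) hx

/-- Squares lie in the span by the quadratic equation, `rp` by the formula for `pr + rp`, and the
remaining products of generators by the alternative and flexible laws. -/
theorem mul_mem_alg {x y : Octonion} (hx : x ∈ alg p r) (hy : y ∈ alg p r) :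
    x * y ∈ alg p r := by
  have L : ∀ z : Octonion, z ∈ alg p r → z * p ∈ alg p r → z * r ∈ alg p r →
      z * (p * r) ∈ alg p r → ∀ y ∈ alg p r, z * y ∈ alg p r := by
    intro z h1 h2 h3 h4 y hy
    refine alg_induction (P := fun y => z * y ∈ alg p r) (by simpa) h2 h3 h4 ?_ ?_ hy
    · intro x y hx hy; rw [mul_add]; exact add_mem hx hy
    · intro t x hx; rw [mul_smul_comm]; exact Submodule.smul_mem _ _ hx
  have Lp : ∀ y ∈ alg p r, p * y ∈ alg p r := by
    refine L p left_mem_alg (mul_self_mem_alg left_mem_alg) mul_mem_alg' ?_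
    rw [left_alt, mul_self_eq, sub_mul, smul_mul_assoc, smul_mul_assoc, one_mul]
    exact sub_mem (Submodule.smul_mem _ _ mul_mem_alg') (Submodule.smul_mem _ _ right_mem_alg)
  have hrp : r * p ∈ alg p r := by
    rw [eq_sub_of_add_eq' (mul_add_mul_comm p r)]
    exact sub_mem (add_mem (add_mem (Submodule.smul_mem _ _ one_mem_alg)
      (Submodule.smul_mem _ _ left_mem_alg)) (Submodule.smul_mem _ _ right_mem_alg)) mul_mem_alg'
  have hprr : p * r * r ∈ alg p r := by
    rw [right_alt]
    exact Lp _ (mul_self_mem_alg right_mem_alg)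
  have Rr : ∀ x ∈ alg p r, x * r ∈ alg p r := fun x hx => by
    refine alg_induction (P := fun x => x * r ∈ alg p r) (by simpa using right_mem_alg)
      mul_mem_alg' (mul_self_mem_alg right_mem_alg) hprr ?_ ?_ hx
    · intro x y hx hy; rw [add_mul]; exact add_mem hx hy
    · intro t x hx; rw [smul_mul_assoc]; exact Submodule.smul_mem _ _ hx
  have Lr : ∀ y ∈ alg p r, r * y ∈ alg p r := by
    refine L r right_mem_alg hrp (mul_self_mem_alg right_mem_alg) ?_
    rw [← flexible]
    exact Rr _ hrp
  have Lpr : ∀ y ∈ alg p r, p * r * y ∈ alg p r := by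
    refine L _ mul_mem_alg' ?_ hprr (mul_self_mem_alg mul_mem_alg')
    rw [flexible]
    exact Lp _ hrp
  refine alg_induction (P := fun x => x * y ∈ alg p r) (by simpa) (Lp y hy) (Lr y hy) (Lpr y hy)
    ?_ ?_ hx
  · intro x y hx hy; rw [add_mul]; exact add_mem hx hy
  · intro t x hx; rw [smul_mul_assoc]; exact Submodule.smul_mem _ _ hx

/-- Artin's theorem. The associator is trilinear, alternating and zero if an argument is `1`, so
only the triple `p, r, pr` matters, and its associator vanishes. -/
theorem associatorOf_alg {x y z : Octonion} (hx : x ∈ alg p r) (hy : y ∈ alg p r)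
    (hz : z ∈ alg p r) : associatorOf x y z = 0 := by
  have L : ∀ u v : Octonion, associatorOf u v p = 0 → associatorOf u v r = 0 →
      associatorOf u v (p * r) = 0 → ∀ z ∈ alg p r, associatorOf u v z = 0 := by
    intro u v h2 h3 h4 z hz
    refine alg_induction (P := fun z => associatorOf u v z = 0) (by simp) h2 h3 h4 ?_ ?_ hz
    · intro x y hx hy; rw [associatorOf_add_right, hx, hy, add_zero]
    · intro t x hx; rw [associatorOf_smul_right, hx, smul_zero]
  have k1 := associatorOf_mul_right p r
  have k2 : associatorOf p (p * r) r = 0 := by rw [associatorOf_swap_right, k1, neg_zero]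
  have k3 : associatorOf r (p * r) p = 0 := by rw [← associatorOf_rotate, k1]
  have k4 : associatorOf r p (p * r) = 0 := by rw [associatorOf_swap_left, k1, neg_zero]
  have Lpr : ∀ z ∈ alg p r, associatorOf p r z = 0 := L _ _ (by simp) (by simp) k1
  have Lpq : ∀ z ∈ alg p r, associatorOf p (p * r) z = 0 := L _ _ (by simp) k2 (by simp)
  have Lrq : ∀ z ∈ alg p r, associatorOf r (p * r) z = 0 := L _ _ k3 (by simp) (by simp)
  have Lp : ∀ y ∈ alg p r, associatorOf p z y = 0 := by
    refine L _ _ (by simp) ?_ ?_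
    · rw [associatorOf_swap_right, Lpr z hz, neg_zero]
    · rw [associatorOf_swap_right, Lpq z hz, neg_zero]
  have Lr : ∀ y ∈ alg p r, associatorOf r z y = 0 := by
    refine L _ _ ?_ (by simp) ?_
    · rw [← associatorOf_rotate, Lpr z hz]
    · rw [associatorOf_swap_right, Lrq z hz, neg_zero]
  have Lq : ∀ y ∈ alg p r, associatorOf (p * r) z y = 0 := by
    refine L _ _ ?_ ?_ (by simp)
    · rw [← associatorOf_rotate, Lpq z hz]
    · rw [← associatorOf_rotate, Lrq z hz]
  rw [associatorOf_swap_right]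
  refine neg_eq_zero.2 (alg_induction (P := fun x => associatorOf x z y = 0) (by simp) (Lp y hy)
    (Lr y hy) (Lq y hy) ?_ ?_ hx)
  · intro x y hx hy; rw [associatorOf_add_left, hx, hy, add_zero]
  · intro t x hx; rw [associatorOf_smul_left, hx, smul_zero]

theorem mul_assoc_alg {x y z : Octonion} (hx : x ∈ alg p r) (hy : y ∈ alg p r)
    (hz : z ∈ alg p r) : x * y * z = x * (y * z) :=
  sub_eq_zero.1 (associatorOf_alg hx hy hz)

end alg

/-- The Euclidean structure of the octonions. -/
abbrev innerCore : InnerProductSpace.Core ℝ Octonion where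
  inner := ip
  conj_inner_symm x y := ip_comm y x
  re_inner_nonneg x := by simpa [ip_self] using normSq_nonneg x
  add_left := ip_add_left
  smul_left x y r := ip_smul_left r x y
  definite x h := normSq_eq_zero.1 ((ip_self x).symm.trans h)

theorem exists_add_perp (H : Submodule ℝ Octonion) [FiniteDimensional ℝ H] (x : Octonion) :
    ∃ h ∈ H, ∃ y, (∀ z ∈ H, ip y z = 0) ∧ x = h + y := by
  let _ : NormedAddCommGroup Octonion := innerCore.toNormedAddCommGroup
  let _ : InnerProductSpace ℝ Octonion := InnerProductSpace.ofCore innerCore.toCore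
  obtain ⟨h, hh, y, hy, hxy⟩ := H.exists_add_mem_mem_orthogonal x
  exact ⟨h, hh, y, fun z hz => (ip_comm y z).trans (hy z hz), hxy⟩

section perp
variable {p r y : Octonion}

theorem star_of_perp (h1 : ip y 1 = 0) : star y = -y := by
  rw [star_eq, re_eq_ip, h1, mul_zero, zero_smul, zero_sub]

theorem mul_of_perp (h1 : ip y 1 = 0) (hr : ip y r = 0) : r * y = y * star r := by
  have h := mul_star_add r (star y)
  rw [star_star, star_of_perp h1, ip_neg_right, ip_comm, hr, neg_zero, mul_zero, zero_smul,
    neg_mul] at h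
  exact eq_of_sub_eq_zero (by rw [← h]; abel)

/-- The Cayley–Dickson rule for a vector orthogonal to a subalgebra: left multiplications compose in
reversed order. It comes from the polarized form of `x̄(xz) = ‖x‖²z`, whose right side vanishes by
orthogonality. -/
theorem mul_mul_of_perp (h1 : ip y 1 = 0) (hp : ip y (star p) = 0) (hr : ip y r = 0)
    (hpr : ip y (r * p) = 0) : p * (r * y) = (r * p) * y := by
  have h := star_mul_mul_add (star p) y (star r)
  rw [ip_comm, hp, mul_zero, zero_smul, star_star, star_of_perp h1, neg_mul] at h
  rw [mul_of_perp h1 hpr, star_mul, mul_of_perp h1 hr]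
  exact eq_of_sub_eq_zero (by rw [← h]; abel)

theorem perp_mul {q : Octonion} (hy : ∀ z ∈ alg p r, ip y z = 0) (hq : q ∈ alg p r) :
    ∀ z ∈ alg p r, ip (q * y) z = 0 := fun z hz => by
  rw [ip_mul_left]; exact hy _ (mul_mem_alg (star_mem_alg hq) hz)

theorem mul_perp {q : Octonion} (hy : ∀ z ∈ alg p r, ip y z = 0) (hq : q ∈ alg p r) :
    y * star q = q * y := (mul_of_perp (hy _ one_mem_alg) (hy _ hq)).symm

theorem mul_mul_perp {q s : Octonion} (hy : ∀ z ∈ alg p r, ip y z = 0) (hq : q ∈ alg p r)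
    (hs : s ∈ alg p r) : q * (s * y) = (s * q) * y :=
  mul_mul_of_perp (hy _ one_mem_alg) (hy _ (star_mem_alg hq)) (hy _ hs) (hy _ (mul_mem_alg hs hq))

/-- An octonion associating with two non-commuting ones lies in the algebra they generate. -/
theorem mem_alg_of_associatorOf {b : Octonion} (hpr : p * r ≠ r * p)
    (h : associatorOf p r b = 0) : b ∈ alg p r := by
  have : FiniteDimensional ℝ (alg p r) :=
    FiniteDimensional.span_of_finite ℝ (Set.toFinite _)
  -- The component `z` in the algebra contributes no associator, and for the orthogonal `y` one has
  -- `[p,r,y] = (pr - rp)y`; there are no zero divisors.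
  obtain ⟨z, hz, y, hy, rfl⟩ := exists_add_perp (alg p r) b
  rw [associatorOf_add_right, associatorOf_alg left_mem_alg right_mem_alg hz, zero_add,
    associatorOf, mul_mul_perp hy left_mem_alg right_mem_alg, ← sub_mul,
    Octonion.mul_eq_zero_iff, sub_eq_zero] at h
  rcases h with h | rfl
  · exact absurd h hpr
  · simpa using hz

end perp
end Octonion

/-! ### Schur complements and comparison maps -/

/-- The off-diagonal part of `φ_M` modulo the image of the first isotropic line. -/
def phiRes (a b c d x : Octonion) : Octonion :=
  phiOff a b c d x - (2 * ip (a * x) b / normSq a) • (a * star c)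

/-- The octonionic Schur complement `d - c (a⁻¹ b)`. -/
def schur (a b c d : Octonion) : Octonion := d - (normSq a)⁻¹ • (c * (star a * b))

section
variable {a b c d p r : Octonion}

theorem schur_mem (ha : a ∈ alg p r) (hb : b ∈ alg p r) (hc : c ∈ alg p r) (hd : d ∈ alg p r) :
    schur a b c d ∈ alg p r :=
  sub_mem hd (Submodule.smul_mem _ _ (mul_mem_alg hc (mul_mem_alg (star_mem_alg ha) hb)))

/-- Within an associative subalgebra the usual factorization of a `2 × 2` matrix by its Schur
complement is valid. -/
theorem phiRes_of_mem_alg (ha0 : a ≠ 0) (ha : a ∈ alg p r) (hb : b ∈ alg p r) (hc : c ∈ alg p r)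
    (hd : d ∈ alg p r) {x : Octonion} (hx : x ∈ alg p r) :
    phiRes a b c d x = (a * x) * star (schur a b c d) := by
  have hn := (normSq_pos ha0).ne'
  have e1 : b * (star x * star c) = b * star x * star c :=
    (mul_assoc_alg hb (star_mem_alg hx) (star_mem_alg hc)).symm
  have e2 : a * (x * star d) = a * x * star d := (mul_assoc_alg ha hx (star_mem_alg hd)).symm
  have e3 : (2 * ip (a * x) b) • (a * star c) =
      (a * x) * (star b * a * star c) + normSq a • (b * star x * star c) := by
    have h := congrArg (· * (a * star c)) (mul_star_add (a * x) b)
    simp only [add_mul, smul_mul_assoc, one_mul, star_mul] at h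
    rw [← h, mul_assoc_alg (mul_mem_alg ha hx) (star_mem_alg hb) (mul_mem_alg ha (star_mem_alg hc)),
      mul_assoc_alg (star_mem_alg hb) ha (star_mem_alg hc),
      ← mul_assoc_alg hb (star_mem_alg hx) (star_mem_alg ha),
      mul_assoc_alg (mul_mem_alg hb (star_mem_alg hx)) (star_mem_alg ha)
        (mul_mem_alg ha (star_mem_alg hc)), star_mul_mul, mul_smul_comm]
  have e4 : (2 * ip (a * x) b / normSq a) • (a * star c) =
      (normSq a)⁻¹ • ((a * x) * (star b * a * star c)) + b * star x * star c := by
    rw [div_eq_inv_mul, mul_smul, e3, smul_add, smul_smul, inv_mul_cancel₀ hn, one_smul]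
  have aux : ∀ u v w : Octonion, (1 / 2 : ℝ) • (u + u + v + v) - (w + u) = v - w := by
    intros; module
  rw [phiRes, phiOff, e1, e2, e4, aux, schur, star_sub, star_smul, star_mul, star_mul, star_star,
    star_trivial (_ : ℝ), mul_sub, mul_smul_comm]

/-- On the complement, the Cayley–Dickson rules move every factor to the left of `y`; the multiplier
is a symmetrized determinant of `M`. -/
theorem phiRes_of_perp (ha : a ∈ alg p r) (hb : b ∈ alg p r) (hc : c ∈ alg p r)
    (hd : d ∈ alg p r) {y : Octonion} (hy : ∀ z ∈ alg p r, ip y z = 0) :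
    phiRes a b c d y = ((1 / 2 : ℝ) • (a * d + d * a - b * c - c * b)) * y := by
  rw [phiRes, phiOff, star_of_perp (hy _ one_mem_alg), perp_mul hy ha _ hb, mul_zero, zero_div,
    zero_smul, sub_zero, mul_neg, neg_mul, neg_mul, mul_neg, mul_perp hy hc, mul_perp hy hd,
    mul_perp (perp_mul hy hb) hc, mul_perp (perp_mul hy ha) hd, mul_mul_perp hy hc hb,
    mul_mul_perp hy hb hc, mul_mul_perp hy hd ha, mul_mul_perp hy ha hd, smul_mul_assoc,
    sub_mul, sub_mul, add_mul]
  congr 1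
  abel

/-- On `alg p r` the two summands coincide, so their sum is twice an injective map. On the
complement their sum is the left multiplication by the element that `hne` assumes nonzero. -/
theorem eq_zero_of_res_add {u v : Octonion} (ha0 : a ≠ 0) (hm : schur a b c d ≠ 0)
    (ha : a ∈ alg p r) (hb : b ∈ alg p r) (hc : c ∈ alg p r) (hd : d ∈ alg p r)
    (hu : u ∈ alg p r) (hv : v ∈ alg p r) (huv : u * v = a)
    (hne : (1 / 2 : ℝ) • (a * d + d * a - b * c - c * b) + (v * u) * schur a b c d ≠ 0)
    {x : Octonion} (h : phiRes a b c d x + (u * (v * x)) * star (schur a b c d) = 0) : x = 0 := by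
  have : FiniteDimensional ℝ (alg p r) :=
    FiniteDimensional.span_of_finite ℝ (Set.toFinite _)
  obtain ⟨z, hz, y, hy, rfl⟩ := exists_add_perp (alg p r) x
  have hs := schur_mem ha hb hc hd
  have radd : phiRes a b c d (z + y) = phiRes a b c d z + phiRes a b c d y := by
    have aux : ∀ u v w u' v' w' s s' : Octonion, (1 / 2 : ℝ) • ((u + u') + (v + v') + (w + w')
      + (s + s')) = (1 / 2 : ℝ) • (u + v + w + s) + (1 / 2 : ℝ) • (u' + v' + w' + s') := by
      intros; module
    rw [phiRes, phiRes, phiRes, phiOff, phiOff, phiOff, star_add]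
    simp only [mul_add, add_mul, ip_add_left]
    rw [aux, add_div, add_smul]
    abel
  rw [radd, mul_add, mul_add, add_mul, phiRes_of_mem_alg ha0 ha hb hc hd hz,
    phiRes_of_perp ha hb hc hd hy, ← mul_assoc_alg hu hv hz, huv, mul_mul_perp hy hu hv,
    mul_perp (perp_mul hy (mul_mem_alg hv hu)) hs, mul_mul_perp hy hs (mul_mem_alg hv hu)] at h
  have h' : (2 : ℝ) • (a * z * star (schur a b c d)) +
      ((1 / 2 : ℝ) • (a * d + d * a - b * c - c * b) + (v * u) * schur a b c d) * y = 0 := by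
    rw [add_mul, two_smul, ← h]; abel
  have hq := add_mem (Submodule.smul_mem _ (1 / 2 : ℝ) (sub_mem (sub_mem (add_mem
    (mul_mem_alg ha hd) (mul_mem_alg hd ha)) (mul_mem_alg hb hc)) (mul_mem_alg hc hb)))
    (mul_mem_alg (mul_mem_alg hv hu) hs)
  -- By the equation, the term with `y` lies in the subalgebra, but it is also orthogonal to it.
  have hy0 : y = 0 := by
    have hperp := perp_mul hy hq
    have hmem : ((1 / 2 : ℝ) • (a * d + d * a - b * c - c * b) + (v * u) * schur a b c d) * y ∈
        alg p r := by
      rw [eq_neg_of_add_eq_zero_right h']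
      exact neg_mem (Submodule.smul_mem _ _
        (mul_mem_alg (mul_mem_alg ha hz) (star_mem_alg hs)))
    have := hperp _ hmem
    rw [ip_self, normSq_eq_zero, Octonion.mul_eq_zero_iff] at this
    exact this.resolve_left hne
  rw [hy0, mul_zero, add_zero, smul_eq_zero_iff_right two_ne_zero, Octonion.mul_eq_zero_iff,
    Octonion.mul_eq_zero_iff, star_eq_zero] at h'
  have hz0 : z = 0 := (h'.resolve_right hm).resolve_left ha0
  rw [hy0, hz0, add_zero]

/-- A comparison of `φ_M` with a product of diagonal transformations. -/
theorem exists_comparison (hac : a * c ≠ c * a) (hm : schur a b c d ≠ 0)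
    (hb : associatorOf a c b = 0) (hd : associatorOf a c d = 0) :
    ∃ u v : Octonion, u * v = a ∧ ∀ x, phiRes a b c d x +
      (u * (v * x)) * star (schur a b c d) = 0 → x = 0 := by
  have ha0 : a ≠ 0 := by rintro rfl; simp at hac
  have hc0 : c ≠ 0 := by rintro rfl; simp at hac
  have hn := (normSq_pos hc0).ne'
  have hb' := mem_alg_of_associatorOf hac hb
  have hd' := mem_alg_of_associatorOf hac hd
  have hA : a ∈ alg a c := left_mem_alg
  have hC : c ∈ alg a c := right_mem_alg
  by_cases h1 : (1 / 2 : ℝ) • (a * d + d * a - b * c - c * b) + (1 * a) * schur a b c d = 0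
  -- If the factorization `a = a · 1` gives a vanishing multiplier on the complement, `a = (ac⁻¹)c`
  -- replaces it: then `vu = cac⁻¹ ≠ a`, so the multiplier changes.
  · refine ⟨(normSq c)⁻¹ • (a * star c), c, ?_, fun x => eq_zero_of_res_add ha0 hm hA hb' hC hd'
      (Submodule.smul_mem _ _ (mul_mem_alg hA (star_mem_alg hC))) hC ?_ ?_⟩
    · rw [smul_mul_assoc, mul_star_mul', smul_smul, inv_mul_cancel₀ hn, one_smul]
    · rw [smul_mul_assoc, mul_star_mul', smul_smul, inv_mul_cancel₀ hn, one_smul]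
    · intro h2
      rw [← h1] at h2
      have h3 := add_left_cancel h2
      rw [← sub_eq_zero, ← sub_mul, Octonion.mul_eq_zero_iff] at h3
      have h4 := sub_eq_zero.1 (h3.resolve_right hm)
      apply hac
      have h5 := congrArg (· * c) h4
      simp only [one_mul, mul_smul_comm, smul_mul_assoc] at h5
      rw [← h5, ← mul_assoc_alg hC hA (star_mem_alg hC), mul_star_mul', smul_smul,
        inv_mul_cancel₀ hn, one_smul]
  · exact ⟨a, 1, mul_one a, fun x => eq_zero_of_res_add ha0 hm hA hb' hC hd' hA one_mem_alg
      (mul_one a) h1⟩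

theorem mem_alg_of_direction {q x : Octonion} (s t : ℝ) : s • (1 : Octonion) + t • q ∈ alg q x :=
  add_mem (Submodule.smul_mem _ _ one_mem_alg) (Submodule.smul_mem _ _ left_mem_alg)

/-- All entries and `x` itself lie in the associative algebra generated by `q` and `x`, so no
complement appears. -/
theorem comparison_of_sharesDirection (h : SharesDirection !![a, b; c, d]) (ha0 : a ≠ 0)
    (hm : schur a b c d ≠ 0) (x : Octonion)
    (hx : phiRes a b c d x + (a * (1 * x)) * star (schur a b c d) = 0) : x = 0 := by
  obtain ⟨q, -, μ, ν, H⟩ := h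
  have ha : a = _ := H 0 0
  have hb : b = _ := H 0 1
  have hc : c = _ := H 1 0
  have hd : d = _ := H 1 1
  have mem : ∀ s t : ℝ, s • (1 : Octonion) + t • q ∈ alg q x := mem_alg_of_direction
  rw [phiRes_of_mem_alg (p := q) (r := x) ha0 (by rw [ha]; exact mem _ _)
    (by rw [hb]; exact mem _ _) (by rw [hc]; exact mem _ _) (by rw [hd]; exact mem _ _)
    right_mem_alg, one_mul, ← two_smul ℝ, smul_eq_zero_iff_right two_ne_zero,
    Octonion.mul_eq_zero_iff, Octonion.mul_eq_zero_iff, star_eq_zero] at hx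
  exact (hx.resolve_right hm).resolve_left ha0

/-- The imaginary parts `P`, `R` commute, so `PR` equals its conjugate and is real; multiplying by
`P̄` shows that `R` is a real multiple of `P`. -/
theorem exists_of_commute (h : p * r = r * p) (hp : p - re p • (1 : Octonion) ≠ 0) :
    ∃ s t : ℝ, r = s • (1 : Octonion) + t • (p - re p • (1 : Octonion)) := by
  set P := p - re p • (1 : Octonion) with hP
  set R := r - re r • (1 : Octonion) with hR
  have hn := (normSq_pos hp).ne'
  have hsP : star P = -P := by
    rw [star_eq, show re P = 0 by simp [hP, re], mul_zero, zero_smul, zero_sub]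
  have hsR : star R = -R := by
    rw [star_eq, show re R = 0 by simp [hR, re], mul_zero, zero_smul, zero_sub]
  have hPR : P * R = R * P := by
    simp only [hP, hR, sub_mul, mul_sub, h, smul_mul_assoc, mul_smul_comm, one_mul, mul_one,
      smul_sub, smul_smul, mul_comm (re r)]
    abel
  have h1 : star (P * R) = P * R := by rw [star_mul, hsP, hsR, neg_mul_neg, hPR]
  have h2 : star P * (P * R) = star P * (re (P * R) • (1 : Octonion)) :=
    congrArg (star P * ·) (eq_re_of_star h1)
  rw [star_mul_mul, mul_smul_comm, mul_one, hsP] at h2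
  refine ⟨re r, -(re (P * R) / normSq P), ?_⟩
  have h3 : R = (-(re (P * R) / normSq P)) • P := by
    rw [neg_smul, ← smul_neg, div_eq_inv_mul, mul_smul, ← h2, smul_smul, inv_mul_cancel₀ hn,
      one_smul]
  rw [← h3, hR]; abel

/-- The imaginary part of any nonreal entry serves as direction; if all entries are real, `q = 0`
does. -/
theorem sharesDirection_of_commute (h1 : a * b = b * a) (h2 : a * c = c * a) (h3 : a * d = d * a)
    (h4 : b * c = c * b) (h5 : b * d = d * b) (h6 : c * d = d * c) :
    SharesDirection !![a, b; c, d] := by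
  have key : ∀ p : Octonion, p * a = a * p → p * b = b * p → p * c = c * p → p * d = d * p →
      p - re p • (1 : Octonion) ≠ 0 → SharesDirection !![a, b; c, d] := by
    intro p ha hb hc hd hp
    obtain ⟨sa, ta, ha⟩ := exists_of_commute ha hp
    obtain ⟨sb, tb, hb⟩ := exists_of_commute hb hp
    obtain ⟨sc, tc, hc⟩ := exists_of_commute hc hp
    obtain ⟨sd, td, hd⟩ := exists_of_commute hd hp
    refine ⟨p - re p • (1 : Octonion), by simp [re], !![sa, sb; sc, sd], !![ta, tb; tc, td], ?_⟩
    intro i j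
    fin_cases i <;> fin_cases j <;> assumption
  by_contra hcon
  have ha := mt (key a rfl h1 h2 h3) hcon
  have hb := mt (key b h1.symm rfl h4 h5) hcon
  have hc := mt (key c h2.symm h4.symm rfl h6) hcon
  have hd := mt (key d h3.symm h5.symm h6.symm rfl) hcon
  rw [not_not, sub_eq_zero] at ha hb hc hd
  refine hcon ⟨0, rfl, !![re a, re b; re c, re d], 0, ?_⟩
  intro i j
  fin_cases i <;> fin_cases j <;> simpa
end

/-! ### The Lorentz form and determinants of Lorentz maps -/

/-- The Lorentz form of `ℝ¹⁰`. -/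
def lor (v w : Fin 10 → ℝ) : ℝ := v ⬝ᵥ (eta *ᵥ w)

theorem lor_apply (v w : Fin 10 → ℝ) : lor v w = v 0 * w 0 - v 1 * w 1 - v 2 * w 2 - v 3 * w 3
    - v 4 * w 4 - v 5 * w 5 - v 6 * w 6 - v 7 * w 7 - v 8 * w 8 - v 9 * w 9 := by
  simp [lor, eta, dotProduct, Matrix.mulVec_diagonal, Fin.sum_univ_succ]
  ring

theorem lor_comm (v w : Fin 10 → ℝ) : lor v w = lor w v := by simp only [lor_apply]; ring
theorem lor_add_left (u v w : Fin 10 → ℝ) : lor (u + v) w = lor u w + lor v w := by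
  simp [lor, add_dotProduct]
theorem lor_add_right (u v w : Fin 10 → ℝ) : lor u (v + w) = lor u v + lor u w := by
  rw [lor_comm, lor_add_left, lor_comm v, lor_comm w]
theorem lor_smul_left (r : ℝ) (v w : Fin 10 → ℝ) : lor (r • v) w = r * lor v w := by
  simp [lor]
theorem lor_smul_right (r : ℝ) (v w : Fin 10 → ℝ) : lor v (r • w) = r * lor v w := by
  rw [lor_comm, lor_smul_left, lor_comm]

theorem lor_coord_hm (α β α' β' : ℝ) (x x' : Octonion) :
    lor (coord (hm α x β)) (coord (hm α' x' β')) = (α * β' + α' * β) / 2 - ip x x' := by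
  rw [lor_apply, coord_hm, coord_hm, ip]
  simp
  ring

theorem hdet_eq_lor (X : h2O) : hdet X = lor (coord X) (coord X) := by
  obtain ⟨α, x, β, rfl⟩ := exists_hm X
  rw [hdet_hm, lor_coord_hm, ip_self]
  ring

theorem lor_map_of_hdet {T : Module.End ℝ h2O} (hT : ∀ X, hdet (T X) = hdet X) (X Y : h2O) :
    lor (coord (T X)) (coord (T Y)) = lor (coord X) (coord Y) := by
  have h := hT (X + Y)
  have h1 := hT X
  have h2 := hT Y
  simp only [hdet_eq_lor, map_add, lor_add_left, lor_add_right, lor_comm (coord (T Y)),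
    lor_comm (coord Y)] at h h1 h2
  linarith

/-- The matrix of an endomorphism of `𝔥₂(𝕆) ≅ ℝ¹⁰`. -/
def matOf (T : Module.End ℝ h2O) : Matrix (Fin 10) (Fin 10) ℝ :=
  LinearMap.toMatrix' (coord.conj T)

theorem matOf_mulVec (T : Module.End ℝ h2O) (X : h2O) : matOf T *ᵥ coord X = coord (T X) := by
  rw [matOf, LinearMap.toMatrix'_mulVec, LinearEquiv.conj_apply_apply, LinearEquiv.symm_apply_apply]

theorem matOf_add (T S : Module.End ℝ h2O) : matOf (T + S) = matOf T + matOf S := by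
  simp [matOf]

theorem det_matOf (T : Module.End ℝ h2O) : (matOf T).det = LinearMap.det T := by
  rw [matOf, LinearMap.det_toMatrix']
  exact LinearMap.det_conj T coord

theorem eq_of_lor {A B : Matrix (Fin 10) (Fin 10) ℝ}
    (h : ∀ v w : Fin 10 → ℝ, v ⬝ᵥ (A *ᵥ w) = v ⬝ᵥ (B *ᵥ w)) : A = B := by
  ext i j
  simpa using h (Pi.single i 1) (Pi.single j 1)

theorem lorentz_iff {A : Matrix (Fin 10) (Fin 10) ℝ} :
    (∀ v w, lor (A *ᵥ v) (A *ᵥ w) = lor v w) ↔ Aᵀ * eta * A = eta := by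
  have key : ∀ v w, lor (A *ᵥ v) (A *ᵥ w) = v ⬝ᵥ ((Aᵀ * eta * A) *ᵥ w) := by
    intro v w
    rw [lor, ← Matrix.vecMul_transpose, ← Matrix.dotProduct_mulVec]
    simp [Matrix.mulVec_mulVec, mul_assoc]
  constructor
  · intro h
    exact eq_of_lor fun v w => by rw [← key, h, lor]
  · intro h v w
    rw [key, h, lor]

theorem lorentz_matOf {T : Module.End ℝ h2O} (hT : ∀ X, hdet (T X) = hdet X) :
    (matOf T)ᵀ * eta * matOf T = eta := by
  refine lorentz_iff.1 fun v w => ?_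
  obtain ⟨X, rfl⟩ := coord.surjective v
  obtain ⟨Y, rfl⟩ := coord.surjective w
  rw [matOf_mulVec, matOf_mulVec, lor_map_of_hdet hT]

theorem eta_mul_eta : eta * eta = 1 := by
  rw [eta, Matrix.diagonal_mul_diagonal, ← Matrix.diagonal_one]
  congr 1
  ext i
  by_cases h : i = 0 <;> simp [h]

theorem det_eta_ne_zero : eta.det ≠ 0 := by
  intro h
  have := congrArg Matrix.det eta_mul_eta
  rw [Matrix.det_mul, h, mul_zero, Matrix.det_one] at this
  exact zero_ne_one this

theorem lorentz_det_sq {A : Matrix (Fin 10) (Fin 10) ℝ} (h : Aᵀ * eta * A = eta) :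
    A.det * A.det = 1 := by
  have h1 := congrArg Matrix.det h
  rw [Matrix.det_mul, Matrix.det_mul, Matrix.det_transpose] at h1
  have h2 : (A.det * A.det - 1) * eta.det = 0 := by linear_combination h1
  linarith [(mul_eq_zero.1 h2).resolve_right det_eta_ne_zero]

/-- Two Lorentz transformations with invertible sum have the same determinant. -/
theorem lorentz_det_eq {A B : Matrix (Fin 10) (Fin 10) ℝ} (hA : Aᵀ * eta * A = eta)
    (hB : Bᵀ * eta * B = eta) (h : (A + B).det ≠ 0) : A.det = B.det := by
  -- Both sides are `η + AᵀηB`; the common factor `det (A + B)` then cancels.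
  have h1 : Aᵀ * eta * (A + B) = (A + B)ᵀ * eta * B := by
    rw [mul_add, hA, Matrix.transpose_add, add_mul, add_mul, hB, add_comm]
  have h2 := congrArg Matrix.det h1
  simp only [Matrix.det_mul, Matrix.det_transpose] at h2
  have h3 : (A.det - B.det) * (eta.det * (A + B).det) = 0 := by linear_combination h2
  linarith [(mul_eq_zero.1 h3).resolve_right (mul_ne_zero det_eta_ne_zero h)]

theorem det_eq_of_injective {T S : Module.End ℝ h2O} (hT : ∀ X, hdet (T X) = hdet X)
    (hS : ∀ X, hdet (S X) = hdet X) (h : ∀ X, T X + S X = 0 → X = 0) :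
    LinearMap.det T = LinearMap.det S := by
  rw [← det_matOf, ← det_matOf]
  refine lorentz_det_eq (lorentz_matOf hT) (lorentz_matOf hS) ?_
  rw [← matOf_add, det_matOf]
  intro h0
  have h1 := LinearMap.bot_lt_ker_of_det_eq_zero h0
  refine h1.ne' ((Submodule.eq_bot_iff _).2 fun X hX => h X hX)

theorem det_eq_one_of_pos {T : Module.End ℝ h2O} (hT : ∀ X, hdet (T X) = hdet X)
    (h : 0 < LinearMap.det T) : LinearMap.det T = 1 := by
  have h1 := lorentz_det_sq (lorentz_matOf hT)
  rw [det_matOf] at h1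
  nlinarith

/-! ### Diagonal and triangular transformations -/

theorem Octonion.exists_sqrt (s : Octonion) : ∃ z : Octonion, z * z = s := by
  set n := √(normSq s) with hn
  have hn2 : n * n = normSq s := Real.mul_self_sqrt (normSq_nonneg s)
  have hn0 : 0 ≤ n := Real.sqrt_nonneg _
  by_cases h : n + re s = 0
  · have h2 : normSq (s + n • (1 : Octonion)) = 0 := by
      rw [normSq_add, normSq_smul, normSq_one, ip_smul_right, ← re_eq_ip, ← hn2]
      linear_combination 2 * n * h
    have hs : s = (-n) • (1 : Octonion) := by
      rw [neg_smul]; exact eq_neg_of_add_eq_zero_left (normSq_eq_zero.1 h2)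
    -- Here `s = -n` with `n ≥ 0`, and `√n e₁` is one of its many square roots.
    refine ⟨⟨0, √n, 0, 0, 0, 0, 0, 0⟩, ?_⟩
    conv_rhs => rw [hs]
    ext <;> simp [Real.mul_self_sqrt hn0]
  · have hpos : 0 < n + re s := by
      refine lt_of_le_of_ne ?_ (Ne.symm h)
      have : re s ^ 2 ≤ n ^ 2 := by
        rw [sq n, hn2, normSq, re]
        nlinarith [sq_nonneg s.x1, sq_nonneg s.x2, sq_nonneg s.x3, sq_nonneg s.x4,
          sq_nonneg s.x5, sq_nonneg s.x6, sq_nonneg s.x7]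
      linarith [(abs_le_of_sq_le_sq' this hn0).1]
    -- The square of the bisector `s + ‖s‖` is a positive multiple of `s`.
    refine ⟨(√(2 * (n + re s)))⁻¹ • (s + n • (1 : Octonion)), ?_⟩
    have h1 : (s + n • (1 : Octonion)) * (s + n • (1 : Octonion)) = (2 * (n + re s)) • s := by
      simp only [mul_add, add_mul, smul_mul_assoc, mul_smul_comm, one_mul, mul_one, mul_self_eq,
        ← hn2]
      module
    rw [smul_mul_assoc, mul_smul_comm, h1, smul_smul, smul_smul, ← mul_inv, Real.mul_self_sqrt
      (by positivity), inv_mul_cancel₀ (by positivity), one_smul]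

theorem phi_diag_left (s : Octonion) (t : ℝ) (α β : ℝ) (x : Octonion) :
    phi !![s, 0; 0, t • 1] (hm α x β) = hm (α * normSq s) (t • (s * x)) (t ^ 2 * β) := by
  rw [phi_hm', phiOff]
  have aux : ∀ u : Octonion, (2⁻¹ : ℝ) • t • u + (2⁻¹ : ℝ) • t • u = t • u := by
    intros; module
  simp [normSq_smul, mul_comm]
  rw [mul_smul_comm, aux]

theorem phi_diag_right (t : Octonion) (α β : ℝ) (x : Octonion) :
    phi !![1, 0; 0, t] (hm α x β) = hm α (x * star t) (normSq t * β) := by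
  rw [phi_hm', phiOff]
  have aux : ∀ u : Octonion, (2⁻¹ : ℝ) • (u + u) = u := by intros; module
  simp [aux, mul_comm]

theorem phi_lower (q : Octonion) (α β : ℝ) (x : Octonion) :
    phi !![1, 0; q, 1] (hm α x β) =
      hm α (α • star q + x) (α * normSq q + β + 2 * ip (q * x) 1) := by
  rw [phi_hm', phiOff]
  have aux : ∀ u : Octonion, (2⁻¹ : ℝ) • (u + u) = u := by intros; module
  simp [aux]

theorem end_ext_hm {T S : Module.End ℝ h2O} (h : ∀ α x β, T (hm α x β) = S (hm α x β)) :
    T = S := by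
  ext1 X
  obtain ⟨α, x, β, rfl⟩ := exists_hm X
  exact h α x β

/-- The determinant of a square is nonnegative, and that of a Lorentz map is not zero. The
triangular and diagonal factors below are all treated in this way. -/
theorem det_pos_of_sq {T S : Module.End ℝ h2O} (h : T = S * S) (hT : ∀ X, hdet (T X) = hdet X) :
    0 < LinearMap.det T := by
  have h1 := lorentz_det_sq (lorentz_matOf hT)
  rw [det_matOf] at h1
  refine lt_of_le_of_ne ?_ fun h0 => by rw [← h0] at h1; simp at h1
  rw [h, map_mul]
  exact mul_self_nonneg _

theorem hdet_diag_left {s : Octonion} {t : ℝ} (h : t ^ 2 * normSq s = 1) (X : h2O) :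
    hdet (phi !![s, 0; 0, t • 1] X) = hdet X := by
  obtain ⟨α, x, β, rfl⟩ := exists_hm X
  rw [phi_diag_left, hdet_hm, hdet_hm, normSq_smul, normSq_mul]
  linear_combination (α * β - normSq x) * h

theorem hdet_diag_right {t : Octonion} (h : normSq t = 1) (X : h2O) :
    hdet (phi !![1, 0; 0, t] X) = hdet X := by
  obtain ⟨α, x, β, rfl⟩ := exists_hm X
  rw [phi_diag_right, hdet_hm, hdet_hm, normSq_mul, normSq_star, h]
  ring

theorem hdet_lower (q : Octonion) (X : h2O) : hdet (phi !![1, 0; q, 1] X) = hdet X := by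
  obtain ⟨α, x, β, rfl⟩ := exists_hm X
  rw [phi_lower, hdet_hm, hdet_hm, normSq_add, normSq_smul, normSq_star, ip_smul_left,
    ip_mul_left, mul_one, ip_comm x]
  ring

/-- A square root `z` of `s` gives a square root of the transformation, since `z(zx) = (zz)x`. -/
theorem det_diag_left {s : Octonion} {t : ℝ} (ht : 0 ≤ t) (h : t ^ 2 * normSq s = 1) :
    0 < LinearMap.det (phi !![s, 0; 0, t • 1]) := by
  obtain ⟨z, rfl⟩ := s.exists_sqrt
  refine det_pos_of_sq (S := phi !![z, 0; 0, (√t) • 1]) (end_ext_hm fun α x β => ?_)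
    (hdet_diag_left h)
  rw [Module.End.mul_apply, phi_diag_left, phi_diag_left, phi_diag_left, normSq_mul,
    mul_smul_comm, left_alt, smul_smul, Real.mul_self_sqrt ht, Real.sq_sqrt ht]
  congr 1 <;> ring

theorem det_diag_right {t : Octonion} (h : normSq t = 1) :
    0 < LinearMap.det (phi !![1, 0; 0, t]) := by
  obtain ⟨z, rfl⟩ := t.exists_sqrt
  refine det_pos_of_sq (S := phi !![1, 0; 0, z]) (end_ext_hm fun α x β => ?_)
    (hdet_diag_right h)
  rw [Module.End.mul_apply, phi_diag_right, phi_diag_right, phi_diag_right, normSq_mul,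
    star_mul, right_alt]
  congr 1; ring

theorem det_lower (q : Octonion) : 0 < LinearMap.det (phi !![1, 0; q, 1]) := by
  refine det_pos_of_sq (S := phi !![1, 0; (1 / 2 : ℝ) • q, 1]) (end_ext_hm fun α x β => ?_)
    (hdet_lower q)
  rw [Module.End.mul_apply, phi_lower, phi_lower, phi_lower, star_smul, star_trivial (_ : ℝ)]
  have aux : ∀ u : Octonion, α • u + x = α • (1 / 2 : ℝ) • u + (α • (1 / 2 : ℝ) • u + x) := by
    intros; module
  congr 1
  · exact aux _
  · simp only [normSq_smul, smul_mul_assoc, ip_smul_left, mul_add, mul_smul_comm, ip_add_left,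
      mul_star_self, ip_self, normSq_one]
    ring

/-! ### Comparison of `φ_M` with a triangular factorization -/

section
variable {a b c d : Octonion}

/-- The scalar condition has this form once its cross term is reassociated, which the vanishing of
`[a,c,b]` allows. -/
theorem normSq_schur (h : PreservesDet !![a, b; c, d]) (ha : a ≠ 0) :
    normSq a * normSq (schur a b c d) = 1 := by
  have hn := (normSq_pos ha).ne'
  have hC := preservesDet_scalar h
  have h1 : ip (a * star c) (b * star d) = ip d (c * (star a * b)) := by
    have h2 : associatorOf a (star c) d = a * star c * d - a * (star c * d) := rfl
    rw [← ip_mul_right, ip_comm _ b, ip_comm d, ip_mul_left c, ip_mul_left (star a), star_star,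
      ← sub_eq_zero, ← ip_sub_right, ← h2, associatorOf_star_mid, ip_neg_right,
      ip_comm, ip_associatorOf_swap, preservesDet_associator h, ip_zero_left, neg_zero, neg_zero]
  rw [schur, normSq_sub, normSq_smul, normSq_mul, normSq_mul, normSq_star, ip_smul_right, ← h1]
  field_simp
  linarith

/-- `φ_M` and the product `S` send `E₁₁` to the same vector, so the injectivity of `φ_M + S` is
decided on the off-diagonal entry, where it is the hypothesis `hinj`. -/
theorem det_phi_of_comparison (h : PreservesDet !![a, b; c, d]) (ha : a ≠ 0) {u v : Octonion}
    (huv : u * v = a)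
    (hinj : ∀ x, phiRes a b c d x + (u * (v * x)) * star (schur a b c d) = 0 → x = 0) :
    LinearMap.det (phi !![a, b; c, d]) = 1 := by
  have hpos := normSq_pos ha
  have hn := hpos.ne'
  have hu : u ≠ 0 := by rintro rfl; exact ha (by rw [← huv, zero_mul])
  have hv : v ≠ 0 := by rintro rfl; exact ha (by rw [← huv, mul_zero])
  have hun := normSq_pos hu
  have hvn := normSq_pos hv
  have hna : normSq a = normSq u * normSq v := by rw [← huv, normSq_mul]
  have hmn := normSq_schur h ha
  set m := schur a b c d with hmdef
  have hsu : (√(normSq u))⁻¹ ^ 2 * normSq u = 1 := by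
    rw [inv_pow, Real.sq_sqrt hun.le, inv_mul_cancel₀ hun.ne']
  have hsv : (√(normSq v))⁻¹ ^ 2 * normSq v = 1 := by
    rw [inv_pow, Real.sq_sqrt hvn.le, inv_mul_cancel₀ hvn.ne']
  have hsm : normSq (√(normSq a) • m) = 1 := by
    rw [normSq_smul, Real.sq_sqrt hpos.le, hmn]
  -- The lower factor has the entry `ca⁻¹`, and the diagonal ones send `x` to `(u(vx))m̄`. The real
  -- square roots make each factor determinant-preserving and cancel in the product.
  set S : Module.End ℝ h2O := phi !![1, 0; (normSq a)⁻¹ • (c * star a), 1] *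
    (phi !![1, 0; 0, √(normSq a) • m] * (phi !![u, 0; 0, (√(normSq u))⁻¹ • 1] *
      phi !![v, 0; 0, (√(normSq v))⁻¹ • 1])) with hS
  have hSdet : ∀ X, hdet (S X) = hdet X := by
    intro X
    rw [hS, Module.End.mul_apply, hdet_lower, Module.End.mul_apply, hdet_diag_right hsm,
      Module.End.mul_apply, hdet_diag_left hsu, hdet_diag_left hsv]
  have hSpos : 0 < LinearMap.det S := by
    rw [hS, map_mul, map_mul, map_mul]
    exact mul_pos (det_lower _) (mul_pos (det_diag_right hsm)
      (mul_pos (det_diag_left (by positivity) hsu) (det_diag_left (by positivity) hsv)))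
  have hSapp : ∀ α x β, ∃ β', S (hm α x β) =
      hm (α * normSq a) (α • (a * star c) + (u * (v * x)) * star m) β' := by
    intro α x β
    have ex : ∀ {A A' B : ℝ} {y y' : Octonion}, A = A' → y = y' →
        ∃ β', hm A y B = hm A' y' β' := by
      rintro A _ B y _ rfl rfl; exact ⟨B, rfl⟩
    rw [hS, Module.End.mul_apply, Module.End.mul_apply, Module.End.mul_apply, phi_diag_left,
      phi_diag_left, phi_diag_right, phi_lower]
    refine ex ?_ ?_
    · rw [hna]; ring
    · congr 1
      · rw [star_smul, star_trivial (_ : ℝ), star_mul, star_star, smul_smul, hna]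
        congr 1
        field_simp
      · rw [star_smul, star_trivial (_ : ℝ), mul_smul_comm, mul_smul_comm, smul_mul_assoc,
          smul_mul_assoc, smul_smul, smul_smul, hna, Real.sqrt_mul hun.le]
        have h1 := (Real.sqrt_pos.2 hun).ne'
        have h2 := (Real.sqrt_pos.2 hvn).ne'
        rw [show √(normSq u) * √(normSq v) * (√(normSq u))⁻¹ * (√(normSq v))⁻¹ = 1 by
          field_simp, one_smul]
  refine det_eq_one_of_pos h ?_
  rw [det_eq_of_injective h hSdet ?_]
  · exact hSpos
  intro X hX
  obtain ⟨α, x, β, rfl⟩ := exists_hm X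
  have hneg : phi !![a, b; c, d] (hm α x β) = -S (hm α x β) := eq_neg_of_add_eq_zero_left hX
  have hX0 : S (hm 1 0 0) = phi !![a, b; c, d] (hm 1 0 0) := by
    obtain ⟨β', hβ⟩ := hSapp 1 0 0
    have h0 := hSdet (hm 1 0 0)
    rw [phi_hm']
    rw [hβ] at h0 ⊢
    rw [hdet_hm, hdet_hm] at h0
    simp only [mul_zero, zero_mul, add_zero, normSq_zero, one_smul, one_mul, normSq_mul,
      normSq_star, sub_zero] at h0 ⊢
    -- The image of the isotropic vector `E₁₁` is isotropic, so its last entry is determined by the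
    -- other two.
    have h1 : β' = normSq c := by
      have : normSq a * (β' - normSq c) = 0 := by linear_combination h0
      linarith [(mul_eq_zero.1 this).resolve_left hn]
    simp [h1, phiOff]
  -- Since `φ_M X = -S X` but `φ_M E₁₁ = S E₁₁`, the product `⟨X, E₁₁⟩` equals its own negative.
  have hβ : β = 0 := by
    have h1 := lor_map_of_hdet h (hm α x β) (hm 1 0 0)
    have h2 := lor_map_of_hdet hSdet (hm α x β) (hm 1 0 0)
    rw [hneg, ← hX0, map_neg, ← neg_one_smul ℝ, lor_smul_left, h2] at h1
    rw [lor_coord_hm] at h1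
    simp at h1
    linarith
  subst hβ
  obtain ⟨β', hβ'⟩ := hSapp α x 0
  rw [phi_hm', hβ', hm_add, ← hm_zero] at hX
  obtain ⟨e1, e2, -⟩ := hm_injective hX
  have hx : x = 0 := by
    apply hinj
    rw [phiRes]
    -- The vanishing of the first diagonal entry expresses `α` through `⟨ax, b⟩`; this substitution
    -- turns the off-diagonal equation into the one for `phiRes`.
    have e3 : 2 * ip (a * x) b / normSq a = -(2 * α) := by
      field_simp
      linarith
    have aux : ∀ p q s t : Octonion, p - (-(2 * α)) • q + s =
        α • q + (0 : ℝ) • t + p + (α • q + s) := by intros; module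
    rw [e3, aux _ _ _ (b * star d)]
    exact e2
  subst hx
  rw [mul_zero, ip_zero_left] at e1
  have hα : α = 0 := by
    have : normSq a * α = 0 := by linear_combination e1 / 2
    exact (mul_eq_zero.1 this).resolve_left hn
  rw [hα, hm_zero]

theorem schur_ne_zero (h : PreservesDet !![a, b; c, d]) (ha : a ≠ 0) : schur a b c d ≠ 0 := by
  intro h0
  have := normSq_schur h ha
  rw [h0, normSq_zero, mul_zero] at this
  exact zero_ne_one this

theorem det_phi_of_not_commute (h : PreservesDet !![a, b; c, d]) (hac : a * c ≠ c * a) :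
    LinearMap.det (phi !![a, b; c, d]) = 1 := by
  have ha : a ≠ 0 := by rintro rfl; simp at hac
  obtain ⟨u, v, huv, hinj⟩ := exists_comparison hac (schur_ne_zero h ha)
    (preservesDet_associator h) (preservesDet_associator' h ha)
  exact det_phi_of_comparison h ha huv hinj

/-! ### Real column operations and transposition -/

/-- Although `φ` is not multiplicative in general, it is for a real elementary right factor, because
reals associate with everything. -/
theorem phi_column (a b c d : Octonion) (s : ℝ) : phi !![a + s • b, b; c + s • d, d] =
    phi !![a, b; c, d] * phi !![1, 0; s • 1, 1] := by
  refine end_ext_hm fun α x β => ?_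
  have key : ∀ a b x : Octonion, α * normSq (a + s • b) + β * normSq b
      + 2 * ip ((a + s • b) * x) b = α * normSq a + (α * s ^ 2 + β + 2 * (s * re x)) * normSq b
        + 2 * ip (a * (α • s • (1 : Octonion) + x)) b := by
    intro a b x
    have h1 : ip (b * x) b = re x * normSq b := by
      rw [ip_mul_left, star_mul_self, ip_smul_right, ← re_eq_ip, mul_comm]
    simp only [normSq_add, normSq_smul, add_mul, mul_add, smul_mul_assoc, mul_smul_comm, mul_one,
      ip_add_left, ip_smul_left, ip_smul_right, h1]
    ring
  rw [Module.End.mul_apply, phi_lower, phi_hm', phi_hm', normSq_smul, normSq_one, smul_mul_assoc,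
    one_mul, ip_smul_left, ← re_eq_ip, mul_one, star_smul, star_one, star_trivial (_ : ℝ)]
  congr 1
  · exact key a b x
  · have hx : star x = (2 * re x) • (1 : Octonion) - x := star_eq x
    have aux : ∀ (ac bc ad bd bxc bxc' axd axd' bxd bxd' : Octonion), bxc + bxc' = bxc + bxc' →
      α • (ac + s • bc + s • (ad + s • bd)) + β • bd + (1 / 2 : ℝ) • ((bxc + s • (2 * re x) • bd
        - s • bxd) + (bxc' + s • (2 * re x) • bd - s • bxd') + (axd + s • bxd) + (axd' + s • bxd'))
        = α • ac + (α * s ^ 2 + β + 2 * (s * re x)) • bd + (1 / 2 : ℝ) • ((α • s • bc + bxc)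
          + (α • s • bc + bxc') + (α • s • ad + axd) + (α • s • ad + axd')) := by
      intros; module
    have e1 : ∀ z : Octonion, b * star x * star (s • z) = s • (2 * re x) • (b * star z)
        - s • (b * x * star z) := by
      intro z
      rw [hx, star_smul, star_trivial (_ : ℝ), mul_smul_comm, mul_sub, mul_smul_comm, mul_one,
        sub_mul, smul_mul_assoc, smul_sub]
    have e2 : ∀ z : Octonion, b * (star x * star (s • z)) = s • (2 * re x) • (b * star z)
        - s • (b * (x * star z)) := by
      intro z
      rw [hx, star_smul, star_trivial (_ : ℝ), mul_smul_comm, sub_mul, mul_smul_comm, mul_sub,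
        smul_mul_assoc, mul_smul_comm, smul_sub, one_mul]
    have e3 := aux (a * star c) (b * star c) (a * star d) (b * star d) (b * star x * star c)
      (b * (star x * star c)) (a * x * star d) (a * (x * star d)) (b * x * star d)
      (b * (x * star d)) rfl
    have l : phiOff (a + s • b) b (c + s • d) d x = (1 / 2 : ℝ) • ((b * star x * star c
        + s • (2 * re x) • (b * star d) - s • (b * x * star d)) + (b * (star x * star c)
        + s • (2 * re x) • (b * star d) - s • (b * (x * star d))) + (a * x * star d
        + s • (b * x * star d)) + (a * (x * star d) + s • (b * (x * star d)))) := by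
      rw [phiOff, star_add, mul_add, mul_add (star x), mul_add, e1, e2, add_mul, add_mul, add_mul,
        smul_mul_assoc, smul_mul_assoc, smul_mul_assoc, add_sub_assoc, add_sub_assoc]
    have l2 : (a + s • b) * star (c + s • d) = a * star c + s • (b * star c)
        + s • (a * star d + s • (b * star d)) := by
      rw [star_add, mul_add, add_mul, add_mul, star_smul, star_trivial (_ : ℝ), mul_smul_comm,
        mul_smul_comm, smul_mul_assoc, smul_mul_assoc, smul_add]
    have l3 : phiOff a b c d (α • s • (1 : Octonion) + x) = (1 / 2 : ℝ) • ((α • s • (b * star c)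
        + b * star x * star c) + (α • s • (b * star c) + b * (star x * star c))
        + (α • s • (a * star d) + a * x * star d) + (α • s • (a * star d)
        + a * (x * star d))) := by
      simp only [phiOff, star_add, star_smul, star_one, star_trivial (_ : ℝ), mul_add, add_mul,
        mul_smul_comm, smul_mul_assoc, mul_one, one_mul]
    rw [l, l2, l3]
    exact e3
  · exact key c d x

theorem dotProduct_coord_hm (α β α' β' : ℝ) (x x' : Octonion) :
    coord (hm α x β) ⬝ᵥ coord (hm α' x' β') = (α * α' + β * β') / 2 + ip x x' := by
  rw [coord_hm, coord_hm, ip]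
  simp [dotProduct, Fin.sum_univ_succ]
  ring

/-- Multiplication by an octonion is adjoint to multiplication by its conjugate. This carries
statements about columns of `M` over to rows. -/
theorem matOf_phi_adjoint (a b c d : Octonion) :
    matOf (phi !![star a, star c; star b, star d]) = (matOf (phi !![a, b; c, d]))ᵀ := by
  refine eq_of_lor fun v w => ?_
  rw [Matrix.dotProduct_mulVec v (matOf _)ᵀ, Matrix.vecMul_transpose]
  obtain ⟨X, rfl⟩ := coord.surjective v
  obtain ⟨Y, rfl⟩ := coord.surjective w
  rw [matOf_mulVec, matOf_mulVec]
  obtain ⟨α, x, β, rfl⟩ := exists_hm X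
  obtain ⟨α', y, β', rfl⟩ := exists_hm Y
  rw [phi_hm', phi_hm', dotProduct_coord_hm, dotProduct_coord_hm]
  simp only [phiOff, normSq_star, star_star, ip_add_left, ip_add_right, ip_smul_left,
    ip_smul_right]
  have e1 : ip (a * star c) y = ip (star a * y) (star c) := by rw [ip_mul_left, ip_comm]
  have e2 : ip (b * star d) y = ip (star b * y) (star d) := by rw [ip_mul_left, ip_comm]
  have e3 : ip (a * x) b = ip x (star a * b) := ip_mul_left _ _ _
  have e4 : ip (c * x) d = ip x (star c * d) := ip_mul_left _ _ _
  have e5 : ip (b * star x * star c) y = ip x (star c * star y * b) := by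
    rw [ip_mul_right, ip_mul_left, ← ip_star, star_star]; simp
  have e6 : ip (b * (star x * star c)) y = ip x (star c * (star y * b)) := by
    rw [ip_mul_left, ip_mul_right, ← ip_star, star_star]; simp
  have e7 : ip (a * x * star d) y = ip x (star a * (y * d)) := by
    rw [ip_mul_right, ip_mul_left, star_star]
  have e8 : ip (a * (x * star d)) y = ip x (star a * y * d) := by
    rw [ip_mul_left, ip_mul_right, star_star]
  rw [e1, e2, e3, e4, e5, e6, e7, e8]
  ring

end

/-- Comparison of coefficients in `s`; the sum and difference of the cases `s = ±1` separate the
quadratic from the linear one. -/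
theorem Octonion.commute_pencil {p q r t : Octonion}
    (h : ∀ s : ℝ, (p + s • q) * (r + s • t) = (r + s • t) * (p + s • q)) :
    p * r = r * p ∧ q * t = t * q ∧ p * t + q * r = t * p + r * q := by
  have h0 := h 0
  have h1 := h 1
  have h2 := h (-1)
  simp only [zero_smul, add_zero] at h0
  have e : ∀ s : ℝ, p * r + s • (p * t) + (s • (q * r) + s • s • (q * t)) =
      r * p + s • (r * q) + (s • (t * p) + s • s • (t * q)) := by
    intro s
    have := h s
    simp only [add_mul, mul_add, smul_mul_assoc, mul_smul_comm, smul_add] at this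
    refine Eq.trans ?_ (this.trans ?_) <;> abel
  have aux : ∀ x y z w x' y' z' w' : Octonion, x = x' →
      (∀ s : ℝ, x + s • y + (s • z + s • s • w) = x' + s • y' + (s • z' + s • s • w')) →
      w = w' ∧ y + z = z' + y' := by
    rintro x y z w _ y' z' w' rfl h
    have h1 := h 1
    have h2 := h (-1)
    constructor
    · calc w = (1 / 2 : ℝ) • ((x + (1 : ℝ) • y + ((1 : ℝ) • z + (1 : ℝ) • (1 : ℝ) • w))
          + (x + (-1 : ℝ) • y + ((-1 : ℝ) • z + (-1 : ℝ) • (-1 : ℝ) • w))) - x := by module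
        _ = _ := by rw [h1, h2]; module
    · calc y + z = (1 / 2 : ℝ) • ((x + (1 : ℝ) • y + ((1 : ℝ) • z + (1 : ℝ) • (1 : ℝ) • w))
          - (x + (-1 : ℝ) • y + ((-1 : ℝ) • z + (-1 : ℝ) • (-1 : ℝ) • w))) := by module
        _ = _ := by rw [h1, h2]; module
  exact ⟨h0, aux _ _ _ _ _ _ _ _ h0 e⟩

/-! ### Determinant one for every generator -/

section
variable {a b c d : Octonion}

theorem PreservesDet.column (h : PreservesDet !![a, b; c, d]) (s : ℝ) :
    PreservesDet !![a + s • b, b; c + s • d, d] := fun X => by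
  rw [phi_column, Module.End.mul_apply, h, hdet_lower]

theorem det_phi_column (s : ℝ) : LinearMap.det (phi !![a + s • b, b; c + s • d, d]) =
    LinearMap.det (phi !![a, b; c, d]) := by
  rw [phi_column, map_mul, det_eq_one_of_pos (hdet_lower _) (det_lower _), mul_one]

theorem hdet_of_lorentz {T : Module.End ℝ h2O} (h : (matOf T)ᵀ * eta * matOf T = eta) (X : h2O) :
    hdet (T X) = hdet X := by
  rw [hdet_eq_lor, hdet_eq_lor, ← matOf_mulVec, lorentz_iff.2 h]

theorem lorentz_transpose {A : Matrix (Fin 10) (Fin 10) ℝ} (h : Aᵀ * eta * A = eta) :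
    Aᵀᵀ * eta * Aᵀ = eta := by
  have h1 : (eta * Aᵀ * eta) * A = 1 := by
    rw [mul_assoc, mul_assoc, ← mul_assoc Aᵀ, h, eta_mul_eta]
  have h2 := mul_eq_one_comm.1 h1
  rw [Matrix.transpose_transpose]
  calc A * eta * Aᵀ = (A * (eta * Aᵀ * eta)) * eta := by
        rw [mul_assoc, mul_assoc A, mul_assoc (eta * Aᵀ), eta_mul_eta, mul_one]
    _ = eta := by rw [h2, one_mul]

theorem PreservesDet.adjoint (h : PreservesDet !![a, b; c, d]) :
    PreservesDet !![star a, star c; star b, star d] := by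
  refine hdet_of_lorentz ?_
  rw [matOf_phi_adjoint]
  exact lorentz_transpose (lorentz_matOf h)

theorem det_phi_adjoint : LinearMap.det (phi !![star a, star c; star b, star d]) =
    LinearMap.det (phi !![a, b; c, d]) := by
  rw [← det_matOf, ← det_matOf, matOf_phi_adjoint, Matrix.det_transpose]

theorem det_phi_of_sharesDirection (h : PreservesDet !![a, b; c, d])
    (hs : SharesDirection !![a, b; c, d]) : LinearMap.det (phi !![a, b; c, d]) = 1 := by
  have main : ∀ {a b c d : Octonion}, PreservesDet !![a, b; c, d] →
      SharesDirection !![a, b; c, d] → a ≠ 0 → LinearMap.det (phi !![a, b; c, d]) = 1 :=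
    fun h hs ha => det_phi_of_comparison h ha (mul_one _)
      (comparison_of_sharesDirection hs ha (schur_ne_zero h ha))
  by_cases ha : a = 0
  -- Adding the second column makes the corner nonzero: `a = b = 0` would contradict the scalar
  -- condition.
  · rw [← det_phi_column 1]
    refine main (h.column 1) ?_ ?_
    · obtain ⟨q, hq, μ, ν, H⟩ := hs
      refine ⟨q, hq, !![μ 0 0 + μ 0 1, μ 0 1; μ 1 0 + μ 1 1, μ 1 1],
        !![ν 0 0 + ν 0 1, ν 0 1; ν 1 0 + ν 1 1, ν 1 1], ?_⟩
      have ha : a = _ := H 0 0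
      have hb : b = _ := H 0 1
      have hc : c = _ := H 1 0
      have hd : d = _ := H 1 1
      have aux : ∀ (s t s' t' : ℝ) (e q : Octonion), (s • e + t • q) + (1 : ℝ) • (s' • e + t' • q)
          = (s + s') • e + (t + t') • q := by intros; module
      intro i j
      fin_cases i <;> fin_cases j
      · exact (congrArg₂ (fun x y => x + (1 : ℝ) • y) ha hb).trans (aux _ _ _ _ _ _)
      · exact hb
      · exact (congrArg₂ (fun x y => x + (1 : ℝ) • y) hc hd).trans (aux _ _ _ _ _ _)
      · exact hd
    · rintro h0
      have hb : b = 0 := by simpa [ha] using h0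
      have := preservesDet_scalar h
      simp [ha, hb] at this
  · exact main h hs ha

/-- A determinant-preserving `φ_M` has determinant `1` as a transformation of `𝔥₂(𝕆)`. -/
theorem det_phi {M : M2O} (h : PreservesDet M) : LinearMap.det (phi M) = 1 := by
  rw [Matrix.eta_fin_two M] at h ⊢
  generalize M 0 0 = a at h ⊢
  generalize M 0 1 = b at h ⊢
  generalize M 1 0 = c at h ⊢
  generalize M 1 1 = d at h ⊢
  -- If the determinant is not `1`, the entries of the first column commute after every real column
  -- operation.
  have main : ∀ {a b c d : Octonion}, PreservesDet !![a, b; c, d] →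
      LinearMap.det (phi !![a, b; c, d]) ≠ 1 → a * c = c * a ∧ b * d = d * b ∧
        a * d + b * c = d * a + c * b := by
    intro a b c d h hne
    refine commute_pencil fun s => ?_
    by_contra hcon
    exact hne (by rw [← det_phi_column s, det_phi_of_not_commute (h.column s) hcon])
  by_contra hne
  obtain ⟨h1, h2, h3⟩ := main h hne
  obtain ⟨h4, h5, h6⟩ := main h.adjoint (by rwa [det_phi_adjoint])
  have st : ∀ {x y : Octonion}, star x * star y = star y * star x → x * y = y * x := by
    intro x y h
    simpa using (congrArg star h).symm
  have h7 : d * a + b * c = a * d + c * b := by simpa using congrArg star h6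
  -- The mixed relations of the column pencil and of the row pencil add up to `2bc = 2cb`; only
  -- their combination separates the two commutators.
  have h8 : (2 : ℝ) • (b * c) = (2 : ℝ) • (c * b) := by
    rw [two_smul, two_smul]
    have : (a * d + b * c) + (d * a + b * c) = (d * a + c * b) + (a * d + c * b) := by rw [h3, h7]
    have e : ∀ x y z w : Octonion, (x + z) + (y + z) = (y + w) + (x + w) → z + z = w + w := by
      intro x y z w h
      have := congrArg (fun u => u - x - y) h
      refine Eq.trans ?_ (this.trans ?_) <;> abel
    exact e _ _ _ _ this
  have h9 : b * c = c * b := smul_right_injective _ (two_ne_zero (α := ℝ)) h8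
  have h10 : a * d = d * a := by rw [h9] at h3; exact add_right_cancel h3
  exact hne (det_phi_of_sharesDirection h
    (sharesDirection_of_commute (st h4) h1 h10 h9 h2 (st h5)))

theorem PreservesDet.bijective {M : M2O} (h : PreservesDet M) : Function.Bijective (phi M) := by
  have : Module.Finite ℝ h2O := Module.Finite.equiv coord.symm
  have hu : IsUnit (LinearMap.det (phi M)) := by rw [det_phi h]; exact isUnit_one
  exact (LinearEquiv.ofIsUnitDet (f := phi M) (v := Module.finBasis ℝ h2O)
    (v' := Module.finBasis ℝ h2O) (by rwa [LinearMap.det_toMatrix])).bijective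

/-! ### Matrices whose entries share one imaginary direction -/

/-- The entries and `x` lie in the associative algebra generated by `q` and `x`, and the entries
commute with one another and with their conjugates. The classical multiplicativity of the
determinant then survives, written with inner products. -/
theorem hdet_phi_of_sharesDirection (h : SharesDirection !![a, b; c, d]) (X : h2O) :
    hdet (phi !![a, b; c, d] X) = normSq (a * d - b * c) * hdet X := by
  obtain ⟨α, x, β, rfl⟩ := exists_hm X
  obtain ⟨q, -, μ, ν, H⟩ := h
  have ha : a = μ 0 0 • 1 + ν 0 0 • q := H 0 0
  have hb : b = μ 0 1 • 1 + ν 0 1 • q := H 0 1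
  have hc : c = μ 1 0 • 1 + ν 1 0 • q := H 1 0
  have hd : d = μ 1 1 • 1 + ν 1 1 • q := H 1 1
  have hma : a ∈ alg q x := by rw [ha]; exact mem_alg_of_direction _ _
  have hmb : b ∈ alg q x := by rw [hb]; exact mem_alg_of_direction _ _
  have hmc : c ∈ alg q x := by rw [hc]; exact mem_alg_of_direction _ _
  have hmd : d ∈ alg q x := by rw [hd]; exact mem_alg_of_direction _ _
  have hx : x ∈ alg q x := right_mem_alg
  have hcd : star c * d = d * star c := by
    have hq := star_eq q
    have aux : ∀ s t : ℝ, (s • (1 : Octonion) + t • q) * d = d * (s • (1 : Octonion) + t • q) := by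
      intro s t
      rw [hd]
      simp only [add_mul, mul_add, smul_mul_assoc, mul_smul_comm, one_mul, mul_one]
      generalize q * q = z
      module
    have h1 : star c = (μ 1 0 + ν 1 0 * (2 * re q)) • (1 : Octonion) + (-ν 1 0) • q := by
      rw [hc]
      simp only [star_add, star_smul, star_one, star_trivial (_ : ℝ), hq]
      module
    rw [h1, aux]
  have e0 : ip (a * d) (b * c) = ip (a * star c) (b * star d) := by
    rw [ip_mul_left, ← mul_assoc_alg (star_mem_alg hma) hmb hmc, ip_comm, ip_mul_right, ← hcd,
      ip_comm (a * star c), ip_mul_right b, star_star,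
      mul_assoc_alg hma (star_mem_alg hmc) hmd, ip_mul_left, star_star]
  have e1 : b * (star x * star c) = b * star x * star c :=
    (mul_assoc_alg hmb (star_mem_alg hx) (star_mem_alg hmc)).symm
  have e2 : a * (x * star d) = a * x * star d := (mul_assoc_alg hma hx (star_mem_alg hmd)).symm
  have hoff : phiOff a b c d x = b * star x * star c + a * x * star d := by
    have aux : ∀ u v : Octonion, (1 / 2 : ℝ) • (u + u + v + v) = u + v := by intros; module
    rw [phiOff, e1, e2, aux]
  have f1 : ip (a * star c) (phiOff a b c d x) =
      normSq c * ip (a * x) b + normSq a * ip (c * x) d := by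
    rw [hoff, ip_add_right, ip_mul_mul_right, normSq_star, ip_mul_right a x b, ← e2,
      ip_mul_mul_left, ip_comm (star c), ip_mul_right x, star_star, ip_mul_left c]
  have f2 : ip (b * star d) (phiOff a b c d x) =
      normSq d * ip (a * x) b + normSq b * ip (c * x) d := by
    rw [hoff, ip_add_right, ip_mul_mul_right, normSq_star, ip_comm b, ← e1,
      ip_mul_mul_left, ← star_mul, ip_star, ip_comm d]
    ring
  have f3 : ip (b * star x * star c) (a * x * star d) =
      2 * ip (a * x) b * ip (c * x) d - normSq x * ip (a * star c) (b * star d) := by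
    -- With `z = c̄d` this is `xz̄ + zx̄ = 2⟨x, z⟩`; it splits the cross term into a product of two
    -- inner products and a multiple of `‖x‖²`.
    have g1 : x * (star d * c) = (2 * ip x (star c * d)) • (1 : Octonion)
        - (star c * d) * star x := by
      rw [← mul_star_add, star_mul, star_star, add_sub_cancel_right]
    have g2 : ip (star a * b * star x) 1 = ip (a * x) b := by
      rw [ip_mul_right, star_star, one_mul, ip_comm, ip_mul_left a]
    have g3 : ip x (star c * d) = ip (c * x) d := (ip_mul_left c x d).symm
    have g4 : ip (star a * b) (star c * d) = ip (a * star c) (b * star d) := by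
      rw [ip_mul_left, star_star, ip_comm, ← mul_assoc_alg hma (star_mem_alg hmc) hmd,
        ip_mul_right]
    rw [ip_mul_right, star_star, mul_assoc_alg (mul_mem_alg hma hx) (star_mem_alg hmd) hmc,
      mul_assoc_alg hma hx (mul_mem_alg (star_mem_alg hmd) hmc), ip_comm, ip_mul_left,
      ip_comm, ← mul_assoc_alg (star_mem_alg hma) hmb (star_mem_alg hx), g1, ip_sub_right,
      ip_smul_right, ip_mul_mul_right, normSq_star, g2, g3, g4]
    ring
  have f4 : normSq (phiOff a b c d x) = normSq b * normSq x * normSq c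
      + 2 * ip (b * star x * star c) (a * x * star d) + normSq a * normSq x * normSq d := by
    rw [hoff, normSq_add, normSq_mul, normSq_mul, normSq_mul, normSq_mul]
    simp only [normSq_star]
  rw [phi_hm', hdet_hm, hdet_hm, normSq_sub, normSq_add, normSq_add]
  simp only [normSq_smul, normSq_mul, normSq_star, ip_add_left, ip_smul_left, ip_smul_right,
    f1, f2, f4, f3, e0]
  ring

theorem bijective_and_preservesDet_iff {M : M2O} (h : SharesDirection M) :
    (Function.Bijective (phi M) ∧ PreservesDet M) ↔
      normSq (M 0 0 * M 1 1 - M 0 1 * M 1 0) = 1 := by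
  have key : ∀ X, hdet (phi M X) = normSq (M 0 0 * M 1 1 - M 0 1 * M 1 0) * hdet X := by
    rw [Matrix.eta_fin_two M] at h ⊢
    exact hdet_phi_of_sharesDirection h
  constructor
  · rintro ⟨-, hp⟩
    have := key (hm 1 0 1)
    rw [hp, hdet_hm, normSq_zero] at this
    linarith
  · intro h1
    have hp : PreservesDet M := fun X => by rw [key, h1, one_mul]
    exact ⟨hp.bijective, hp⟩
end

/-! ### Transformations given by Hermitian matrices -/

theorem hm_sub (α α' β β' : ℝ) (x x' : Octonion) :
    hm α x β - hm α' x' β' = hm (α - α') (x - x') (β - β') := by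
  rw [sub_eq_iff_eq_add, hm_add, sub_add_cancel, sub_add_cancel, sub_add_cancel]

theorem hermOf_coord_hm (α β : ℝ) (x : Octonion) :
    hermOf (coord (hm α x β)) = !![α • (1 : Octonion), x; star x, β • (1 : Octonion)] := by
  have h : (⟨hermOf (coord (hm α x β)), hermOf_mem _⟩ : h2O) = hm α x β :=
    coord.symm_apply_apply _
  exact congrArg Subtype.val h

theorem sharesDirection_hermOf (v : Fin 10 → ℝ) : SharesDirection (hermOf v) := by
  have h : star (offDiag v) = re (offDiag v) • (1 : Octonion)
      + (-1 : ℝ) • (offDiag v - re (offDiag v) • (1 : Octonion)) := by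
    rw [star_eq]; module
  refine ⟨offDiag v - re (offDiag v) • (1 : Octonion), ?_,
    !![v 0 + v 9, re (offDiag v); re (offDiag v), v 0 - v 9], !![0, 1; -1, 0], ?_⟩
  · rw [sub_eq_add_neg]; simp [re]
  · intro i j
    fin_cases i <;> fin_cases j
    · simp [hermOf]
    · simp [hermOf]
    · simpa [hermOf] using h
    · simp [hermOf]

/-- The essential product is `xȳx = 2⟨x, y⟩x - ‖x‖²y`. If the Lorentz norm of `v` is `±1`, composing
with `η` gives, up to sign, the Lorentz reflection in `ηv`. -/
theorem coord_phi_hermOf (v : Fin 10 → ℝ) (X : h2O) : coord (phi (hermOf v) X) =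
    (2 * (v ⬝ᵥ coord X)) • v - lor v v • (eta *ᵥ coord X) := by
  obtain ⟨V, rfl⟩ := coord.surjective v
  obtain ⟨α, x, β, rfl⟩ := exists_hm V
  obtain ⟨γ, y, δ, rfl⟩ := exists_hm X
  have he : eta *ᵥ coord (hm γ y δ) = coord (hm δ (-y) γ) := by
    rw [coord_hm, coord_hm, eta]
    ext i
    rw [Matrix.mulVec_diagonal]
    fin_cases i <;> simp <;> ring
  have ho : phiOff (α • (1 : Octonion)) x (star x) (β • (1 : Octonion)) y =
      (2 * ip x y) • x - normSq x • y + (α * β) • y := by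
    have h1 : x * star y = (2 * ip x y) • (1 : Octonion) - y * star x := by
      rw [← mul_star_add, add_sub_cancel_right]
    have h2 : x * (star y * x) = x * star y * x := (flexible _ _).symm
    rw [phiOff, star_star, h2, h1, sub_mul, mul_star_mul', smul_mul_assoc, one_mul]
    simp only [star_smul, star_one, star_trivial (_ : ℝ), smul_mul_assoc, mul_smul_comm, one_mul,
      mul_one]
    module
  rw [he, hermOf_coord_hm, phi_hm', ho, dotProduct_coord_hm, lor_coord_hm, ← map_smul, ← map_smul,
    ← map_sub, smul_hm, smul_hm, hm_sub]
  congr 1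
  simp only [star_star, star_smul, star_one, star_trivial (_ : ℝ), smul_mul_assoc, mul_smul_comm,
    one_mul, mul_one, ip_smul_left, ip_smul_right, normSq_smul, normSq_one, normSq_star, ip_self]
  congr 1
  · rw [ip_comm y x]; ring
  · module
  · rw [ip_mul_left, star_star, mul_one, ip_comm]; ring

theorem preservesDet_hermOf {v : Fin 10 → ℝ} (h : lor v v ^ 2 = 1) : PreservesDet (hermOf v) := by
  refine ((bijective_and_preservesDet_iff (sharesDirection_hermOf v)).2 ?_).2
  obtain ⟨V, rfl⟩ := coord.surjective v
  obtain ⟨α, x, β, rfl⟩ := exists_hm V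
  have e : (α • (1 : Octonion)) * (β • (1 : Octonion)) - x * star x =
      (α * β - normSq x) • (1 : Octonion) := by
    rw [mul_star_self, smul_mul_assoc, one_mul]; module
  rw [hermOf_coord_hm]
  change normSq ((α • (1 : Octonion)) * (β • (1 : Octonion)) - x * star x) = 1
  rw [e, normSq_smul, normSq_one, mul_one, ← h, lor_coord_hm, ip_self]
  ring

theorem eta_mulVec_eta_mulVec (v : Fin 10 → ℝ) : eta *ᵥ (eta *ᵥ v) = v := by
  rw [Matrix.mulVec_mulVec, eta_mul_eta, Matrix.one_mulVec]

theorem eta_mulVec_dotProduct (v w : Fin 10 → ℝ) : (eta *ᵥ v) ⬝ᵥ w = lor v w := by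
  rw [dotProduct_comm]; exact lor_comm w v

theorem lor_eta_eta (v w : Fin 10 → ℝ) : lor (eta *ᵥ v) (eta *ᵥ w) = lor v w := by
  rw [lor, eta_mulVec_eta_mulVec, eta_mulVec_dotProduct]

theorem lor_eta_right (v w : Fin 10 → ℝ) : lor v (eta *ᵥ w) = v ⬝ᵥ w := by
  rw [lor, eta_mulVec_eta_mulVec]

/-- The linear map `y ↦ 2 (v ⬝ y) v - ⟨v, v⟩ η y`. -/
def boostMap (v : Fin 10 → ℝ) : (Fin 10 → ℝ) →ₗ[ℝ] (Fin 10 → ℝ) where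
  toFun y := (2 * (v ⬝ᵥ y)) • v - lor v v • (eta *ᵥ y)
  map_add' y z := by
    rw [dotProduct_add, Matrix.mulVec_add]; module
  map_smul' r y := by
    rw [dotProduct_smul, Matrix.mulVec_smul, RingHom.id_apply, smul_eq_mul]; module

theorem boostMap_apply (v y : Fin 10 → ℝ) :
    boostMap v y = (2 * (v ⬝ᵥ y)) • v - lor v v • (eta *ᵥ y) := rfl

theorem boostMap_eta {v : Fin 10 → ℝ} (h : lor v v ^ 2 = 1) (y : Fin 10 → ℝ) :
    boostMap (eta *ᵥ v) (boostMap v y) = y := by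
  rw [boostMap_apply, boostMap_apply, lor_eta_eta, dotProduct_sub, dotProduct_smul,
    dotProduct_smul, eta_mulVec_dotProduct, eta_mulVec_dotProduct, lor_eta_right,
    Matrix.mulVec_sub, Matrix.mulVec_smul, Matrix.mulVec_smul, eta_mulVec_eta_mulVec]
  have e : ∀ (l d : ℝ) (u : Fin 10 → ℝ), l ^ 2 = 1 →
      (2 * ((2 * d) • l - l • d)) • u - l • ((2 * d) • u - l • y) = y := by
    intro l d u hl
    calc _ = (l ^ 2) • y := by simp only [smul_eq_mul]; module
      _ = y := by rw [hl, one_smul]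
  exact e _ _ _ h

/-- The invertible transformation `φ_M` for the Hermitian matrix `M` with coordinates `v`. -/
def boost (v : Fin 10 → ℝ) (h : lor v v ^ 2 = 1) : GL10 where
  val := LinearMap.toContinuousLinearMap (boostMap v)
  inv := LinearMap.toContinuousLinearMap (boostMap (eta *ᵥ v))
  val_inv := by
    ext1 y
    have := boostMap_eta (v := eta *ᵥ v) (by rwa [lor_eta_eta]) y
    rwa [eta_mulVec_eta_mulVec] at this
  inv_val := by
    ext1 y
    exact boostMap_eta h y

theorem boost_apply {v : Fin 10 → ℝ} (h : lor v v ^ 2 = 1) (y : Fin 10 → ℝ) :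
    (boost v h : (Fin 10 → ℝ) →L[ℝ] (Fin 10 → ℝ)) y =
      (2 * (v ⬝ᵥ y)) • v - lor v v • (eta *ᵥ y) := rfl

theorem boost_mem {v : Fin 10 → ℝ} (h : lor v v ^ 2 = 1) : boost v h ∈ directedGenerators :=
  ⟨hermOf v, sharesDirection_hermOf v, preservesDet_hermOf h, fun X => by
    rw [coord_phi_hermOf, boost_apply]⟩

/-- The inverse belongs to `ηv`. Hence the monoid generated by these maps already contains their
inverses. -/
theorem boost_inv_mem {v : Fin 10 → ℝ} (h : lor v v ^ 2 = 1) :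
    (boost v h)⁻¹ ∈ directedGenerators := by
  have h' : lor (eta *ᵥ v) (eta *ᵥ v) ^ 2 = 1 := by rwa [lor_eta_eta]
  have : (boost v h)⁻¹ = boost (eta *ᵥ v) h' := Units.ext rfl
  rw [this]
  exact boost_mem h'

/-! ### Time orientation and the restricted Lorentz group -/

theorem lor_eq_sub_sum (v w : Fin 10 → ℝ) :
    lor v w = v 0 * w 0 - ∑ i : Fin 9, v i.succ * w i.succ := by
  rw [lor_apply]
  simp only [Fin.sum_univ_succ, Fin.sum_univ_zero, Fin.succ_zero_eq_one]
  simp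
  ring

theorem dotProduct_eq_sub_lor (v w : Fin 10 → ℝ) : v ⬝ᵥ w = 2 * (v 0 * w 0) - lor v w := by
  rw [lor_eq_sub_sum, dotProduct, Fin.sum_univ_succ]
  ring

/-- Cauchy–Schwarz for the nine spatial coordinates. -/
theorem zero_lt_lor {v w : Fin 10 → ℝ} (hv : 0 < lor v v) (hv0 : 0 < v 0) (hw : 0 < lor w w)
    (hw0 : 0 < w 0) : 0 < lor v w := by
  rw [lor_eq_sub_sum] at *
  have h := Finset.sum_mul_sq_le_sq_mul_sq Finset.univ (fun i : Fin 9 => v i.succ)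
    (fun i : Fin 9 => w i.succ)
  have e : ∀ u : Fin 10 → ℝ, ∑ i : Fin 9, u i.succ ^ 2 = ∑ i : Fin 9, u i.succ * u i.succ :=
    fun u => Finset.sum_congr rfl fun i _ => pow_two _
  rw [e, e] at h
  have p : 0 ≤ ∑ i : Fin 9, v i.succ * v i.succ := Finset.sum_nonneg fun i _ => mul_self_nonneg _
  have q : 0 ≤ ∑ i : Fin 9, w i.succ * w i.succ := Finset.sum_nonneg fun i _ => mul_self_nonneg _
  have : (∑ i : Fin 9, v i.succ * w i.succ) ^ 2 < (v 0 * w 0) ^ 2 := by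
    refine h.trans_lt ?_
    rw [mul_pow, pow_two, pow_two]
    exact mul_lt_mul'' (by linarith) (by linarith) p q
  linarith [abs_lt_of_sq_lt_sq this (by positivity) |> abs_lt.1 |>.2]

theorem ne_zero_of_lor_pos {v : Fin 10 → ℝ} (hv : 0 < lor v v) : v 0 ≠ 0 := by
  intro h
  rw [lor_eq_sub_sum, h] at hv
  have p : 0 ≤ ∑ i : Fin 9, v i.succ * v i.succ := Finset.sum_nonneg fun i _ => mul_self_nonneg _
  linarith

theorem GL10.apply_inv_apply (g : GL10) (v : Fin 10 → ℝ) : g.val ((g⁻¹).val v) = v :=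
  congrArg (fun f : (Fin 10 → ℝ) →L[ℝ] (Fin 10 → ℝ) => f v) g.mul_inv

theorem GL10.inv_apply_apply (g : GL10) (v : Fin 10 → ℝ) : (g⁻¹).val (g.val v) = v :=
  congrArg (fun f : (Fin 10 → ℝ) →L[ℝ] (Fin 10 → ℝ) => f v) g.inv_mul

/-- The determinant of an element of `GL(10,ℝ)`. -/
def GL10.det : GL10 →* ℝ where
  toFun g := LinearMap.det (g.val : (Fin 10 → ℝ) →ₗ[ℝ] (Fin 10 → ℝ))
  map_one' := LinearMap.det_id
  map_mul' g h := LinearMap.det_comp (g.val : (Fin 10 → ℝ) →ₗ[ℝ] (Fin 10 → ℝ))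
    (h.val : (Fin 10 → ℝ) →ₗ[ℝ] (Fin 10 → ℝ))

/-- The group of the linear maps that preserve the Lorentz form. -/
def lorentzGroup : Subgroup GL10 where
  carrier := {g | ∀ v w, lor (g.val v) (g.val w) = lor v w}
  one_mem' := fun _ _ => rfl
  mul_mem' := fun {g h} hg hh v w => (hg _ _).trans (hh v w)
  inv_mem' := fun {g} hg v w => by
    rw [← hg, g.apply_inv_apply, g.apply_inv_apply]

/-- The group of the linear maps that preserve the Lorentz form, the orientation and the
direction of time. -/
def restrictedLorentz : Subgroup GL10 where
  carrier := {g | g ∈ lorentzGroup ∧ GL10.det g = 1 ∧ ∀ v, 0 < lor v v → 0 < v 0 → 0 < g.val v 0}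
  one_mem' := ⟨one_mem _, map_one _, fun _ _ h => h⟩
  mul_mem' := by
    rintro g h ⟨g1, g2, g3⟩ ⟨h1, h2, h3⟩
    refine ⟨mul_mem g1 h1, ?_, fun v hv hv0 => g3 _ ?_ (h3 v hv hv0)⟩
    · rw [map_mul, g2, h2, one_mul]
    · exact lt_of_lt_of_eq hv (h1 v v).symm
  inv_mem' := by
    rintro g ⟨g1, g2, g3⟩
    refine ⟨inv_mem g1, ?_, fun v hv hv0 => ?_⟩
    · have := map_mul GL10.det g g⁻¹
      rw [mul_inv_cancel, map_one, g2, one_mul] at this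
      exact this.symm
    · have hl : 0 < lor ((g⁻¹).val v) ((g⁻¹).val v) :=
        lt_of_lt_of_eq hv (inv_mem g1 v v).symm
      refine lt_of_le_of_ne (le_of_not_gt fun hneg => ?_) (ne_zero_of_lor_pos hl).symm
      have := g3 ((-1 : ℝ) • (g⁻¹).val v) ?_ ?_
      · rw [map_smul, g.apply_inv_apply] at this
        simp only [Pi.smul_apply, smul_eq_mul] at this
        linarith
      · rw [lor_smul_left, lor_smul_right]; linarith
      · simp only [Pi.smul_apply, smul_eq_mul]; linarith

/-- One forward vector suffices: `⟨g e₀, g v⟩ = v₀ > 0` is impossible if `g e₀` is forward and `g v`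
is a backward timelike vector. -/
theorem mem_restrictedLorentz {g : GL10} (h1 : g ∈ lorentzGroup) (h2 : GL10.det g = 1)
    (h3 : 0 < g.val (Pi.single 0 1) 0) : g ∈ restrictedLorentz := by
  refine ⟨h1, h2, fun v hv hv0 => ?_⟩
  have e : ∀ w, lor (Pi.single 0 1) w = w 0 := fun w => by simp [lor_apply]
  have hl : 0 < lor (g.val v) (g.val v) := lt_of_lt_of_eq hv (h1 v v).symm
  have hu : lor (g.val (Pi.single 0 1)) (g.val (Pi.single 0 1)) = 1 := by
    rw [h1, e]; simp
  have huv : lor (g.val (Pi.single 0 1)) (g.val v) = v 0 := by rw [h1, e]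
  refine lt_of_le_of_ne (le_of_not_gt fun hneg => ?_) (ne_zero_of_lor_pos hl).symm
  have := zero_lt_lor (v := g.val (Pi.single 0 1)) (w := (-1 : ℝ) • g.val v) (by rw [hu]; norm_num)
    h3 (by rw [lor_smul_left, lor_smul_right]; linarith)
    (by simp only [Pi.smul_apply, smul_eq_mul]; linarith)
  rw [lor_smul_right, huv] at this
  linarith

theorem generators_subset : generators ⊆ (restrictedLorentz : Set GL10) := by
  rintro g ⟨M, hM, hg⟩
  refine ⟨fun v w => ?_, ?_, fun v hv hv0 => ?_⟩
  · obtain ⟨X, rfl⟩ := coord.surjective v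
    obtain ⟨Y, rfl⟩ := coord.surjective w
    rw [hg, hg]
    exact lor_map_of_hdet hM X Y
  · have : (g.val : (Fin 10 → ℝ) →ₗ[ℝ] (Fin 10 → ℝ)) = coord.conj (phi M) := by
      refine LinearMap.ext fun v => ?_
      rw [LinearEquiv.conj_apply_apply, ← hg, LinearEquiv.apply_symm_apply]
      rfl
    change LinearMap.det (g.val : (Fin 10 → ℝ) →ₗ[ℝ] (Fin 10 → ℝ)) = 1
    rw [this]
    exact (LinearMap.det_conj _ coord).trans (det_phi hM)
  · obtain ⟨X, rfl⟩ := coord.surjective v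
    rw [hg]
    have hX := hM X
    obtain ⟨α, x, β, rfl⟩ := exists_hm X
    rw [← hdet_eq_lor, hdet_hm] at hv
    rw [Matrix.eta_fin_two M, phi_hm', hdet_hm, hdet_hm] at hX
    rw [Matrix.eta_fin_two M, phi_hm']
    rw [coord_hm] at hv0 ⊢
    have hs : 0 < α + β := by
      have : 0 < (α + β) / 2 := hv0
      linarith
    change 0 < (_ + _) / 2
    have hαβ : 0 < α * β := by linarith [normSq_nonneg x]
    have hα : 0 < α := by
      by_contra h
      have hβ : 0 < β := by linarith
      nlinarith
    -- Completing the square: `α` times this diagonal entry is `‖αa + bx̄‖² + (det X)‖b‖²`.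
    have key : ∀ a b : Octonion, 0 ≤ α * normSq a + β * normSq b + 2 * ip (a * x) b := by
      intro a b
      have e : α * (α * normSq a + β * normSq b + 2 * ip (a * x) b) =
          normSq (α • a + b * star x) + (α * β - normSq x) * normSq b := by
        rw [normSq_add, normSq_smul, normSq_mul, normSq_star, ip_smul_left, ip_mul_right]
        ring
      refine nonneg_of_mul_nonneg_right ?_ hα
      rw [e]
      exact add_nonneg (normSq_nonneg _) (mul_nonneg hv.le (normSq_nonneg _))
    have k1 := key (M 0 0) (M 0 1)
    have k2 := key (M 1 0) (M 1 1)
    -- If the trace of the image vanished, so would both diagonal entries, and its determinant could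
    -- not be positive.
    refine div_pos (lt_of_le_of_ne (add_nonneg k1 k2) fun h0 => ?_) two_pos
    have z1 := le_antisymm (by linarith) k1
    have := normSq_nonneg (α • (M 0 0 * star (M 1 0)) + β • (M 0 1 * star (M 1 1))
      + phiOff (M 0 0) (M 0 1) (M 1 0) (M 1 1) x)
    rw [z1, zero_mul] at hX
    linarith

theorem directedGenerators_subset : directedGenerators ⊆ generators :=
  fun _ ⟨M, _, h1, h2⟩ => ⟨M, h1, h2⟩

/-! ### Generation by Hermitian matrices -/

/-- The map `η` as an element of `GL(10,ℝ)`. -/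
def etaUnit : GL10 where
  val := LinearMap.toContinuousLinearMap (Matrix.toLin' eta)
  inv := LinearMap.toContinuousLinearMap (Matrix.toLin' eta)
  val_inv := by ext1 y; exact eta_mulVec_eta_mulVec y
  inv_val := by ext1 y; exact eta_mulVec_eta_mulVec y

theorem det_etaUnit : GL10.det etaUnit = -1 := by
  change LinearMap.det (Matrix.toLin' eta) = -1
  rw [LinearMap.det_toLin', eta, Matrix.det_diagonal]
  norm_num [Fin.prod_univ_succ]

/-- A Lorentz map that fixes the time axis preserves time coordinates, so it is Euclidean
orthogonal. -/
theorem dotProduct_map {h : GL10} (hh : h ∈ lorentzGroup)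
    (h0 : h.val (Pi.single 0 1) = Pi.single 0 1) (v w : Fin 10 → ℝ) :
    h.val v ⬝ᵥ h.val w = v ⬝ᵥ w := by
  have e : ∀ w, (h.val w) 0 = w 0 := fun w => by
    have := hh (Pi.single 0 1) w
    rw [h0] at this
    simpa [lor_apply] using this
  rw [dotProduct_eq_sub_lor, dotProduct_eq_sub_lor, hh, e, e]

/-- Householder induction on the number `k` of coordinate vectors not yet known to be fixed. The
available maps are reflections multiplied by `η`, which commutes with them, so every reflection
switches between the two alternatives. -/
theorem mem_closure_or {k : ℕ} : ∀ {h : GL10}, h ∈ lorentzGroup → k ≤ 9 →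
    (∀ i : Fin 10, i.val + k < 10 → h.val (Pi.single i 1) = Pi.single i 1) →
    h ∈ Submonoid.closure directedGenerators ∨
      etaUnit * h ∈ Submonoid.closure directedGenerators := by
  induction k with
  | zero =>
    intro h _ _ hfix
    left
    have : h = 1 := by
      refine Units.ext (ContinuousLinearMap.coe_injective (LinearMap.pi_ext' fun i => ?_))
      ext1
      exact hfix i (by omega)
    rw [this]
    exact one_mem _
  | succ k ih =>
    intro h hh hk hfix
    -- The first index that `hfix` does not cover.
    let j : Fin 10 := ⟨9 - k, by omega⟩
    have h0 : h.val (Pi.single 0 1) = Pi.single 0 1 := hfix 0 (by simp; omega)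
    by_cases hj : h.val (Pi.single j 1) = Pi.single j 1
    · refine ih hh (by omega) fun i hi => ?_
      by_cases hij : i.val = 9 - k
      · rw [show i = j from Fin.ext hij]; exact hj
      · exact hfix i (by omega)
    set w := h.val (Pi.single j 1) with hw
    have hdot := dotProduct_map hh h0
    have hj0 : j ≠ 0 := fun h' => by
      have : (9 - k : ℕ) = 0 := congrArg Fin.val h'
      omega
    have hww : w ⬝ᵥ w = 1 := by rw [hw, hdot]; simp
    have hwi : ∀ i : Fin 10, i.val < 9 - k → w i = 0 := fun i hi => by
      have := hdot (Pi.single j 1) (Pi.single i 1)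
      rw [hfix i (by omega), ← hw, dotProduct_single, dotProduct_single,
        Pi.single_eq_of_ne (fun h' => by rw [h'] at hi; exact lt_irrefl _ hi)] at this
      simpa using this
    have hpos : 0 < (w - Pi.single j 1) ⬝ᵥ (w - Pi.single j 1) := by
      refine lt_of_le_of_ne (Finset.sum_nonneg fun i _ => mul_self_nonneg _) fun h' => hj ?_
      exact sub_eq_zero.1 (dotProduct_self_eq_zero.1 h'.symm)
    set n := √((w - Pi.single j 1) ⬝ᵥ (w - Pi.single j 1)) with hn
    have hn0 : n ≠ 0 := (Real.sqrt_pos.2 hpos).ne'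
    have hn2 : n * n = 2 - 2 * w j := by
      rw [hn, Real.mul_self_sqrt hpos.le, dotProduct_sub, sub_dotProduct, sub_dotProduct, hww]
      simp only [dotProduct_single, single_dotProduct, Pi.single_eq_same]
      ring
    -- The reflection in `w - eⱼ` exchanges `w` and `eⱼ`. It fixes the earlier coordinate vectors
    -- because `v` vanishes there.
    set v := n⁻¹ • (w - Pi.single j 1) with hv
    have hvv : v ⬝ᵥ v = 1 := by
      rw [hv, dotProduct_smul, smul_dotProduct, ← Real.mul_self_sqrt hpos.le, ← hn, smul_eq_mul,
        smul_eq_mul]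
      field_simp
    have hvi : ∀ i : Fin 10, i.val < 9 - k → v i = 0 := fun i hi => by
      have hij : i ≠ j := fun h' => by rw [h'] at hi; exact lt_irrefl _ hi
      simp [hv, hwi i hi, Pi.single_eq_of_ne hij]
    have hv0 : v 0 = 0 := hvi 0 (by simp; omega)
    have hl : lor v v = -1 := by
      have := dotProduct_eq_sub_lor v v
      rw [hvv, hv0] at this
      linarith
    have heta : eta *ᵥ v = -v := by
      ext i
      rw [eta, Matrix.mulVec_diagonal]
      split_ifs with hi
      · rw [hi, Pi.neg_apply, hv0]; simp
      · simp
    have hb : lor v v ^ 2 = 1 := by rw [hl]; norm_num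
    have hrefl : ∀ y, (etaUnit * boost v hb).val y = y - (2 * (v ⬝ᵥ y)) • v := fun y => by
      have : (etaUnit * boost v hb).val y = eta *ᵥ ((2 * (v ⬝ᵥ y)) • v - lor v v • (eta *ᵥ y)) :=
        rfl
      rw [this, Matrix.mulVec_sub, Matrix.mulVec_smul eta (lor v v),
        Matrix.mulVec_smul eta (2 * _), eta_mulVec_eta_mulVec,
        heta, hl]
      module
    have hcomm : etaUnit * boost v hb = boost v hb * etaUnit := by
      refine Units.ext (ContinuousLinearMap.ext fun y => ?_)
      rw [hrefl]
      have : (boost v hb * etaUnit).val y =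
        (2 * (v ⬝ᵥ eta *ᵥ y)) • v - lor v v • (eta *ᵥ (eta *ᵥ y)) := rfl
      have e : v ⬝ᵥ eta *ᵥ y = - (v ⬝ᵥ y) := by
        rw [← lor, ← eta_mulVec_dotProduct, heta, neg_dotProduct]
      rw [this, e, hl, eta_mulVec_eta_mulVec]
      module
    have hmem : etaUnit * boost v hb ∈ lorentzGroup :=
      mul_mem (fun x y => lor_eta_eta x y)
        (generators_subset (directedGenerators_subset (boost_mem hb))).1
    have hcl := Submonoid.subset_closure (boost_inv_mem hb)
    have he2 : etaUnit * etaUnit = 1 := Units.ext etaUnit.inv_mul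
    have hf : ∀ i : Fin 10, i.val + k < 10 →
        (etaUnit * boost v hb * h).val (Pi.single i 1) = Pi.single i 1 := fun i hi => by
      have : (etaUnit * boost v hb * h).val (Pi.single i 1) =
        (etaUnit * boost v hb).val (h.val (Pi.single i 1)) := rfl
      rw [this, hrefl]
      by_cases hij : i.val = 9 - k
      · rw [show i = j from Fin.ext hij, ← hw]
        have e : 2 * (v ⬝ᵥ w) = n := by
          rw [hv, smul_dotProduct, sub_dotProduct, hww, single_dotProduct, smul_eq_mul]
          field_simp
          linarith
        rw [e, hv, smul_smul, mul_inv_cancel₀ hn0, one_smul, sub_sub_cancel]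
      · rw [hfix i (by omega)]
        have : v i = 0 := hvi i (by omega)
        rw [dotProduct_single, this]
        simp
    rcases ih (mul_mem hmem hh) (by omega) hf with h1 | h1
    · right
      have : etaUnit * h = (boost v hb)⁻¹ * (etaUnit * boost v hb * h) := by
        rw [hcomm]; group
      rw [this]
      exact mul_mem hcl h1
    · left
      have : h = (boost v hb)⁻¹ * (etaUnit * (etaUnit * boost v hb * h)) := by
        rw [← mul_assoc etaUnit, ← mul_assoc etaUnit, he2]; group
      rw [this]
      exact mul_mem hcl h1

theorem det_of_mem_closure {g : GL10} (hg : g ∈ Submonoid.closure directedGenerators) :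
    GL10.det g = 1 := by
  have : Submonoid.closure directedGenerators ≤ restrictedLorentz.toSubmonoid :=
    Submonoid.closure_le.2 (directedGenerators_subset.trans generators_subset)
  exact (this hg).2.1

theorem restrictedLorentz_le :
    restrictedLorentz.toSubmonoid ≤ Submonoid.closure directedGenerators := by
  intro g hg
  set w := g.val (Pi.single 0 1) with hw
  have e : ∀ w, lor (Pi.single 0 1) w = w 0 := fun w => by simp [lor_apply]
  have hl : lor w w = 1 := by rw [hw, hg.1, e]; simp
  have hw0 : 0 < w 0 := hg.2.2 _ (by rw [e]; simp) (by simp)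
  set n := √(2 + 2 * w 0) with hn
  have hn2 : n * n = 2 + 2 * w 0 := Real.mul_self_sqrt (by linarith)
  have hn0 : n ≠ 0 := fun h => by rw [h] at hn2; linarith
  have hη0 : (eta *ᵥ w) 0 = w 0 := by rw [eta, Matrix.mulVec_diagonal]; simp
  -- The normalized sum of `e₀` and `ηw`: with this `v`, the map of `hermOf v` sends `w` back to
  -- `e₀`.
  set v := n⁻¹ • (Pi.single 0 1 + eta *ᵥ w) with hv
  have hvw : v ⬝ᵥ w = n⁻¹ * (w 0 + 1) := by
    rw [hv, smul_dotProduct, add_dotProduct, eta_mulVec_dotProduct, hl]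
    simp
  have hvv : lor v v = 1 := by
    rw [hv, lor_smul_left, lor_smul_right, lor_add_left, lor_add_right, lor_add_right,
      lor_eta_eta, hl, lor_comm (eta *ᵥ w) (Pi.single 0 1), e, e, hη0, Pi.single_eq_same]
    field_simp
    linarith
  have hb : lor v v ^ 2 = 1 := by rw [hvv]; norm_num
  have hfix : (boost v hb * g).val (Pi.single 0 1) = Pi.single 0 1 := by
    change (boost v hb).val w = _
    rw [boost_apply, hvw, hvv, hv, smul_smul]
    have : 2 * (n⁻¹ * (w 0 + 1)) * n⁻¹ = 1 := by field_simp; linarith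
    rw [this]
    module
  have hmem := directedGenerators_subset.trans generators_subset (boost_mem hb)
  have hcl := Submonoid.subset_closure (boost_inv_mem hb)
  have hfin : boost v hb * g ∈ Submonoid.closure directedGenerators := by
    -- With `k = 9` only `e₀` has to be fixed. The alternative with `η` is excluded because `det η =
    -- -1`.
    refine (mem_closure_or (k := 9) (mul_mem hmem.1 hg.1) le_rfl fun i hi => ?_).resolve_right
      fun h => ?_
    · rw [show i = 0 from Fin.ext (by simp; omega)]
      exact hfix
    · have := det_of_mem_closure h
      rw [map_mul, map_mul, hmem.2.1, hg.2.1, det_etaUnit] at this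
      norm_num at this
  have := mul_mem hcl hfin
  rwa [inv_mul_cancel_left] at this

theorem SL2O_eq_restrictedLorentz : SL2O = restrictedLorentz := by
  refine le_antisymm ((Subgroup.closure_le _).2 generators_subset) fun g hg => ?_
  have h : Submonoid.closure directedGenerators ≤ SL2O.toSubmonoid :=
    Submonoid.closure_le.2 (directedGenerators_subset.trans Subgroup.subset_closure)
  exact h (restrictedLorentz_le hg)

theorem closure_directedGenerators :
    (Submonoid.closure directedGenerators : Set GL10) = (SL2O : Set GL10) := by
  refine Set.Subset.antisymm (fun g hg => ?_) (fun g hg => ?_)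
  · have h : Submonoid.closure directedGenerators ≤ SL2O.toSubmonoid :=
      Submonoid.closure_le.2 (directedGenerators_subset.trans Subgroup.subset_closure)
    exact h hg
  · rw [SL2O_eq_restrictedLorentz] at hg
    exact restrictedLorentz_le hg

/-! ### Brackets of left-invariant vector fields -/

section
variable {E R : Type*} [NormedAddCommGroup E] [NormedSpace ℝ E] [NormedRing R] [NormedAlgebra ℝ R]

open Filter Topology in
/-- If `F` intertwines the vector fields `V, W` with right multiplication by `a, b`, then it
intertwines their Lie bracket with right multiplication by `ab - ba`. -/
theorem fderiv_lieBracket {F : E → R} {V W : E → E} {y : E} {a b : R} (hF : ContDiffAt ℝ 2 F y)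
    (hV : DifferentiableAt ℝ V y) (hW : DifferentiableAt ℝ W y)
    (ha : ∀ᶠ z in 𝓝 y, fderiv ℝ F z (V z) = F z * a)
    (hb : ∀ᶠ z in 𝓝 y, fderiv ℝ F z (W z) = F z * b) :
    fderiv ℝ F y (VectorField.lieBracket ℝ V W y) = F y * a * b - F y * b * a := by
  have hF1 : DifferentiableAt ℝ F y := hF.differentiableAt (by norm_num)
  have hF2 : DifferentiableAt ℝ (fderiv ℝ F) y :=
    (hF.fderiv_right (m := 1) (by norm_num)).differentiableAt (by norm_num)
  -- The relation `F'(U) = F c` is differentiated in the direction `u`. The second derivatives of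
  -- `F` for the two fields cancel below by symmetry.
  have main : ∀ {U : E → E} {c : R}, DifferentiableAt ℝ U y →
      (∀ᶠ z in 𝓝 y, fderiv ℝ F z (U z) = F z * c) → ∀ u,
      fderiv ℝ (fderiv ℝ F) y u (U y) + fderiv ℝ F y (fderiv ℝ U y u) = fderiv ℝ F y u * c := by
    intro U c hU hc u
    have h1 : HasFDerivAt (fun z => fderiv ℝ F z (U z)) _ y :=
      hF2.hasFDerivAt.clm_apply hU.hasFDerivAt
    have h2 : HasFDerivAt (fun z => F z * c) _ y := hF1.hasFDerivAt.mul_const' c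
    have := congrArg (fun f : E →L[ℝ] R => f u)
      ((h1.congr_of_eventuallyEq (hc.mono fun z hz => hz.symm)).unique h2)
    simp at this
    rw [← this]
    abel
  have hs := hF.isSymmSndFDerivAt (by simp [minSmoothness_of_isRCLikeNormedField])
  have e1 := main hV ha (W y)
  have e2 := main hW hb (V y)
  rw [ha.self_of_nhds] at e2
  rw [hb.self_of_nhds] at e1
  rw [VectorField.lieBracket_eq, map_sub, ← e1, ← e2, hs.eq (V y) (W y)]
  abel

variable {G : Type*} [TopologicalSpace G] [ChartedSpace E G] [Group G]
  [LieGroup 𝓘(ℝ, E) ∞ G]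

variable (E) in
/-- The derivative of an algebra-valued function on a manifold modelled on a vector space, as a
linear map on the model space. -/
def modelDeriv {M : Type*} [TopologicalSpace M] [ChartedSpace E M] (f : M → R) (x : M) :
    E →L[ℝ] R := mfderiv 𝓘(ℝ, E) 𝓘(ℝ, R) f x

/-- The chain rule for `ι(gx) = ι(g)ι(x)` at `x = 1`. -/
theorem modelDeriv_mulInvariantVectorField (ι : G →* R) (hι : ContMDiff 𝓘(ℝ, E) 𝓘(ℝ, R) ∞ ι)
    (v : GroupLieAlgebra 𝓘(ℝ, E) G) (g : G) :
    modelDeriv E ι g (mulInvariantVectorField v g) = ι g * modelDeriv E ι 1 v := by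
  have d : ∀ x, HasMFDerivAt 𝓘(ℝ, E) 𝓘(ℝ, R) ι x (mfderiv 𝓘(ℝ, E) 𝓘(ℝ, R) ι x) := fun x =>
    ((hι x).mdifferentiableAt (by simp)).hasMFDerivAt
  have dl : HasMFDerivAt 𝓘(ℝ, E) 𝓘(ℝ, E) (fun x => g * x) (1 : G)
      (mfderiv 𝓘(ℝ, E) 𝓘(ℝ, E) (fun x => g * x) (1 : G)) :=
    ((contMDiff_mul_left (I := 𝓘(ℝ, E)) (n := ∞) (a := g) 1).mdifferentiableAt
      (by simp)).hasMFDerivAt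
  have h1 := (d (g * 1)).comp (1 : G) dl
  have h2 : HasMFDerivAt 𝓘(ℝ, E) 𝓘(ℝ, R) (fun x => ι g * ι x) (1 : G) _ :=
    ((ContinuousLinearMap.mul ℝ R (ι g)).hasFDerivAt (x := ι 1)).hasMFDerivAt.comp (1 : G) (d 1)
  have h3 : (ι ∘ fun x => g * x) = fun x => ι g * ι x := funext fun x => map_mul ι g x
  rw [h3] at h1
  have h4 := hasMFDerivAt_unique h1 h2
  have h5 := congrArg (fun f : E →L[ℝ] R => f v) h4
  have h6 : modelDeriv E ι (g * 1) (mulInvariantVectorField v g) = ι g * modelDeriv E ι 1 v := h5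
  rwa [mul_one] at h6

open Set in
-- In the chart at `1`, the representation `ι` intertwines the pulled-back invariant fields with
-- right multiplications, so `fderiv_lieBracket` applies.
theorem modelDeriv_bracket [CompleteSpace E] (ι : G →* R) (hι : ContMDiff 𝓘(ℝ, E) 𝓘(ℝ, R) ∞ ι)
    (v w : GroupLieAlgebra 𝓘(ℝ, E) G) :
    modelDeriv E ι 1 (⁅v, w⁆ : GroupLieAlgebra 𝓘(ℝ, E) G) =
      modelDeriv E ι 1 v * modelDeriv E ι 1 w - modelDeriv E ι 1 w * modelDeriv E ι 1 v := by
  have hL : LieGroup 𝓘(ℝ, E) (minSmoothness ℝ 3) G := by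
    rw [minSmoothness_of_isRCLikeNormedField]
    exact LieGroup.of_le (n := ∞) (by norm_cast)
  have hM : IsManifold 𝓘(ℝ, E) 1 G := IsManifold.of_le (n := ∞) (by simp)
  have hM' : IsManifold 𝓘(ℝ, E) ∞ G := inferInstance
  set φ := extChartAt 𝓘(ℝ, E) (1 : G) with hφ
  have d : ∀ x, HasMFDerivAt 𝓘(ℝ, E) 𝓘(ℝ, R) ι x (mfderiv 𝓘(ℝ, E) 𝓘(ℝ, R) ι x) := fun x =>
    ((hι x).mdifferentiableAt (by simp)).hasMFDerivAt
  let F : E → R := ι ∘ φ.symm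
  let A : E → E →L[ℝ] E := fun y => mfderivWithin 𝓘(ℝ, E) 𝓘(ℝ, E) φ.symm (range 𝓘(ℝ, E)) y
  let V : GroupLieAlgebra 𝓘(ℝ, E) G → E → E := fun u y =>
    (A y).inverse (mulInvariantVectorField u (φ.symm y))
  have ho : IsOpen φ.target := isOpen_extChartAt_target 1
  have h0 : φ 1 ∈ φ.target := mem_extChartAt_target 1
  have hFs : ContDiffOn ℝ ∞ F φ.target := by
    rw [← contMDiffOn_iff_contDiffOn]
    exact hι.comp_contMDiffOn (contMDiffOn_extChartAt_symm 1)
  have hF : ContDiffAt ℝ 2 F (φ 1) :=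
    (hFs.contDiffAt (ho.mem_nhds h0)).of_le (by norm_cast)
  have huniv : φ.symm ⁻¹' univ ∩ range 𝓘(ℝ, E) = univ := by simp
  have hdiff : ∀ u, DifferentiableAt ℝ (V u) (φ 1) := fun u => by
    have := (mdifferentiableAt_mulInvariantVectorField u
      (g := 1)).mdifferentiableWithinAt (s := univ)
      |>.differentiableWithinAt_mpullbackWithin_vectorField
    rw [huniv] at this
    exact differentiableWithinAt_univ.1 (show DifferentiableWithinAt ℝ (V u) univ (φ 1) from this)
  have hA : ∀ y ∈ φ.target, (A y).IsInvertible := fun y hy =>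
    isInvertible_mfderivWithin_extChartAt_symm hy
  have hFA : ∀ y ∈ φ.target, fderiv ℝ F y = (modelDeriv E ι (φ.symm y)).comp (A y) :=
      fun y hy => by
    have h1 : HasMFDerivWithinAt 𝓘(ℝ, E) 𝓘(ℝ, E) φ.symm (range 𝓘(ℝ, E)) y (A y) :=
      (mdifferentiableWithinAt_extChartAt_symm hy).hasMFDerivWithinAt
    rw [ModelWithCorners.range_eq_univ, hasMFDerivWithinAt_univ] at h1
    exact HasFDerivAt.fderiv (hasMFDerivAt_iff_hasFDerivAt.1 ((d _).comp y h1))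
  have hpull : ∀ u, ∀ y ∈ φ.target, fderiv ℝ F y (V u y) = F y * modelDeriv E ι 1 u :=
      fun u y hy => by
    rw [hFA y hy, ContinuousLinearMap.comp_apply]
    have : A y (V u y) = mulInvariantVectorField u (φ.symm y) := (hA y hy).self_apply_inverse _
    rw [this]
    exact modelDeriv_mulInvariantVectorField ι hι u _
  have hev : ∀ u, ∀ᶠ y in nhds (φ 1), fderiv ℝ F y (V u y) = F y * modelDeriv E ι 1 u := fun u =>
    (ho.eventually_mem h0).mono (hpull u)
  have key := fderiv_lieBracket hF (hdiff v) (hdiff w) (hev v) (hev w)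
  have hF1 : F (φ 1) = 1 := by
    change ι (φ.symm (φ 1)) = 1
    rw [extChartAt_to_inv, map_one]
  rw [hF1, one_mul, one_mul] at key
  rw [← key]
  let C : E →L[ℝ] E := mfderiv 𝓘(ℝ, E) 𝓘(ℝ, E) φ 1
  have hC : C.IsInvertible := isInvertible_mfderiv_extChartAt (mem_extChartAt_source 1)
  -- By definition the bracket at `1` is computed in the chart and carried back by the inverse of
  -- the chart's derivative.
  have hbr : (⁅v, w⁆ : GroupLieAlgebra 𝓘(ℝ, E) G) = C.inverse (VectorField.lieBracketWithin ℝ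
      (V v) (V w) (φ.symm ⁻¹' univ ∩ range 𝓘(ℝ, E)) (φ 1)) := rfl
  rw [huniv, VectorField.lieBracketWithin_univ] at hbr
  have hAC : (A (φ 1)).comp C = .id ℝ E :=
    mfderivWithin_extChartAt_symm_comp_mfderiv_extChartAt' (mem_extChartAt_source 1)
  have h1 : φ.symm (φ 1) = 1 := extChartAt_to_inv 1
  rw [hFA _ h0, h1, ContinuousLinearMap.comp_apply]
  refine congrArg (modelDeriv E ι 1) (hbr.trans ?_)
  generalize VectorField.lieBracket ℝ (V v) (V w) (φ 1) = X
  have := congrArg (fun f : E →L[ℝ] E => f (C.inverse X)) hAC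
  simp only [ContinuousLinearMap.comp_apply] at this
  rw [hC.self_apply_inverse] at this
  exact this.symm

end

/-! ### Lie group structure from a slice chart -/

section
variable {R : Type*} [NormedRing R] [NormedAlgebra ℝ R] [CompleteSpace R]

/-- A chart of `Rˣ` around the identity in which the subgroup `G` is a linear subspace. -/
structure SliceChart (G : Subgroup Rˣ) (E F : Type*) [NormedAddCommGroup E] [NormedSpace ℝ E]
    [NormedAddCommGroup F] [NormedSpace ℝ F] where
  chart : OpenPartialHomeomorph Rˣ R
  split : (E × F) ≃L[ℝ] R
  one_mem : 1 ∈ chart.source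
  chart_one : chart 1 = 0
  contMDiffOn : ContMDiffOn 𝓘(ℝ, R) 𝓘(ℝ, R) ∞ chart chart.source
  contMDiffOn_symm : ContMDiffOn 𝓘(ℝ, R) 𝓘(ℝ, R) ∞ chart.symm chart.target
  mem_iff : ∀ g ∈ chart.source, g ∈ G ↔ (split.symm (chart g)).2 = 0
  hasFDerivAt : HasFDerivAt (fun A => ((chart.symm A : Rˣ) : R)) (ContinuousLinearMap.id ℝ R) 0

namespace SliceChart

variable {G : Subgroup Rˣ} {E F : Type*} [NormedAddCommGroup E] [NormedSpace ℝ E]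
    [NormedAddCommGroup F] [NormedSpace ℝ F] (S : SliceChart G E F)

theorem symm_mem {y : E} (hy : S.split (y, 0) ∈ S.chart.target) :
    S.chart.symm (S.split (y, 0)) ∈ G := by
  rw [S.mem_iff _ (S.chart.map_target hy), S.chart.right_inv hy]
  simp

open Classical in
/-- The parametrization of the subgroup near the identity. -/
def param (y : E) : G :=
  -- The value `1` outside the target is a default that the chart `base` does not see.
  if hy : S.split (y, 0) ∈ S.chart.target then ⟨_, S.symm_mem hy⟩ else 1

theorem coe_param {y : E} (hy : S.split (y, 0) ∈ S.chart.target) :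
    (S.param y : Rˣ) = S.chart.symm (S.split (y, 0)) := by
  rw [param, dif_pos hy]

theorem split_fst {g : G} (hg : (g : Rˣ) ∈ S.chart.source) :
    S.split ((S.split.symm (S.chart g)).1, 0) = S.chart g := by
  have h := (S.mem_iff _ hg).1 g.2
  rw [← h, Prod.mk.eta, ContinuousLinearEquiv.apply_symm_apply]

theorem continuous_inl : Continuous fun y : E => S.split (y, 0) := by fun_prop

/-- The chart of the subgroup at the identity. -/
def base : OpenPartialHomeomorph G E where
  toFun g := (S.split.symm (S.chart g)).1
  invFun := S.param
  source := {g | (g : Rˣ) ∈ S.chart.source}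
  target := {y | S.split (y, 0) ∈ S.chart.target}
  map_source' g hg := by
    change S.split ((S.split.symm (S.chart g)).1, 0) ∈ S.chart.target
    rw [S.split_fst hg]
    exact S.chart.map_source hg
  map_target' y hy := by
    change (S.param y : Rˣ) ∈ S.chart.source
    rw [S.coe_param hy]
    exact S.chart.map_target hy
  left_inv' g hg := by
    apply Subtype.ext
    have h := S.split_fst hg
    rw [S.coe_param (by rw [h]; exact S.chart.map_source hg), h, S.chart.left_inv hg]
  right_inv' y hy := by
    rw [S.coe_param hy, S.chart.right_inv hy]
    simp
  open_source := S.chart.open_source.preimage continuous_subtype_val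
  open_target := S.chart.open_target.preimage S.continuous_inl
  continuousOn_toFun := by
    refine (continuous_fst.comp S.split.symm.continuous).comp_continuousOn ?_
    exact S.chart.continuousOn.comp continuous_subtype_val.continuousOn fun g hg => hg
  continuousOn_invFun := by
    rw [Topology.IsEmbedding.subtypeVal.continuousOn_iff]
    refine ContinuousOn.congr ?_ fun y hy => S.coe_param hy
    exact S.chart.continuousOn_symm.comp S.continuous_inl.continuousOn fun y hy => hy

/-- The translated chart of the subgroup at `h`. -/
def chartAtPoint (h : G) : OpenPartialHomeomorph G E :=
  (Homeomorph.mulLeft h⁻¹).transOpenPartialHomeomorph S.base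

theorem chartAtPoint_apply (h g : G) :
    S.chartAtPoint h g = (S.split.symm (S.chart ((h : Rˣ)⁻¹ * (g : Rˣ)))).1 := rfl

theorem mem_chartAtPoint_source (h g : G) :
    g ∈ (S.chartAtPoint h).source ↔ (h : Rˣ)⁻¹ * (g : Rˣ) ∈ S.chart.source := by
  simp [chartAtPoint, base]

theorem mem_chartAtPoint_target (h : G) (y : E) :
    y ∈ (S.chartAtPoint h).target ↔ S.split (y, 0) ∈ S.chart.target := by
  simp [chartAtPoint, base]

theorem coe_chartAtPoint_symm (h : G) {y : E} (hy : y ∈ (S.chartAtPoint h).target) :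
    ((S.chartAtPoint h).symm y : Rˣ) = (h : Rˣ) * S.chart.symm (S.split (y, 0)) := by
  rw [← S.coe_param ((S.mem_chartAtPoint_target h y).1 hy)]
  have : (S.chartAtPoint h).symm y = h⁻¹⁻¹ * S.param y := rfl
  rw [this, inv_inv]
  rfl

/-- The manifold structure on the subgroup. -/
@[reducible] def chartedSpace : ChartedSpace E G where
  atlas := Set.range S.chartAtPoint
  chartAt := S.chartAtPoint
  mem_chart_source h := by
    rw [mem_chartAtPoint_source, inv_mul_cancel]
    exact S.one_mem
  chart_mem_atlas h := ⟨h, rfl⟩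

theorem contMDiffOn_coe_symm (h : G) : ContMDiffOn 𝓘(ℝ, E) 𝓘(ℝ, R) ∞
    (fun y => ((S.chartAtPoint h).symm y : Rˣ)) (S.chartAtPoint h).target := by
  refine ContMDiffOn.congr ?_ fun y hy => S.coe_chartAtPoint_symm h hy
  refine (contMDiff_mul_left (I := 𝓘(ℝ, R)) (a := (h : Rˣ))).comp_contMDiffOn ?_
  refine S.contMDiffOn_symm.comp (ContDiff.contMDiff ?_).contMDiffOn fun y hy =>
    (S.mem_chartAtPoint_target h y).1 hy
  exact S.split.contDiff.comp (contDiff_id.prodMk contDiff_const)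

/-- Transition maps are composed of ambient charts, a left translation of `Rˣ` and the linear
splitting, all smooth. -/
theorem isManifold : @IsManifold ℝ _ E _ _ E _ 𝓘(ℝ, E) ∞ G _ S.chartedSpace := by
  let _ := S.chartedSpace
  refine isManifold_of_contDiffOn _ _ _ ?_
  rintro _ _ ⟨h, rfl⟩ ⟨h', rfl⟩
  rw [← contMDiffOn_iff_contDiffOn]
  simp only [modelWithCornersSelf_coe, modelWithCornersSelf_coe_symm, Function.id_comp,
    Function.comp_id, Set.range_id, Set.inter_univ, Set.preimage_id]
  have h1 : ContMDiffOn 𝓘(ℝ, E) 𝓘(ℝ, R) ∞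
      (fun y => (h' : Rˣ)⁻¹ * ((S.chartAtPoint h).symm y : Rˣ))
      ((S.chartAtPoint h).symm.trans (S.chartAtPoint h')).source :=
    (contMDiff_mul_left (I := 𝓘(ℝ, R)) (a := (h' : Rˣ)⁻¹)).comp_contMDiffOn
      ((S.contMDiffOn_coe_symm h).mono fun y hy => hy.1)
  have h2 : ContMDiff 𝓘(ℝ, R) 𝓘(ℝ, E) ∞ fun A : R => (S.split.symm A).1 :=
    ContDiff.contMDiff (contDiff_fst.comp S.split.symm.contDiff)
  exact h2.comp_contMDiffOn
    (S.contMDiffOn.comp h1 fun y hy => (S.mem_chartAtPoint_source h' _).1 hy.2)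

/-- The translated ambient chart. -/
def ambient (h : Rˣ) : OpenPartialHomeomorph Rˣ R :=
  (Homeomorph.mulLeft h⁻¹).transOpenPartialHomeomorph S.chart

theorem ambient_mem (h : Rˣ) : S.ambient h ∈ IsManifold.maximalAtlas 𝓘(ℝ, R) ∞ Rˣ := by
  refine OpenPartialHomeomorph.mem_maximalAtlas_of_contMDiffOn _ ?_ ?_
  · exact S.contMDiffOn.comp
      (contMDiff_mul_left (I := 𝓘(ℝ, R)) (a := h⁻¹)).contMDiffOn fun g hg => hg
  · exact (contMDiff_mul_left (I := 𝓘(ℝ, R)) (a := h⁻¹⁻¹)).comp_contMDiffOn S.contMDiffOn_symm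

/-- In the translated charts the inclusion is `y ↦ split (y, 0)`, hence an immersion. Smoothness of
product and inverse can be tested after composing with it, and there it is that of `Rˣ`. -/
theorem exists_lieGroup : ∃ (_ : ChartedSpace E G) (_ : LieGroup 𝓘(ℝ, E) ∞ G),
    Manifold.IsSmoothEmbedding 𝓘(ℝ, E) 𝓘(ℝ, R) ∞ (Subtype.val : G → Rˣ) ∧
    ∀ v, modelDeriv E (fun g : G => ((g : Rˣ) : R)) 1 v = S.split (v, 0) := by
  let _ := S.chartedSpace
  have _ := S.isManifold
  have himm : Manifold.IsImmersion 𝓘(ℝ, E) 𝓘(ℝ, R) ∞ (Subtype.val : G → Rˣ) := by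
    refine Manifold.IsImmersionOfComplement.isImmersion (F := F) fun h => ?_
    refine Manifold.IsImmersionAtOfComplement.mk_of_charts S.split (S.chartAtPoint h)
      (S.ambient h) (mem_chart_source E h) ?_ (IsManifold.chart_mem_maximalAtlas h)
      (S.ambient_mem h) (fun g hg => (S.mem_chartAtPoint_source h g).1 hg) fun y hy => ?_
    · exact (S.mem_chartAtPoint_source h h).1 (mem_chart_source E h)
    · have hy' : y ∈ (S.chartAtPoint h).target := by simpa using hy
      change S.chart ((h : Rˣ)⁻¹ * ((S.chartAtPoint h).symm y : Rˣ)) = S.split (y, 0)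
      rw [S.coe_chartAtPoint_symm h hy', inv_mul_cancel_left,
        S.chart.right_inv ((S.mem_chartAtPoint_target h y).1 hy')]
  have hval := himm.contMDiff
  have hlie : LieGroup 𝓘(ℝ, E) ∞ G :=
    { contMDiff_mul := by
        rw [ContMDiff.iff_comp_isImmersion himm]
        exact ⟨continuous_mul, (hval.comp contMDiff_fst).mul (hval.comp contMDiff_snd)⟩
      contMDiff_inv := by
        rw [ContMDiff.iff_comp_isImmersion himm]
        exact ⟨continuous_inv, hval.inv⟩ }
  refine ⟨inferInstance, hlie, ⟨himm, Topology.IsEmbedding.subtypeVal⟩, fun v => ?_⟩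
  have h1 : (1 : Rˣ)⁻¹ * 1 = 1 := by simp
  have ht : IsOpen (S.chartAtPoint 1).target := (S.chartAtPoint 1).open_target
  have hx : S.chartAtPoint 1 1 = 0 := by
    rw [S.chartAtPoint_apply, Subgroup.coe_one, h1, S.chart_one, map_zero, Prod.fst_zero]
  have h0 : (0 : E) ∈ (S.chartAtPoint 1).target := by
    rw [← hx]
    exact (S.chartAtPoint 1).map_source (mem_chart_source E (1 : G))
  have hF : HasFDerivAt (fun y : E => (((S.chartAtPoint 1).symm y : Rˣ) : R))
      ((S.split : (E × F) →L[ℝ] R).comp (ContinuousLinearMap.inl ℝ E F)) 0 := by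
    have h2 : HasFDerivAt (fun y : E => S.split (y, 0))
        ((S.split : (E × F) →L[ℝ] R).comp (ContinuousLinearMap.inl ℝ E F)) 0 :=
      ((S.split : (E × F) →L[ℝ] R).comp (ContinuousLinearMap.inl ℝ E F)).hasFDerivAt
    have h3 := S.hasFDerivAt
    have h4 : S.split ((0 : E), (0 : F)) = 0 := map_zero S.split
    rw [← h4] at h3
    have h5 := h3.comp (0 : E) h2
    rw [ContinuousLinearMap.id_comp] at h5
    refine h5.congr_of_eventuallyEq ((ht.eventually_mem h0).mono fun y hy => ?_)
    change (((S.chartAtPoint 1).symm y : Rˣ) : R) = (S.chart.symm (S.split (y, 0)) : Rˣ)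
    rw [S.coe_chartAtPoint_symm 1 hy, Subgroup.coe_one, one_mul]
  have hm : HasMFDerivAt 𝓘(ℝ, E) 𝓘(ℝ, R) (fun g : G => ((g : Rˣ) : R)) 1
      ((S.split : (E × F) →L[ℝ] R).comp (ContinuousLinearMap.inl ℝ E F)) := by
    refine ⟨(Units.continuous_val.comp continuous_subtype_val).continuousAt, ?_⟩
    have h6 : extChartAt 𝓘(ℝ, E) (1 : G) 1 = 0 := hx
    rw [h6]
    exact hF.hasFDerivWithinAt
  have h7 : modelDeriv E (fun g : G => ((g : Rˣ) : R)) 1 =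
      (S.split : (E × F) →L[ℝ] R).comp (ContinuousLinearMap.inl ℝ E F) := hm.mfderiv
  rw [h7]
  rfl

end SliceChart
end

/-! ### The Cayley transform as a chart of the group of units -/

section
variable {R : Type*} [NormedRing R] [NormedAlgebra ℝ R]

/-- The Cayley transform, normalized to have derivative the identity at `1`. -/
def cayley (g : R) : R := (2 : ℝ) • ((g - 1) * Ring.inverse (g + 1))

/-- The inverse of the Cayley transform. -/
def cayleyInv (A : R) : R := (1 + (1 / 2 : ℝ) • A) * Ring.inverse (1 - (1 / 2 : ℝ) • A)

theorem half_cayley (g : R) : (1 / 2 : ℝ) • cayley g = (g - 1) * Ring.inverse (g + 1) := by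
  rw [cayley, smul_smul]; norm_num

theorem isUnit_two_smul {u : R} (hu : IsUnit u) : IsUnit ((2 : ℝ) • u) := by
  have : (2 : ℝ) • u = algebraMap ℝ R 2 * u := by rw [Algebra.smul_def]
  rw [this]
  exact ((IsUnit.mk0 (2 : ℝ) two_ne_zero).map (algebraMap ℝ R)).mul hu

theorem one_sub_cayley {g : R} (hg : IsUnit (g + 1)) :
    1 - (1 / 2 : ℝ) • cayley g = (2 : ℝ) • Ring.inverse (g + 1) := by
  rw [half_cayley]
  calc _ = (g + 1) * Ring.inverse (g + 1) - (g - 1) * Ring.inverse (g + 1) := by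
        rw [Ring.mul_inverse_cancel _ hg]
    _ = _ := by rw [← sub_mul, two_smul]; noncomm_ring

/-- With `A` half the Cayley transform, this is `1 + A = g(1 - A)`, the form used to invert the
transform and to compare Lorentz with skew. -/
theorem one_add_cayley {g : R} (hg : IsUnit (g + 1)) :
    1 + (1 / 2 : ℝ) • cayley g = g * (1 - (1 / 2 : ℝ) • cayley g) := by
  rw [one_sub_cayley hg, half_cayley]
  calc _ = (g + 1) * Ring.inverse (g + 1) + (g - 1) * Ring.inverse (g + 1) := by
        rw [Ring.mul_inverse_cancel _ hg]
    _ = _ := by rw [← add_mul, two_smul]; noncomm_ring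

theorem cayleyInv_cayley {g : R} (hg : IsUnit (g + 1)) : cayleyInv (cayley g) = g := by
  have h : IsUnit (1 - (1 / 2 : ℝ) • cayley g) := by
    rw [one_sub_cayley hg]; exact isUnit_two_smul (isUnit_ringInverse.2 hg)
  rw [cayleyInv, one_add_cayley hg, mul_assoc, Ring.mul_inverse_cancel _ h, mul_one]

theorem cayleyInv_add_one {A : R} (hA : IsUnit (1 - (1 / 2 : ℝ) • A)) :
    cayleyInv A + 1 = (2 : ℝ) • Ring.inverse (1 - (1 / 2 : ℝ) • A) := by
  calc _ = (1 + (1 / 2 : ℝ) • A) * Ring.inverse (1 - (1 / 2 : ℝ) • A)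
        + (1 - (1 / 2 : ℝ) • A) * Ring.inverse (1 - (1 / 2 : ℝ) • A) := by
          rw [Ring.mul_inverse_cancel _ hA, cayleyInv]
    _ = _ := by rw [← add_mul, two_smul]; noncomm_ring

theorem isUnit_cayleyInv_add_one {A : R} (hA : IsUnit (1 - (1 / 2 : ℝ) • A)) :
    IsUnit (cayleyInv A + 1) := by
  rw [cayleyInv_add_one hA]; exact isUnit_two_smul (isUnit_ringInverse.2 hA)

theorem cayley_cayleyInv {A : R} (hA : IsUnit (1 - (1 / 2 : ℝ) • A)) :
    cayley (cayleyInv A) = A := by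
  have h : cayleyInv A - 1 = ((1 / 2 : ℝ) • A) * (cayleyInv A + 1) := by
    calc _ = (1 + (1 / 2 : ℝ) • A) * Ring.inverse (1 - (1 / 2 : ℝ) • A)
          - (1 - (1 / 2 : ℝ) • A) * Ring.inverse (1 - (1 / 2 : ℝ) • A) := by
            rw [Ring.mul_inverse_cancel _ hA, cayleyInv]
      _ = _ := by rw [← sub_mul, cayleyInv_add_one hA, two_smul]; noncomm_ring
  rw [cayley, h, mul_assoc, Ring.mul_inverse_cancel _ (isUnit_cayleyInv_add_one hA), mul_one,
    smul_smul]
  norm_num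

variable [CompleteSpace R]

theorem contDiffAt_cayley {g : R} (hg : IsUnit (g + 1)) : ContDiffAt ℝ ∞ cayley g := by
  obtain ⟨u, hu⟩ := hg
  have h := contDiffAt_ringInverse ℝ (n := ∞) u
  rw [hu] at h
  have h2 : ContDiffAt ℝ ∞ (fun g : R => Ring.inverse (g + 1)) g :=
    h.comp g (contDiffAt_id.add contDiffAt_const)
  exact ((contDiffAt_id.sub contDiffAt_const).mul h2).const_smul (2 : ℝ)

theorem contDiffAt_cayleyInv {A : R} (hA : IsUnit (1 - (1 / 2 : ℝ) • A)) :
    ContDiffAt ℝ ∞ cayleyInv A := by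
  obtain ⟨u, hu⟩ := hA
  have h := contDiffAt_ringInverse ℝ (n := ∞) u
  rw [hu] at h
  have h1 : ContDiffAt ℝ ∞ (fun A : R => (1 / 2 : ℝ) • A) A := contDiffAt_id.const_smul _
  have h2 : ContDiffAt ℝ ∞ (fun A : R => Ring.inverse (1 - (1 / 2 : ℝ) • A)) A :=
    ContDiffAt.comp (g := Ring.inverse) A h (contDiffAt_const.sub h1)
  exact (contDiffAt_const.add h1).mul h2

theorem hasFDerivAt_cayleyInv :
    HasFDerivAt (cayleyInv : R → R) (ContinuousLinearMap.id ℝ R) 0 := by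
  have h := hasFDerivAt_ringInverse (𝕜 := ℝ) (1 : Rˣ)
  have e : (1 : R) - (1 / 2 : ℝ) • (0 : R) = ((1 : Rˣ) : R) := by simp
  rw [← e] at h
  have h1 : HasFDerivAt (fun A : R => (1 / 2 : ℝ) • A) ((1 / 2 : ℝ) • ContinuousLinearMap.id ℝ R) 0 :=
    (hasFDerivAt_id (0 : R)).const_smul (1 / 2 : ℝ)
  have h2 := h.comp (0 : R) ((hasFDerivAt_const (1 : R) 0).sub h1)
  have h3 := ((hasFDerivAt_const (1 : R) 0).add h1).mul' h2
  refine h3.congr_fderiv ?_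
  ext A
  simp
  rw [← add_smul]
  norm_num

open Classical in
/-- The inverse Cayley transform with values in the group of units. -/
def cayleyUnit (A : R) : Rˣ := if h : IsUnit (cayleyInv A) then h.unit else 1

theorem coe_cayleyUnit {A : R} (h : IsUnit (cayleyInv A)) : (cayleyUnit A : R) = cayleyInv A := by
  rw [cayleyUnit, dif_pos h]
  rfl

/-- The Cayley transform as a chart of the group of units. -/
def cayleyChart : OpenPartialHomeomorph Rˣ R where
  toFun g := cayley (g : R)
  invFun := cayleyUnit
  source := {g | IsUnit ((g : R) + 1)}
  target := {A | IsUnit (1 - (1 / 2 : ℝ) • A) ∧ IsUnit (cayleyInv A)}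
  map_source' g hg := by
    refine ⟨?_, ?_⟩
    · rw [one_sub_cayley hg]; exact isUnit_two_smul (isUnit_ringInverse.2 hg)
    · rw [cayleyInv_cayley hg]; exact g.isUnit
  map_target' A hA := by
    change IsUnit ((cayleyUnit A : R) + 1)
    rw [coe_cayleyUnit hA.2]
    exact isUnit_cayleyInv_add_one hA.1
  left_inv' g hg := by
    have h : IsUnit (cayleyInv (cayley (g : R))) := by rw [cayleyInv_cayley hg]; exact g.isUnit
    exact Units.ext ((coe_cayleyUnit h).trans (cayleyInv_cayley hg))
  right_inv' A hA := by
    rw [coe_cayleyUnit hA.2]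
    exact cayley_cayleyInv hA.1
  open_source := Units.isOpen.preimage (Units.continuous_val.add continuous_const)
  open_target := by
    have h1 : IsOpen {A : R | IsUnit (1 - (1 / 2 : ℝ) • A)} :=
      Units.isOpen.preimage (by fun_prop)
    have h2 : ContinuousOn (cayleyInv : R → R) {A : R | IsUnit (1 - (1 / 2 : ℝ) • A)} :=
      fun A hA => (contDiffAt_cayleyInv hA).continuousAt.continuousWithinAt
    exact h2.isOpen_inter_preimage h1 Units.isOpen
  continuousOn_toFun := fun g hg =>
    ((contDiffAt_cayley hg).continuousAt.comp
      Units.continuous_val.continuousAt).continuousWithinAt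
  continuousOn_invFun := by
    rw [Units.isOpenEmbedding_val.isEmbedding.continuousOn_iff]
    refine ContinuousOn.congr (f := cayleyInv) (fun A hA =>
      (contDiffAt_cayleyInv hA.1).continuousAt.continuousWithinAt) fun A hA =>
      coe_cayleyUnit hA.2

theorem coe_cayleyChart_symm {A : R} (hA : A ∈ (cayleyChart (R := R)).target) :
    ((cayleyChart.symm A : Rˣ) : R) = cayleyInv A := by
  exact coe_cayleyUnit hA.2

theorem contMDiffOn_cayleyChart : ContMDiffOn 𝓘(ℝ, R) 𝓘(ℝ, R) ∞
    (cayleyChart (R := R)) (cayleyChart (R := R)).source := fun g hg =>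
  ((contDiffAt_cayley hg).contMDiffAt.comp g (Units.contMDiff_val g)).contMDiffWithinAt

theorem contMDiffOn_cayleyChart_symm : ContMDiffOn 𝓘(ℝ, R) 𝓘(ℝ, R) ∞
    (cayleyChart (R := R)).symm (cayleyChart (R := R)).target := by
  have h1 := contMDiffOn_isOpenEmbedding_symm (I := 𝓘(ℝ, R)) (n := ∞)
    (Units.isOpenEmbedding_val (R := R))
  have h2 : ContMDiffOn 𝓘(ℝ, R) 𝓘(ℝ, R) ∞ (cayleyInv : R → R) (cayleyChart (R := R)).target :=
    fun A hA => (contDiffAt_cayleyInv hA.1).contMDiffAt.contMDiffWithinAt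
  have h3 := h1.comp h2 fun A hA => ⟨_, coe_cayleyUnit hA.2⟩
  refine h3.congr fun A hA => ?_
  rw [Function.comp_apply, ← coe_cayleyChart_symm hA]
  exact ((Units.isOpenEmbedding_val (R := R)).toOpenPartialHomeomorph_left_inv).symm

end

/-! ### Skew endomorphisms and the slice chart of `SL(2,𝕆)` -/

/-- The continuous endomorphisms of `ℝ¹⁰` that are skew for the Lorentz form. -/
def lorSkew : Submodule ℝ ((Fin 10 → ℝ) →L[ℝ] (Fin 10 → ℝ)) where
  carrier := {A | ∀ v w, lor (A v) w + lor v (A w) = 0}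
  add_mem' := fun {A B} hA hB v w => by
    have := congrArg₂ (· + ·) (hA v w) (hB v w)
    simp only [add_apply, lor_add_left, lor_add_right] at this ⊢
    linarith
  zero_mem' := fun v w => by simp [lor_apply]
  smul_mem' := fun r A hA v w => by
    have := congrArg (r * ·) (hA v w)
    simp only [smul_apply, lor_smul_left, lor_smul_right] at this ⊢
    linarith

/-- The endomorphism of `ℝ¹⁰` with a given matrix. -/
def endOfMatrix : Matrix (Fin 10) (Fin 10) ℝ ≃ₗ[ℝ] ((Fin 10 → ℝ) →L[ℝ] (Fin 10 → ℝ)) :=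
  Matrix.toLin'.trans LinearMap.toContinuousLinearMap

theorem endOfMatrix_apply (A : Matrix (Fin 10) (Fin 10) ℝ) (v : Fin 10 → ℝ) :
    endOfMatrix A v = A *ᵥ v := rfl

theorem endOfMatrix_mem {A : Matrix (Fin 10) (Fin 10) ℝ} :
    endOfMatrix A ∈ lorSkew ↔ A ∈ so91 := by
  have e : ∀ v w, lor (A *ᵥ v) w = -(v ⬝ᵥ (-(eta * A)ᵀ *ᵥ w)) := fun v w => by
    rw [lor_comm, lor, Matrix.mulVec_mulVec, Matrix.neg_mulVec, dotProduct_neg, neg_neg,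
      Matrix.mulVec_transpose, dotProduct_comm v, ← Matrix.dotProduct_mulVec]
  have e' : ∀ v w, lor v (A *ᵥ w) = v ⬝ᵥ ((eta * A) *ᵥ w) := fun v w => by
    rw [lor, Matrix.mulVec_mulVec]
  constructor
  · intro h
    refine eq_of_lor fun v w => ?_
    have := h v w
    rw [endOfMatrix_apply, endOfMatrix_apply, e, e'] at this
    linarith
  · intro h v w
    have h' : eta * A = -(eta * A)ᵀ := h
    rw [endOfMatrix_apply, endOfMatrix_apply, e, e', ← h']
    ring

theorem map_so91 : so91.map (endOfMatrix : Matrix (Fin 10) (Fin 10) ℝ →ₗ[ℝ] _) = lorSkew := by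
  ext A
  constructor
  · rintro ⟨M, hM, rfl⟩
    exact endOfMatrix_mem.2 hM
  · intro hA
    refine ⟨endOfMatrix.symm A, ?_, endOfMatrix.apply_symm_apply A⟩
    exact endOfMatrix_mem.1 (by rwa [LinearEquiv.apply_symm_apply])

/-- The skew-symmetric matrix with given entries above the diagonal. -/
def skewOf (f : {p : Fin 10 × Fin 10 // p.1 < p.2} → ℝ) : Matrix (Fin 10) (Fin 10) ℝ :=
  Matrix.of fun i j => if h : i < j then f ⟨(i, j), h⟩ else
    if h : j < i then -f ⟨(j, i), h⟩ else 0

/-- `𝔰𝔬(9,1)` is parametrized by the entries of `ηA` above the diagonal. -/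
def so91Equiv : so91 ≃ₗ[ℝ] ({p : Fin 10 × Fin 10 // p.1 < p.2} → ℝ) where
  toFun A p := (eta * (A : Matrix (Fin 10) (Fin 10) ℝ)) p.1.1 p.1.2
  map_add' A B := by
    ext p
    simp [Matrix.mul_add]
  map_smul' r A := by
    ext p
    simp
  invFun f := ⟨eta * skewOf f, by
    change eta * (eta * skewOf f) = -(eta * (eta * skewOf f))ᵀ
    rw [← mul_assoc, eta_mul_eta, one_mul]
    ext i j
    simp only [skewOf, Matrix.neg_apply, Matrix.transpose_apply, Matrix.of_apply]
    rcases lt_trichotomy i j with h | h | h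
    · simp [h, h.not_gt]
    · simp [h]
    · simp [h, h.not_gt]⟩
  left_inv A := by
    apply Subtype.ext
    have h : eta * (A : Matrix (Fin 10) (Fin 10) ℝ) =
      -(eta * (A : Matrix (Fin 10) (Fin 10) ℝ))ᵀ := A.2
    have hij : ∀ i j, (eta * (A : Matrix (Fin 10) (Fin 10) ℝ)) i j =
        -(eta * (A : Matrix (Fin 10) (Fin 10) ℝ)) j i := fun i j => congrFun (congrFun h i) j
    have : skewOf (fun p => (eta * (A : Matrix (Fin 10) (Fin 10) ℝ)) p.1.1 p.1.2) =
        eta * (A : Matrix (Fin 10) (Fin 10) ℝ) := by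
      ext i j
      simp only [skewOf, Matrix.of_apply]
      rcases lt_trichotomy i j with h | h | h
      · simp [h]
      · have := hij i j
        rw [h] at this
        simp only [h, lt_irrefl, dite_false]
        linarith
      · rw [dif_neg h.not_gt, dif_pos h, ← hij]
    change eta * skewOf _ = _
    rw [this, ← mul_assoc, eta_mul_eta, one_mul]
  right_inv f := by
    ext p
    change (eta * (eta * skewOf f)) p.1.1 p.1.2 = f p
    rw [← mul_assoc, eta_mul_eta, one_mul]
    simp [skewOf, p.2]

theorem finrank_lorSkew : Module.finrank ℝ lorSkew = 45 := by
  rw [← map_so91, LinearEquiv.finrank_map_eq, so91Equiv.finrank_eq, Module.finrank_pi]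
  -- Counting the pairs `i < j` of ten indices.
  rfl

/-- With `g(1 - A) = 1 + A`, the defect `⟨g·, g·⟩ - ⟨·, ·⟩` on the image of `1 - A` is `2(⟨Av, w⟩ +
⟨v, Aw⟩)`, and `1 - A` is surjective. -/
theorem cayley_mem_lorSkew {g : GL10} (hg : IsUnit (g.val + 1)) :
    cayley g.val ∈ lorSkew ↔ g ∈ lorentzGroup := by
  set A := (1 / 2 : ℝ) • cayley g.val with hA
  have h1 : 1 + A = g.val * (1 - A) := one_add_cayley hg
  have h2 : 1 - A = (2 : ℝ) • Ring.inverse (g.val + 1) := one_sub_cayley hg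
  have h1' : ∀ v, g.val ((1 - A) v) = v + A v := fun v =>
    (congrArg (fun f : (Fin 10 → ℝ) →L[ℝ] (Fin 10 → ℝ) => f v) h1).symm
  have hs : Function.Surjective ⇑(1 - A) := by
    have hu : IsUnit (1 - A) := by rw [h2]; exact isUnit_two_smul (isUnit_ringInverse.2 hg)
    obtain ⟨u, hu⟩ := hu
    rw [← hu]
    exact fun v => ⟨(u⁻¹).val v, GL10.apply_inv_apply u v⟩
  have hm : cayley g.val ∈ lorSkew ↔ A ∈ lorSkew := by
    refine ⟨fun h => lorSkew.smul_mem _ h, fun h => ?_⟩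
    have := lorSkew.smul_mem (2 : ℝ) h
    rwa [hA, smul_smul, show (2 : ℝ) * (1 / 2) = 1 by norm_num, one_smul] at this
  have e : ∀ v w, lor (g.val ((1 - A) v)) (g.val ((1 - A) w)) =
      lor ((1 - A) v) ((1 - A) w) + 2 * (lor (A v) w + lor v (A w)) := fun v w => by
    have h3 : ∀ v, (1 - A) v = v + (-1 : ℝ) • A v := fun v => by
      rw [neg_one_smul, ← sub_eq_add_neg]; rfl
    rw [h1', h1', h3, h3]
    simp only [lor_add_left, lor_add_right, lor_smul_left, lor_smul_right]
    ring
  rw [hm]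
  constructor
  · intro h v w
    obtain ⟨v, rfl⟩ := hs v
    obtain ⟨w, rfl⟩ := hs w
    rw [e, h v w, mul_zero, add_zero]
  · intro h v w
    have := e v w
    rw [h] at this
    linarith

/-- The comparison of determinants with the identity as second Lorentz map. -/
theorem det_eq_one_of_isUnit {g : GL10} (hg : g ∈ lorentzGroup) (hu : IsUnit (g.val + 1)) :
    GL10.det g = 1 := by
  set A := endOfMatrix.symm g.val with hA
  have hgA : g.val = endOfMatrix A := (endOfMatrix.apply_symm_apply _).symm
  have h1 : Aᵀ * eta * A = eta := by
    refine lorentz_iff.1 fun v w => ?_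
    have := hg v w
    rwa [hgA] at this
  have h2 : (A + 1).det ≠ 0 := by
    intro h0
    obtain ⟨v, hv, hv0⟩ := Matrix.exists_mulVec_eq_zero_iff.2 h0
    obtain ⟨u, hu⟩ := hu
    apply hv
    have h3 : u.val v = 0 := by
      rw [hu, hgA, ← hv0, Matrix.add_mulVec, Matrix.one_mulVec]
      rfl
    rw [← GL10.inv_apply_apply u v, h3, map_zero]
  have h3 := lorentz_det_eq h1 (by simp) h2
  rw [Matrix.det_one] at h3
  have h4 : GL10.det g = A.det := by
    change LinearMap.det (g.val : (Fin 10 → ℝ) →ₗ[ℝ] (Fin 10 → ℝ)) = _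
    rw [hgA]
    exact LinearMap.det_toLin' A
  rw [h4, h3]

/-- The elements of `GL(10,ℝ)` that send the time axis forward. -/
def forward : Set GL10 := {g | 0 < g.val (Pi.single 0 1) 0}

theorem isOpen_forward : IsOpen forward := by
  have : Continuous fun g : GL10 => g.val (Pi.single 0 1) 0 :=
    (continuous_apply 0).comp
      ((ContinuousLinearMap.apply ℝ (Fin 10 → ℝ) (Pi.single 0 1)).continuous.comp
        Units.continuous_val)
  exact isOpen_lt continuous_const this

theorem mem_SL2O_iff {g : GL10} (hu : IsUnit (g.val + 1)) (hf : g ∈ forward) :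
    g ∈ SL2O ↔ cayley g.val ∈ lorSkew := by
  rw [cayley_mem_lorSkew hu, SL2O_eq_restrictedLorentz]
  exact ⟨fun h => h.1, fun h => mem_restrictedLorentz h (det_eq_one_of_isUnit h hu) hf⟩

/-- The chart is the Cayley transform on the open set of forward elements, where only skewness
remains as a condition; any linear complement `F` of the skew endomorphisms serves. -/
theorem exists_sliceChart : ∃ (F : Submodule ℝ ((Fin 10 → ℝ) →L[ℝ] (Fin 10 → ℝ)))
    (S : SliceChart SL2O E45 F) (ε : E45 ≃ₗ[ℝ] lorSkew), ∀ y, S.split (y, 0) = ε y := by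
  obtain ⟨F, hF⟩ := lorSkew.exists_isCompl
  have _ : Module.Free ℝ lorSkew := Module.Free.of_divisionRing ℝ lorSkew
  let ε : E45 ≃ₗ[ℝ] lorSkew := LinearEquiv.ofFinrankEq _ _ (by
    rw [finrank_lorSkew, finrank_euclideanSpace, Fintype.card_fin])
  let L : (E45 × F) ≃ₗ[ℝ] ((Fin 10 → ℝ) →L[ℝ] (Fin 10 → ℝ)) :=
    (ε.prodCongr (LinearEquiv.refl ℝ F)).trans (Submodule.prodEquivOfIsCompl lorSkew F hF)
  let Lc : (E45 × F) ≃L[ℝ] ((Fin 10 → ℝ) →L[ℝ] (Fin 10 → ℝ)) :=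
    have h : Continuous ⇑(L.symm.toLinearMap) :=
      LinearMap.continuous_of_finiteDimensional (𝕜 := ℝ) (E := (Fin 10 → ℝ) →L[ℝ] (Fin 10 → ℝ))
        (F' := E45 × F) L.symm.toLinearMap
    have h' : Continuous ⇑(L.toLinearMap) :=
      LinearMap.continuous_of_finiteDimensional (𝕜 := ℝ) (E := E45 × F)
        (F' := (Fin 10 → ℝ) →L[ℝ] (Fin 10 → ℝ)) L.toLinearMap
    { L with
      continuous_toFun := h'
      continuous_invFun := h }
  refine ⟨F,
    { chart := cayleyChart.restrOpen forward isOpen_forward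
      split := Lc
      one_mem := ⟨?_, ?_⟩
      chart_one := ?_
      contMDiffOn := contMDiffOn_cayleyChart.mono fun g hg => hg.1
      contMDiffOn_symm := contMDiffOn_cayleyChart_symm.mono fun g hg => hg.1
      mem_iff := fun g hg => ?_
      hasFDerivAt := ?_ }, ε, fun y => ?_⟩
  · change IsUnit ((1 : (Fin 10 → ℝ) →L[ℝ] (Fin 10 → ℝ)) + 1)
    rw [← two_smul ℝ]
    exact isUnit_two_smul isUnit_one
  · change (0 : ℝ) < (Pi.single 0 1 : Fin 10 → ℝ) 0
    simp
  · change cayley (1 : (Fin 10 → ℝ) →L[ℝ] (Fin 10 → ℝ)) = 0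
    simp [cayley]
  · rw [mem_SL2O_iff hg.1 hg.2]
    change _ ↔ ((Submodule.prodEquivOfIsCompl lorSkew F hF).symm (cayley g.val)).2 = 0
    rw [Submodule.prodEquivOfIsCompl_symm_apply_snd_eq_zero]
  · refine hasFDerivAt_cayleyInv.congr_of_eventuallyEq ?_
    have h0 : (0 : (Fin 10 → ℝ) →L[ℝ] (Fin 10 → ℝ)) ∈
        (cayleyChart (R := (Fin 10 → ℝ) →L[ℝ] (Fin 10 → ℝ))).target := by
      constructor
      · simp
      · simp [cayleyInv]
    exact (cayleyChart.open_target.eventually_mem h0).mono fun A hA => coe_cayleyChart_symm hA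
  · change (ε y : (Fin 10 → ℝ) →L[ℝ] (Fin 10 → ℝ)) + ((0 : F) : _) = _
    simp

/-! ### Derivations among the skew maps of the imaginary octonions -/

namespace Octonion

/-- The imaginary units `e₁, …, e₇`. -/
def im : Fin 7 → Octonion :=
  ![⟨0, 1, 0, 0, 0, 0, 0, 0⟩, ⟨0, 0, 1, 0, 0, 0, 0, 0⟩, ⟨0, 0, 0, 1, 0, 0, 0, 0⟩,
    ⟨0, 0, 0, 0, 1, 0, 0, 0⟩, ⟨0, 0, 0, 0, 0, 1, 0, 0⟩, ⟨0, 0, 0, 0, 0, 0, 1, 0⟩,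
    ⟨0, 0, 0, 0, 0, 0, 0, 1⟩]

theorem eq_sum_im (x : Octonion) : x = x.x0 • (1 : Octonion) + (x.x1 • im 0 + x.x2 • im 1 +
    x.x3 • im 2 + x.x4 • im 3 + x.x5 • im 4 + x.x6 • im 5 + x.x7 • im 6) := by
  ext <;> simp [im]

/-- The skew-symmetric endomorphism of the imaginary octonions whose matrix has the entries
`s i j` above the diagonal, extended by zero to the real octonions. -/
def skewEnd (s : Fin 7 → Fin 7 → ℝ) : Module.End ℝ Octonion where
  toFun x := ⟨0,
    s 0 1 * x.x2 + s 0 2 * x.x3 + s 0 3 * x.x4 + s 0 4 * x.x5 + s 0 5 * x.x6 + s 0 6 * x.x7,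
    -s 0 1 * x.x1 + s 1 2 * x.x3 + s 1 3 * x.x4 + s 1 4 * x.x5 + s 1 5 * x.x6 + s 1 6 * x.x7,
    -s 0 2 * x.x1 - s 1 2 * x.x2 + s 2 3 * x.x4 + s 2 4 * x.x5 + s 2 5 * x.x6 + s 2 6 * x.x7,
    -s 0 3 * x.x1 - s 1 3 * x.x2 - s 2 3 * x.x3 + s 3 4 * x.x5 + s 3 5 * x.x6 + s 3 6 * x.x7,
    -s 0 4 * x.x1 - s 1 4 * x.x2 - s 2 4 * x.x3 - s 3 4 * x.x4 + s 4 5 * x.x6 + s 4 6 * x.x7,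
    -s 0 5 * x.x1 - s 1 5 * x.x2 - s 2 5 * x.x3 - s 3 5 * x.x4 - s 4 5 * x.x5 + s 5 6 * x.x7,
    -s 0 6 * x.x1 - s 1 6 * x.x2 - s 2 6 * x.x3 - s 3 6 * x.x4 - s 4 6 * x.x5 - s 5 6 * x.x6⟩
  map_add' x y := by ext <;> simp <;> ring
  map_smul' r x := by ext <;> simp <;> ring

/-- The linear relations that cut out the derivations among the skew-symmetric maps. -/
structure DerRel (s : Fin 7 → Fin 7 → ℝ) : Prop where
  r1 : s 1 6 + s 2 4 - s 3 5 = 0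
  r2 : s 0 6 + s 2 5 + s 3 4 = 0
  r3 : -s 0 4 + s 1 5 + s 3 6 = 0
  r4 : s 0 5 + s 1 4 - s 2 6 = 0
  r5 : s 0 2 - s 1 3 + s 5 6 = 0
  r6 : s 0 3 + s 1 2 + s 4 6 = 0
  r7 : s 0 1 + s 2 3 + s 4 5 = 0

theorem DerRel.eqs {s : Fin 7 → Fin 7 → ℝ} (h : DerRel s) :
    s 1 6 = s 3 5 - s 2 4 ∧ s 0 6 = -s 2 5 - s 3 4 ∧ s 0 4 = s 1 5 + s 3 6 ∧
    s 0 5 = s 2 6 - s 1 4 ∧ s 0 2 = s 1 3 - s 5 6 ∧ s 0 3 = -s 1 2 - s 4 6 ∧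
    s 0 1 = -s 2 3 - s 4 5 := by
  obtain ⟨h1, h2, h3, h4, h5, h6, h7⟩ := h
  refine ⟨?_, ?_, ?_, ?_, ?_, ?_, ?_⟩ <;> linarith

theorem skewEnd_mem_derO {s : Fin 7 → Fin 7 → ℝ} (h : DerRel s) : skewEnd s ∈ derO := by
  obtain ⟨h1, h2, h3, h4, h5, h6, h7⟩ := h.eqs
  intro x y
  ext <;> simp only [skewEnd, LinearMap.coe_mk, AddHom.coe_mk, mul_x0, mul_x1, mul_x2, mul_x3,
    mul_x4, mul_x5, mul_x6, mul_x7, add_x0, add_x1, add_x2, add_x3, add_x4, add_x5, add_x6,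
    add_x7, h1, h2, h3, h4, h5, h6, h7] <;> ring

/-- The matrix entries of an endomorphism of the octonions. -/
def entries (S : Module.End ℝ Octonion) (i j : Fin 7) : ℝ := ip (S (im j)) (im i)

theorem eq_skewEnd {S : Module.End ℝ Octonion} (h1 : S 1 = 0) (h : ∀ x y, ip (S x) y = -ip x (S y)) :
    S = skewEnd (entries S) := by
  have hs : ∀ i j, ip (S (im j)) (im i) = -ip (S (im i)) (im j) := fun i j => by
    rw [h, ip_comm]
  have h0 : ∀ x, (S x).x0 = 0 := fun x => by
    have := h x 1
    rw [h1, ← re_eq_ip, ip_zero_right, neg_zero] at this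
    exact this
  have hd : ∀ i, ip (S (im i)) (im i) = 0 := fun i => by linarith [hs i i]
  have hl : ∀ x y, ip (S x) y = x.x1 * ip (S (im 0)) y + x.x2 * ip (S (im 1)) y +
      x.x3 * ip (S (im 2)) y + x.x4 * ip (S (im 3)) y + x.x5 * ip (S (im 4)) y +
      x.x6 * ip (S (im 5)) y + x.x7 * ip (S (im 6)) y := fun x y => by
    conv_lhs => rw [eq_sum_im x]
    simp only [map_add, map_smul, h1, smul_zero, zero_add, ip_add_left, ip_smul_left]
  have hc : ∀ x : Octonion, x.x1 = ip x (im 0) ∧ x.x2 = ip x (im 1) ∧ x.x3 = ip x (im 2) ∧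
      x.x4 = ip x (im 3) ∧ x.x5 = ip x (im 4) ∧ x.x6 = ip x (im 5) ∧ x.x7 = ip x (im 6) :=
    fun x => by simp [ip, im]
  refine LinearMap.ext fun x => ?_
  obtain ⟨c1, c2, c3, c4, c5, c6, c7⟩ := hc (S x)
  ext
  · exact h0 x
  · rw [c1, hl, hd 0]; simp only [skewEnd, entries, LinearMap.coe_mk, AddHom.coe_mk]; ring
  · rw [c2, hl, hd 1, hs 1 0]; simp only [skewEnd, entries, LinearMap.coe_mk, AddHom.coe_mk]; ring
  · rw [c3, hl, hd 2, hs 2 0, hs 2 1]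
    simp only [skewEnd, entries, LinearMap.coe_mk, AddHom.coe_mk]; ring
  · rw [c4, hl, hd 3, hs 3 0, hs 3 1, hs 3 2]
    simp only [skewEnd, entries, LinearMap.coe_mk, AddHom.coe_mk]; ring
  · rw [c5, hl, hd 4, hs 4 0, hs 4 1, hs 4 2, hs 4 3]
    simp only [skewEnd, entries, LinearMap.coe_mk, AddHom.coe_mk]; ring
  · rw [c6, hl, hd 5, hs 5 0, hs 5 1, hs 5 2, hs 5 3, hs 5 4]
    simp only [skewEnd, entries, LinearMap.coe_mk, AddHom.coe_mk]; ring
  · rw [c7, hl, hd 6, hs 6 0, hs 6 1, hs 6 2, hs 6 3, hs 6 4, hs 6 5]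
    simp only [skewEnd, entries, LinearMap.coe_mk, AddHom.coe_mk]; ring

theorem skew_of_ip_self {S : Module.End ℝ Octonion} (h : ∀ x, ip (S x) x = 0) (x y : Octonion) :
    ip (S x) y = -ip x (S y) := by
  have := h (x + y)
  rw [map_add, ip_add_left, ip_add_right, ip_add_right, h, h, ip_comm (S y)] at this
  linarith

/-- A derivation kills the real number `x x̄`; the real part of the Leibniz rule there is `2⟨Dx,
x⟩`. -/
theorem derO_ip_self {D : Module.End ℝ Octonion} (hD : D ∈ derO) (x : Octonion) :
    ip (D x) x = 0 := by
  have h1 : D 1 = 0 := sl2O.derO_one ⟨D, hD⟩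
  have h2 := hD x (star x)
  have h3 : D (star x) = star (D x) := sl2O.star_derO ⟨D, hD⟩ x
  rw [mul_star_self, map_smul, h1, smul_zero, h3] at h2
  have h4 := congrArg re h2
  rw [ip_comm, ← re_mul_star]
  have h5 : re (D x * star x) = re (x * star (D x)) := by rw [re_mul_star, re_mul_star, ip_comm]
  simp only [re, add_x0, zero_x0] at h4 h5 ⊢
  linarith

theorem derO_eq_skewEnd {D : Module.End ℝ Octonion} (hD : D ∈ derO) :
    D = skewEnd (entries D) :=
  eq_skewEnd (sl2O.derO_one ⟨D, hD⟩) (skew_of_ip_self (derO_ip_self hD))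

theorem derRel_of_skewEnd_mem {s : Fin 7 → Fin 7 → ℝ} (h : skewEnd s ∈ derO) : DerRel s := by
  have e : ∀ i j, skewEnd s (im i * im j) = skewEnd s (im i) * im j + im i * skewEnd s (im j) :=
    fun i j => h _ _
  -- The Leibniz rule on `e₁e₂`, `e₁e₃`, `e₂e₃` and `e₁e₄` already yields all seven relations.
  have e1 := e 0 1
  have e2 := e 0 2
  have e3 := e 1 2
  have e4 := e 0 3
  rw [Octonion.ext_iff] at e1 e2 e3 e4
  simp [skewEnd, im] at e1 e2 e3 e4
  constructor <;> linarith

end Octonion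

/-! ### The decomposition `𝔰𝔬(7) = C(𝕆') ⊕ Der(𝕆)` -/

namespace Octonion

theorem commMap_apply (d x : Octonion) : commMap d x = d * x - x * d := rfl

theorem commMap_one (d : Octonion) : commMap d 1 = 0 := by
  rw [commMap_apply, mul_one, one_mul, sub_self]

theorem ip_commMap_self (d x : Octonion) : ip (commMap d x) x = 0 := by
  rw [commMap_apply, ip_sub_left, ip_mul_right, ip_mul_left, mul_star_self, star_mul_self,
    ip_smul_right, sub_self]

theorem star_eq_neg {d : Octonion} (hd : re d = 0) : star d = -d := by
  rw [star_eq, hd, mul_zero, zero_smul, zero_sub]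

/-- The entries of `C_d`, summed as in the relations for derivations. -/
theorem entries_commMap (d : Octonion) :
    (entries (commMap d) 1 6 + entries (commMap d) 2 4 - entries (commMap d) 3 5 = -6 * d.x1 ∧
    entries (commMap d) 0 6 + entries (commMap d) 2 5 + entries (commMap d) 3 4 = 6 * d.x2 ∧
    -entries (commMap d) 0 4 + entries (commMap d) 1 5 + entries (commMap d) 3 6 = -6 * d.x3) ∧
    (entries (commMap d) 0 5 + entries (commMap d) 1 4 - entries (commMap d) 2 6 = -6 * d.x4 ∧
    entries (commMap d) 0 2 - entries (commMap d) 1 3 + entries (commMap d) 5 6 = -6 * d.x5 ∧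
    entries (commMap d) 0 3 + entries (commMap d) 1 2 + entries (commMap d) 4 6 = 6 * d.x6 ∧
    entries (commMap d) 0 1 + entries (commMap d) 2 3 + entries (commMap d) 4 5 = -6 * d.x7) := by
  refine ⟨⟨?_, ?_, ?_⟩, ?_, ?_, ?_, ?_⟩ <;>
    simp [entries, commMap_apply, sub_eq_add_neg, im, ip] <;> ring

theorem entries_sub (S T : Module.End ℝ Octonion) (i j : Fin 7) :
    entries (S - T) i j = entries S i j - entries T i j := by
  rw [entries, LinearMap.sub_apply, ip_sub_left]; rfl

/-- `𝔰𝔬(7) = C(𝕆') + Der(𝕆)`. -/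
theorem exists_sub_commMap_mem_derO {S : Module.End ℝ Octonion} (h1 : S 1 = 0)
    (h : ∀ x, ip (S x) x = 0) : ∃ d, re d = 0 ∧ S - commMap d ∈ derO := by
  let s := entries S
  -- The coordinates are solved from `entries_commMap`, so that `C_d` violates the seven relations
  -- exactly as `S` does.
  let d : Octonion := ⟨0, -(s 1 6 + s 2 4 - s 3 5) / 6, (s 0 6 + s 2 5 + s 3 4) / 6,
    -(-s 0 4 + s 1 5 + s 3 6) / 6, -(s 0 5 + s 1 4 - s 2 6) / 6, -(s 0 2 - s 1 3 + s 5 6) / 6,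
    (s 0 3 + s 1 2 + s 4 6) / 6, -(s 0 1 + s 2 3 + s 4 5) / 6⟩
  refine ⟨d, rfl, ?_⟩
  have hsk : S - commMap d = skewEnd (entries (S - commMap d)) := by
    refine eq_skewEnd ?_ (skew_of_ip_self fun x => ?_)
    · rw [LinearMap.sub_apply, h1, commMap_one, sub_zero]
    · rw [LinearMap.sub_apply, ip_sub_left, h, ip_commMap_self, sub_zero]
  rw [hsk]
  obtain ⟨⟨c1, c2, c3⟩, c4, c5, c6, c7⟩ := entries_commMap d
  apply skewEnd_mem_derO
  constructor <;> simp only [entries_sub] <;> simp only [d, s] at * <;> linarith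

/-- For a derivation the seven sums vanish, while for `C_d` they are `±6` times the coordinates of
`d`. -/
theorem eq_zero_of_commMap_mem_derO {d : Octonion} (hd : re d = 0) (h : commMap d ∈ derO) :
    d = 0 := by
  obtain ⟨⟨c1, c2, c3⟩, c4, c5, c6, c7⟩ := entries_commMap d
  have e := derO_eq_skewEnd h
  rw [e] at h
  obtain ⟨h1, h2, h3, h4, h5, h6, h7⟩ := derRel_of_skewEnd_mem h
  ext
  · exact hd
  all_goals simp only [zero_x1, zero_x2, zero_x3, zero_x4, zero_x5, zero_x6, zero_x7]; linarith

end Octonion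

/-! ### The isomorphism of `𝔰𝔩(2,𝕆)` with `𝔰𝔬(9,1)` -/

namespace sl2O

/-- The element of `𝔰𝔩(2,𝕆)` with given components. -/
def mk (p q r : Octonion) (d : Octonion) (hd : re d = 0) (D : derO) : sl2O :=
  (⟨!![p, q; r, -p], by simp [M2prime, Matrix.trace_fin_two]⟩, ⟨commMap d, d, hd, rfl⟩, D)

theorem exists_mk (m : sl2O) : ∃ p q r d, ∃ (hd : re d = 0) (D : derO), m = mk p q r d hd D := by
  obtain ⟨⟨N, hN⟩, ⟨_, d, hd, rfl⟩, D⟩ := m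
  refine ⟨N 0 0, N 0 1, N 1 0, d, hd, D, ?_⟩
  have h1 : N 0 0 + N 1 1 = 0 := by
    have : N.trace = 0 := hN
    rwa [Matrix.trace_fin_two] at this
  have h2 : N = !![N 0 0, N 0 1; N 1 0, -N 0 0] := by
    rw [← eq_neg_of_add_eq_zero_right h1]
    exact Matrix.eta_fin_two N
  exact Prod.ext (Subtype.ext h2) rfl

theorem act_mk (p q r d : Octonion) (hd : re d = 0) (D : derO) (α β : ℝ) (x : Octonion) :
    act (mk p q r d hd D) (hm α x β) =
      hm (2 * re p * α + 2 * ip q x)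
        (α • star r + β • q + (p * x - x * star p + commMap d x + (D : Module.End ℝ Octonion) x))
        (-(2 * re p) * β + 2 * ip (star r) x) := by
  have hD1 := derO_one D
  have hp := add_star_self p
  refine eq_hm ?_ ?_ ?_
  · have e : ((act (mk p q r d hd D) (hm α x β) : h2O) : M2O) 0 0 =
      p * (α • (1 : Octonion)) + q * star x + ((α • (1 : Octonion)) * star p + x * star q) +
        commMap d (α • (1 : Octonion)) + (D : Module.End ℝ Octonion) (α • (1 : Octonion)) := by
      simp [act, actFun, mk, hm, Fin.sum_univ_two, Matrix.vecMul,
        Matrix.vecHead, Matrix.vecTail, dotProduct, Matrix.conjTranspose_apply]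
    rw [e, map_smul, map_smul, hD1, commMap_one]
    simp only [mul_smul_comm, smul_mul_assoc, one_mul, mul_one, smul_zero, add_zero]
    have aux : ∀ u v w z : Octonion, u + v + (w + z) = (u + w) + (v + z) := fun u v w z => by abel
    rw [aux, ← smul_add, hp, mul_star_add, smul_smul, ← add_smul]
    congr 1; ring
  · have e : ((act (mk p q r d hd D) (hm α x β) : h2O) : M2O) 0 1 =
      p * x + q * (β • (1 : Octonion)) + ((α • (1 : Octonion)) * star r + x * star (-p)) +
        commMap d x + (D : Module.End ℝ Octonion) x := by
      simp [act, actFun, mk, hm, Fin.sum_univ_two, Matrix.vecMul,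
        Matrix.vecHead, Matrix.vecTail, dotProduct, Matrix.conjTranspose_apply]
    rw [e, star_neg, mul_neg]
    simp only [mul_smul_comm, smul_mul_assoc, one_mul, mul_one]
    abel
  · have e : ((act (mk p q r d hd D) (hm α x β) : h2O) : M2O) 1 1 =
      r * x + (-p) * (β • (1 : Octonion)) + (star x * star r + (β • (1 : Octonion)) * star (-p)) +
        commMap d (β • (1 : Octonion)) + (D : Module.End ℝ Octonion) (β • (1 : Octonion)) := by
      simp [act, actFun, mk, hm, Fin.sum_univ_two, Matrix.vecMul,
        Matrix.vecHead, Matrix.vecTail, dotProduct, Matrix.conjTranspose_apply]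
    rw [e, map_smul, map_smul, hD1, commMap_one]
    simp only [mul_smul_comm, smul_mul_assoc, one_mul, mul_one, smul_zero, add_zero, star_neg,
      neg_mul, smul_neg]
    have aux : ∀ u v w z : Octonion, u + -v + (w + -z) = (u + w) - (v + z) :=
      fun u v w z => by abel
    have h2 : r * x + star x * star r = (2 * ip (star r) x) • (1 : Octonion) := by
      rw [← star_mul, add_star_self, re_eq_ip, ip_mul_left, mul_one, ip_comm]
    rw [aux, ← smul_add, hp, h2, smul_smul, ← sub_smul]
    congr 1; ring

end sl2O

theorem hm_eq_add (α β : ℝ) (x : Octonion) :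
    hm α x β = α • hm 1 0 0 + hm 0 x 0 + β • hm 0 0 1 := by
  rw [smul_hm, smul_hm, hm_add, hm_add]
  simp

theorem lor_self_add (v w : Fin 10 → ℝ) (A : (Fin 10 → ℝ) →L[ℝ] (Fin 10 → ℝ))
    (h : ∀ v, lor (A v) v = 0) : lor (A v) w + lor v (A w) = 0 := by
  have h1 := h (v + w)
  rw [map_add, lor_add_left, lor_add_right, lor_add_right, h, h] at h1
  rw [lor_comm v]
  linarith

theorem ip_mul_sub_mul_star (p x : Octonion) : ip (p * x - x * star p) x = 0 := by
  rw [ip_sub_left, ip_mul_right, ip_mul_left, mul_star_self, star_mul_self, ip_smul_right,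
    ip_smul_right, ← re_eq_ip, ← re_eq_ip]
  exact sub_self _

namespace sl2O

theorem toMat_mulVec (m : sl2O) (X : h2O) : toMat m *ᵥ coord X = coord (act m X) :=
  matOf_mulVec (act m) X

theorem toEnd_coord (m : sl2O) (X : h2O) : toEnd m (coord X) = coord (act m X) :=
  matOf_mulVec (act m) X

theorem lor_act (m : sl2O) (X : h2O) : lor (coord (act m X)) (coord X) = 0 := by
  obtain ⟨p, q, r, d, hd, D, rfl⟩ := exists_mk m
  obtain ⟨α, x, β, rfl⟩ := exists_hm X
  rw [act_mk, lor_coord_hm]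
  simp only [ip_add_left, ip_smul_left, ip_mul_sub_mul_star, ip_commMap_self, derO_ip_self D.2]
  ring

theorem toEnd_mem_lorSkew (m : sl2O) : toEnd m ∈ lorSkew := fun v w =>
  lor_self_add v w _ fun v => by
    obtain ⟨X, rfl⟩ := coord.surjective v
    rw [toEnd_coord]
    exact lor_act m X

theorem mk_zero (hd : re 0 = 0) : mk 0 0 0 0 hd 0 = 0 := by
  refine Prod.ext (Subtype.ext ?_) (Prod.ext (Subtype.ext ?_) rfl)
  · ext i j : 1
    fin_cases i <;> fin_cases j <;> simp [mk] <;> rfl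
  · exact map_zero commMap

/-- The images of `E₁₁` and `E₂₂` determine `r`, `q` and `Re p`, and the off-diagonal entry `x = 1`
determines the rest of `p`. There remains `C_d = -D`, which forces both to vanish. -/
theorem eq_zero_of_act {m : sl2O} (h : act m = 0) : m = 0 := by
  obtain ⟨p, q, r, d, hd, D, rfl⟩ := exists_mk m
  have e : ∀ α x β, act (mk p q r d hd D) (hm α x β) = hm 0 0 0 := fun α x β => by
    rw [h, hm_zero]; rfl
  simp only [act_mk] at e
  obtain ⟨h1, h2, -⟩ := hm_injective (e 1 0 0)
  obtain ⟨-, h3, -⟩ := hm_injective (e 0 0 1)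
  have hD0 : (D : Module.End ℝ Octonion) 0 = 0 := map_zero _
  have hr : r = 0 := by
    simpa [hD0] using h2
  have hq : q = 0 := by
    simpa [hD0] using h3
  have hp0 : re p = 0 := by
    simpa [ip] using h1
  have hS : ∀ x, p * x - x * star p + commMap d x + (D : Module.End ℝ Octonion) x = 0 := fun x => by
    simpa using (hm_injective (e 0 x 0)).2.1
  have hp : p = 0 := by
    have h5 := hS 1
    rw [commMap_one, derO_one D, mul_one, one_mul, star_eq_neg hp0, sub_neg_eq_add, add_zero,
      add_zero, ← two_smul ℝ] at h5
    exact (smul_eq_zero.1 h5).resolve_left two_ne_zero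
  have hC : commMap d = -(D : Module.End ℝ Octonion) := by
    ext1 x
    have := hS x
    rw [hp, star_zero, zero_mul, mul_zero, sub_zero, zero_add] at this
    exact eq_neg_of_add_eq_zero_left this
  have hd0 : d = 0 := eq_zero_of_commMap_mem_derO hd (hC ▸ neg_mem D.2)
  have hD : D = 0 := by
    rw [hd0, map_zero] at hC
    exact Subtype.ext (neg_eq_zero.1 hC.symm)
  subst hp hq hr hd0 hD
  exact mk_zero hd

theorem toMat_injective : Function.Injective toMat := by
  rw [← LinearMap.ker_eq_bot, LinearMap.ker_eq_bot']
  intro m hm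
  refine eq_zero_of_act (LinearMap.ext fun X => coord.injective ?_)
  rw [← toMat_mulVec, hm, Matrix.zero_mulVec, LinearMap.zero_apply, map_zero]

/-- The part of an endomorphism of `𝔥₂(𝕆)` acting on the off-diagonal entry. -/
def offPart (T : Module.End ℝ h2O) : Module.End ℝ Octonion where
  toFun x := (T (hm 0 x 0) : M2O) 0 1
  map_add' x y := by
    have h : hm 0 (x + y) 0 = hm 0 x 0 + hm 0 y 0 := by rw [hm_add, add_zero]
    rw [h, map_add]; rfl
  map_smul' c x := by
    have h : hm 0 (c • x) 0 = c • hm 0 x 0 := by rw [smul_hm, mul_zero]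
    rw [h, map_smul]; rfl

/-- Skewness, tested on few vectors, expresses everything by `T E₁₁`, `T E₂₂` and a skew map of `𝕆`.
Subtracting `x ↦ px - xp̄` makes that map kill `1`, and the remainder is in `C(𝕆') + Der(𝕆)`. -/
theorem exists_act_eq {T : Module.End ℝ h2O} (h : ∀ X, lor (coord (T X)) (coord X) = 0) :
    ∃ m, act m = T := by
  obtain ⟨a₁, x₁, b₁, h1⟩ := exists_hm (T (hm 1 0 0))
  obtain ⟨a₂, x₂, b₂, h2⟩ := exists_hm (T (hm 0 0 1))
  have h3 : ∀ x, ∃ f g, T (hm 0 x 0) = hm f (offPart T x) g := fun x => by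
    obtain ⟨f, y, g, hx⟩ := exists_hm (T (hm 0 x 0))
    refine ⟨f, g, ?_⟩
    have : offPart T x = y := by
      change (T (hm 0 x 0) : M2O) 0 1 = y
      rw [hx]; rfl
    rw [this, hx]
  choose f g hT using h3
  have key : ∀ α β x, lor (coord (hm (α * a₁ + f x + β * a₂) (α • x₁ + offPart T x + β • x₂)
      (α * b₁ + g x + β * b₂))) (coord (hm α x β)) = 0 := fun α β x => by
    have e : T (hm α x β) = hm (α * a₁ + f x + β * a₂) (α • x₁ + offPart T x + β • x₂)
        (α * b₁ + g x + β * b₂) := by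
      rw [hm_eq_add α β x, map_add T, map_add T, map_smul T, map_smul T, h1, h2, hT, smul_hm,
        smul_hm, hm_add, hm_add]
    rw [← e]
    exact h _
  simp only [lor_coord_hm, ip_add_left, ip_smul_left] at key
  have hS : ∀ x, ip (offPart T x) x = 0 := fun x => by linarith [key 0 0 x]
  have hb : b₁ = 0 := by linarith [key 1 0 0, key (-1) 0 0, hS 0]
  have ha : a₂ = 0 := by linarith [key 0 1 0, key 0 (-1) 0, hS 0]
  have hg : ∀ x, g x = 2 * ip x₁ x := fun x => by linarith [key 1 0 x, hS x]
  have hf : ∀ x, f x = 2 * ip x₂ x := fun x => by linarith [key 0 1 x, hS x]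
  have hba : b₂ = -a₁ := by linarith [key 1 1 0, hS 0, hg 0, hf 0]
  have hs : re (offPart T 1) = 0 := by rw [re_eq_ip, hS]
  -- The real part matches the action on the diagonal, and `p - p̄` is the image of `1`.
  let p : Octonion := (a₁ / 2) • 1 + (1 / 2 : ℝ) • offPart T 1
  have hp : re p = a₁ / 2 := by
    have : re p = a₁ / 2 * 1 + 1 / 2 * re (offPart T 1) := rfl
    rw [this, hs]; ring
  have hpp : p - star p = offPart T 1 := by
    rw [star_eq, hp]
    simp only [p]
    module
  let S' : Module.End ℝ Octonion :=
    offPart T - (LinearMap.mulLeft ℝ p - LinearMap.mulRight ℝ (star p))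
  have hS' : ∀ x, S' x = offPart T x - (p * x - x * star p) := fun x => rfl
  obtain ⟨d, hd, hD⟩ := exists_sub_commMap_mem_derO (S := S')
    (by rw [hS', mul_one, one_mul, hpp, sub_self])
    (fun x => by rw [hS', ip_sub_left, hS, ip_mul_sub_mul_star, sub_self])
  refine ⟨mk p x₂ (star x₁) d hd ⟨_, hD⟩, end_ext_hm fun α x β => ?_⟩
  have e1 : 2 * re p = a₁ := by rw [hp]; ring
  have e2 : p * x - x * star p + commMap d x + (S' - commMap d) x = offPart T x := by
    rw [LinearMap.sub_apply, hS']; abel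
  rw [act_mk, e1, star_star, e2, hm_eq_add α β x, map_add T, map_add T, map_smul T, map_smul T, h1,
    h2, hT, smul_hm, smul_hm, hm_add, hm_add, hf, hg, hba, ha, hb]
  congr 1
  · ring
  · abel
  · ring

theorem exists_toEnd_eq {A : (Fin 10 → ℝ) →L[ℝ] (Fin 10 → ℝ)} (hA : A ∈ lorSkew) :
    ∃ m, toEnd m = A := by
  obtain ⟨m, hm⟩ := exists_act_eq (T := coord.symm.conj (A : (Fin 10 → ℝ) →ₗ[ℝ] (Fin 10 → ℝ)))
    fun X => by
      have h1 : coord (coord.symm.conj (A : (Fin 10 → ℝ) →ₗ[ℝ] (Fin 10 → ℝ)) X) = A (coord X) :=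
        coord.apply_symm_apply _
      have := hA (coord X) (coord X)
      rw [h1]
      rw [lor_comm (coord X)] at this
      linarith
  refine ⟨m, ContinuousLinearMap.ext fun v => ?_⟩
  obtain ⟨X, rfl⟩ := coord.surjective v
  rw [toEnd_coord, hm]
  exact coord.apply_symm_apply _

theorem toEnd_eq_endOfMatrix (m : sl2O) : toEnd m = endOfMatrix (toMat m) := rfl

theorem range_toMat : Set.range toMat = (so91 : Set (Matrix (Fin 10) (Fin 10) ℝ)) := by
  ext A
  constructor
  · rintro ⟨m, rfl⟩
    exact endOfMatrix_mem.1 (toEnd_mem_lorSkew m)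
  · intro hA
    obtain ⟨m, hm⟩ := exists_toEnd_eq (endOfMatrix_mem.2 hA)
    exact ⟨m, endOfMatrix.injective hm⟩

theorem commutator_mem_lorSkew {A B : (Fin 10 → ℝ) →L[ℝ] (Fin 10 → ℝ)} (hA : A ∈ lorSkew)
    (hB : B ∈ lorSkew) : A * B - B * A ∈ lorSkew := fun v w => by
  have e : ∀ v, (A * B - B * A) v = A (B v) + (-1 : ℝ) • B (A v) := fun v => by
    rw [neg_one_smul, ← sub_eq_add_neg]; rfl
  rw [e, e, lor_add_left, lor_add_right, lor_smul_left, lor_smul_right]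
  linarith [hA (B v) w, hA v (B w), hB (A v) w, hB v (A w)]

theorem endOfMatrix_mul (A B : Matrix (Fin 10) (Fin 10) ℝ) :
    endOfMatrix (A * B) = endOfMatrix A * endOfMatrix B :=
  ContinuousLinearMap.ext fun v => (Matrix.mulVec_mulVec v A B).symm

/-- Commutators of skew maps are skew, hence in the range of `toMat`, so `Function.invFun` returns a
true preimage. -/
theorem toMat_bracket (m n : sl2O) :
    toMat ⁅m, n⁆ = toMat m * toMat n - toMat n * toMat m := by
  refine Function.invFun_eq ?_
  change _ ∈ Set.range toMat
  rw [range_toMat]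
  refine endOfMatrix_mem.1 ?_
  rw [map_sub, endOfMatrix_mul, endOfMatrix_mul]
  exact commutator_mem_lorSkew (toEnd_mem_lorSkew m) (toEnd_mem_lorSkew n)

theorem toEnd_bracket (m n : sl2O) :
    toEnd ⁅m, n⁆ = toEnd m * toEnd n - toEnd n * toEnd m := by
  simp only [toEnd_eq_endOfMatrix, toMat_bracket, map_sub, endOfMatrix_mul]

theorem toEnd_injective : Function.Injective toEnd :=
  endOfMatrix.injective.comp toMat_injective

/-- `φ` as an isomorphism of `𝔰𝔩(2,𝕆)` onto `𝔰𝔬(9,1)`, in terms of endomorphisms. -/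
def lorSkewEquiv : sl2O ≃ₗ[ℝ] lorSkew :=
  LinearEquiv.ofBijective
    { toFun := fun m => ⟨toEnd m, toEnd_mem_lorSkew m⟩
      map_add' := fun m n => Subtype.ext (by
        change endOfMatrix _ = endOfMatrix _ + endOfMatrix _
        rw [map_add toMat, map_add endOfMatrix])
      map_smul' := fun r m => Subtype.ext (by
        change endOfMatrix _ = r • endOfMatrix _
        rw [map_smul toMat, map_smul endOfMatrix]) }
    ⟨fun m n h => toEnd_injective (congrArg Subtype.val h), fun A => by
      obtain ⟨m, hm⟩ := exists_toEnd_eq A.2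
      exact ⟨m, Subtype.ext hm⟩⟩

theorem coe_lorSkewEquiv (m : sl2O) : (lorSkewEquiv m : (Fin 10 → ℝ) →L[ℝ] (Fin 10 → ℝ)) = toEnd m :=
  rfl

end sl2O

/-- The tangent space at `1` is the model space, which the slice chart identifies with the skew
endomorphisms and `φ⁻¹` with `𝔰𝔩(2,𝕆)`. Brackets agree because their images under the injective
`toEnd` are commutators. -/
theorem exists_lieGroup_SL2O :
    ∃ (_ : ChartedSpace E45 SL2O) (_ : LieGroup 𝓘(ℝ, E45) ∞ SL2O),
      Manifold.IsSmoothEmbedding 𝓘(ℝ, E45) 𝓘(ℝ, (Fin 10 → ℝ) →L[ℝ] (Fin 10 → ℝ)) ∞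
        (Subtype.val : SL2O → GL10) ∧
      ∃ e : GroupLieAlgebra 𝓘(ℝ, E45) SL2O ≃ₗ[ℝ] sl2O,
        (∀ v w : GroupLieAlgebra 𝓘(ℝ, E45) SL2O, e ⁅v, w⁆ = ⁅e v, e w⁆) ∧
        ∀ v : GroupLieAlgebra 𝓘(ℝ, E45) SL2O,
          mfderiv 𝓘(ℝ, E45) 𝓘(ℝ, (Fin 10 → ℝ) →L[ℝ] (Fin 10 → ℝ))
            (fun g : SL2O => ((g : GL10) : (Fin 10 → ℝ) →L[ℝ] (Fin 10 → ℝ))) 1 v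
              = sl2O.toEnd (e v) := by
  obtain ⟨F, S, ε, hε⟩ := exists_sliceChart
  obtain ⟨cs, lg, emb, hd⟩ := S.exists_lieGroup
  refine ⟨cs, lg, emb, ?_⟩
  let e : E45 ≃ₗ[ℝ] sl2O := ε.trans sl2O.lorSkewEquiv.symm
  have he : ∀ v : E45, modelDeriv E45
      (fun g : SL2O => ((g : GL10) : (Fin 10 → ℝ) →L[ℝ] (Fin 10 → ℝ))) 1 v = sl2O.toEnd (e v) := by
    intro v
    rw [hd, hε, ← sl2O.coe_lorSkewEquiv]
    simp [e]
  refine ⟨e, fun v w => ?_, he⟩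
  let ι : SL2O →* ((Fin 10 → ℝ) →L[ℝ] (Fin 10 → ℝ)) := (Units.coeHom _).comp SL2O.subtype
  have hι : ContMDiff 𝓘(ℝ, E45) 𝓘(ℝ, (Fin 10 → ℝ) →L[ℝ] (Fin 10 → ℝ)) ∞ ι :=
    Units.contMDiff_val.comp emb.contMDiff
  have hb := modelDeriv_bracket (E := E45) ι hι v w
  apply sl2O.toEnd_injective
  rw [sl2O.toEnd_bracket]
  exact (he _).symm.trans (hb.trans (congrArg₂ (· - ·) (congrArg₂ (· * ·) (he v) (he w))
    (congrArg₂ (· * ·) (he w) (he v))))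

/-! ### The derivations `D_{a,b}` -/

namespace Octonion

/-- The endomorphism `D_{a,b}(x) = [[a, b], x] - 3 [a, b, x]`. -/
def canonicalEnd (a b : Octonion) : Module.End ℝ Octonion where
  toFun x := commutatorOf (commutatorOf a b) x - (3 : ℝ) • associatorOf a b x
  map_add' x y := by
    rw [associatorOf_add_right, commutatorOf, commutatorOf, commutatorOf, commutatorOf, mul_add,
      add_mul, smul_add]
    abel
  map_smul' r x := by
    rw [associatorOf_smul_right, commutatorOf, commutatorOf, commutatorOf, mul_smul_comm,
      smul_mul_assoc, ← smul_sub, smul_comm (3 : ℝ), ← smul_sub]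
    rfl

theorem canonicalEnd_apply (a b x : Octonion) : canonicalEnd a b x =
    commutatorOf (commutatorOf a b) x - (3 : ℝ) • associatorOf a b x := rfl

theorem canonicalEnd_eq_skewEnd (a b : Octonion) :
    canonicalEnd a b = skewEnd (entries (canonicalEnd a b)) := by
  refine eq_skewEnd ?_ (skew_of_ip_self fun x => ?_)
  · rw [canonicalEnd_apply, commutatorOf, associatorOf]
    simp
  · have h : commutatorOf (commutatorOf a b) x = commMap (commutatorOf a b) x := rfl
    rw [canonicalEnd_apply, ip_sub_left, ip_smul_left, ip_associatorOf_right, h, ip_commMap_self]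
    ring

/-- The map is skew and kills `1`, so only the seven linear relations have to be verified. -/
theorem canonicalEnd_mem_derO (a b : Octonion) : canonicalEnd a b ∈ derO := by
  rw [canonicalEnd_eq_skewEnd]
  apply skewEnd_mem_derO
  constructor <;>
    simp [entries, canonicalEnd_apply, commutatorOf, associatorOf, im, ip] <;> ring

theorem canonicalEnd_zero_right (a : Octonion) : canonicalEnd a 0 = 0 := by
  ext1 x
  rw [canonicalEnd_apply, commutatorOf, commutatorOf, associatorOf]
  simp

theorem anticommute_of_perp {a b : Octonion} (ha : re a = 0) (hb : re b = 0) (h : ip a b = 0) :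
    a * b = -(b * a) := by
  have h1 := mul_star_add a b
  rw [star_eq_neg ha, star_eq_neg hb, h, mul_zero, zero_smul, mul_neg, mul_neg] at h1
  exact neg_injective (eq_neg_of_add_eq_zero_left h1)

theorem re_im (k : Fin 7) : re (im k) = 0 := by
  fin_cases k <;> rfl

theorem im_ne_zero (k : Fin 7) : im k ≠ 0 := fun h => by
  have : normSq (im k) = 1 := by fin_cases k <;> simp [im, normSq]
  rw [h, normSq_eq_zero.2 rfl] at this
  exact zero_ne_one this

theorem mk_mul (a0 a1 a2 a3 a4 a5 a6 a7 b0 b1 b2 b3 b4 b5 b6 b7 : ℝ) :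
    (⟨a0, a1, a2, a3, a4, a5, a6, a7⟩ * ⟨b0, b1, b2, b3, b4, b5, b6, b7⟩ : Octonion) =
      ⟨a0 * b0 - a1 * b1 - a2 * b2 - a3 * b3 - a4 * b4 - a5 * b5 - a6 * b6 - a7 * b7,
        a0 * b1 + a1 * b0 + (a2 * b7 - a7 * b2) + (a3 * b5 - a5 * b3) + (a6 * b4 - a4 * b6),
        a0 * b2 + a2 * b0 + (a7 * b1 - a1 * b7) + (a6 * b3 - a3 * b6) + (a5 * b4 - a4 * b5),
        a0 * b3 + a3 * b0 + (a5 * b1 - a1 * b5) + (a2 * b6 - a6 * b2) + (a4 * b7 - a7 * b4),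
        a0 * b4 + a4 * b0 + (a1 * b6 - a6 * b1) + (a2 * b5 - a5 * b2) + (a7 * b3 - a3 * b7),
        a0 * b5 + a5 * b0 + (a1 * b3 - a3 * b1) + (a4 * b2 - a2 * b4) + (a6 * b7 - a7 * b6),
        a0 * b6 + a6 * b0 + (a4 * b1 - a1 * b4) + (a3 * b2 - a2 * b3) + (a7 * b5 - a5 * b7),
        a0 * b7 + a7 * b0 + (a1 * b2 - a2 * b1) + (a3 * b4 - a4 * b3) + (a5 * b6 - a6 * b5)⟩ := rfl

theorem mk_sub (a0 a1 a2 a3 a4 a5 a6 a7 b0 b1 b2 b3 b4 b5 b6 b7 : ℝ) :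
    (⟨a0, a1, a2, a3, a4, a5, a6, a7⟩ - ⟨b0, b1, b2, b3, b4, b5, b6, b7⟩ : Octonion) =
      ⟨a0 - b0, a1 - b1, a2 - b2, a3 - b3, a4 - b4, a5 - b5, a6 - b6, a7 - b7⟩ := by
  ext <;> simp

set_option maxHeartbeats 1000000 in
/-- Every derivation is a combination of derivations `D_{a,b}`. -/
theorem sum_canonicalEnd {s : Fin 7 → Fin 7 → ℝ} (h : DerRel s) (x : Octonion) :
    ∑ k, canonicalEnd (im k) (skewEnd s (im k)) x = (12 : ℝ) • skewEnd s x := by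
  obtain ⟨h1, h2, h3, h4, h5, h6, h7⟩ := h.eqs
  obtain ⟨x0, x1, x2, x3, x4, x5, x6, x7⟩ := x
  simp only [Fin.sum_univ_seven, canonicalEnd_apply, commutatorOf, associatorOf]
  simp [skewEnd, im, mk_mul, mk_sub]
  ext
  all_goals
    simp only [add_x0, add_x1, add_x2, add_x3, add_x4, add_x5, add_x6, add_x7, sub_x0, sub_x1,
      sub_x2, sub_x3, sub_x4, sub_x5, sub_x6, sub_x7, smul_x0, smul_x1, smul_x2, smul_x3, smul_x4,
      smul_x5, smul_x6, smul_x7, h1, h2, h3, h4, h5, h6, h7]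
    ring

end Octonion

/-- The identity `∑ₖ D_{eₖ, D eₖ} = 12 D` exhibits `D`. Each pair `eₖ, D eₖ` anticommutes because
`D` is skew with imaginary values; terms with `D eₖ = 0` drop out. -/
theorem span_canonical_eq_top : Submodule.span ℝ
    {D : derO | ∃ a b, AnticommutingImaginary a b ∧ IsCanonicalDer a b D} = ⊤ := by
  rw [eq_top_iff]
  rintro D -
  let T : Fin 7 → derO := fun k => ⟨_, canonicalEnd_mem_derO (im k) ((D : Module.End ℝ Octonion) (im k))⟩
  have hT : ∀ k, T k ∈ Submodule.span ℝ
      {D : derO | ∃ a b, AnticommutingImaginary a b ∧ IsCanonicalDer a b D} := fun k => by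
    by_cases h0 : (D : Module.End ℝ Octonion) (im k) = 0
    · have : T k = 0 := Subtype.ext (by
        change canonicalEnd _ _ = 0
        rw [h0, canonicalEnd_zero_right])
      rw [this]
      exact zero_mem _
    · refine Submodule.subset_span ⟨im k, (D : Module.End ℝ Octonion) (im k),
        ⟨im_ne_zero k, h0, re_im k, sl2O.derO_im D _, ?_⟩, fun x => rfl⟩
      refine anticommute_of_perp (re_im k) (sl2O.derO_im D _) ?_
      rw [ip_comm, derO_ip_self D.2]
  have hD : D = (1 / 12 : ℝ) • ∑ k, T k := by
    refine Subtype.ext (LinearMap.ext fun x => ?_)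
    have hs := derO_eq_skewEnd D.2
    have hr : DerRel (entries (D : Module.End ℝ Octonion)) :=
      derRel_of_skewEnd_mem (hs ▸ D.2)
    have h1 := sum_canonicalEnd hr x
    rw [← hs] at h1
    have h2 : ((∑ k, T k : derO) : Module.End ℝ Octonion) x =
        ∑ k, canonicalEnd (im k) ((D : Module.End ℝ Octonion) (im k)) x := by
      rw [Submodule.coe_sum, LinearMap.sum_apply]
    rw [Submodule.coe_smul, LinearMap.smul_apply, h2, h1, smul_smul]
    norm_num
  rw [hD]
  exact Submodule.smul_mem _ _ (Submodule.sum_mem _ fun k _ => hT k)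

/-! ### Transformations acting entrywise -/

/-- The endomorphism of `𝔥₂(𝕆)` that multiplies the diagonal entries by `c` and applies `f` to the
off-diagonal entry. -/
def blockH2 (c : ℝ) (f : Module.End ℝ Octonion) : Module.End ℝ h2O where
  toFun X := hm (c * re ((X : M2O) 0 0)) (f ((X : M2O) 0 1)) (c * re ((X : M2O) 1 1))
  map_add' X Y := by
    rw [hm_add, ← mul_add, ← mul_add, ← map_add]; rfl
  map_smul' r X := by
    rw [RingHom.id_apply, smul_hm, ← map_smul, mul_left_comm, mul_left_comm r]; rfl

theorem blockH2_hm (c : ℝ) (f : Module.End ℝ Octonion) (α β : ℝ) (x : Octonion) :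
    blockH2 c f (hm α x β) = hm (c * α) (f x) (c * β) := by
  have h1 : re ((hm α x β : M2O) 0 0) = α := by simp [hm, re]
  have h2 : re ((hm α x β : M2O) 1 1) = β := by simp [hm, re]
  change hm (c * re ((hm α x β : M2O) 0 0)) (f x) (c * re ((hm α x β : M2O) 1 1)) = _
  rw [h1, h2]

/-- `blockH2` in the coordinates. -/
def block : (ℝ × Module.End ℝ Octonion) →ₗ[ℝ] ((Fin 10 → ℝ) →L[ℝ] (Fin 10 → ℝ)) where
  toFun p := LinearMap.toContinuousLinearMap (coord.conj (blockH2 p.1 p.2))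
  map_add' p q := by
    rw [← map_add, ← map_add]
    congr 2
    refine end_ext_hm fun α x β => ?_
    rw [LinearMap.add_apply, blockH2_hm, blockH2_hm, blockH2_hm, hm_add, ← add_mul, ← add_mul]
    rfl
  map_smul' r p := by
    rw [← map_smul, ← map_smul]
    congr 2
    refine end_ext_hm fun α x β => ?_
    rw [LinearMap.smul_apply, blockH2_hm, blockH2_hm, RingHom.id_apply, smul_hm, ← mul_assoc,
      ← mul_assoc]
    rfl

theorem block_coord_hm (c : ℝ) (f : Module.End ℝ Octonion) (α β : ℝ) (x : Octonion) :
    block (c, f) (coord (hm α x β)) = coord (hm (c * α) (f x) (c * β)) := by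
  rw [← blockH2_hm]
  change coord (blockH2 c f (coord.symm (coord (hm α x β)))) = _
  rw [LinearEquiv.symm_apply_apply]

theorem ext_coord_hm {A B : (Fin 10 → ℝ) →L[ℝ] (Fin 10 → ℝ)}
    (h : ∀ α x β, A (coord (hm α x β)) = B (coord (hm α x β))) : A = B := by
  ext1 v
  obtain ⟨X, rfl⟩ := coord.surjective v
  obtain ⟨α, x, β, rfl⟩ := exists_hm X
  exact h α x β

theorem block_mul (p q : ℝ × Module.End ℝ Octonion) : block (p * q) = block p * block q :=
  ext_coord_hm fun α x β => by
    change block (p.1 * q.1, p.2 * q.2) _ = block p (block q _)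
    rw [block_coord_hm, block_coord_hm q.1 q.2, block_coord_hm p.1 p.2, mul_assoc, mul_assoc]
    rfl

theorem block_one : block 1 = 1 := ext_coord_hm fun α x β => by
  change block (1, 1) _ = _
  rw [block_coord_hm, one_mul, one_mul]
  rfl

namespace Octonion

/-- The map `x ↦ (u x) v`, as a bilinear function of `u` and `v`. -/
def sandwich : Octonion →ₗ[ℝ] Octonion →ₗ[ℝ] Module.End ℝ Octonion :=
  LinearMap.mk₂ ℝ (fun u v => LinearMap.mulRight ℝ v * LinearMap.mulLeft ℝ u)
    (fun u u' v => by ext1 x; simp [add_mul])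
    (fun r u v => by ext1 x; simp [smul_mul_assoc])
    (fun u v v' => by ext1 x; simp [mul_add])
    (fun r u v => by ext1 x; simp [mul_smul_comm])

/-- The map `x ↦ (u x) ū`. -/
def conjEnd (u : Octonion) : Module.End ℝ Octonion := sandwich u (star u)

theorem conjEnd_apply (u x : Octonion) : conjEnd u x = (u * x) * star u := rfl

theorem mul_mul_star_assoc (u x : Octonion) : (u * x) * star u = u * (x * star u) := by
  have h : associatorOf u x (star u) = 0 := by
    rw [associatorOf_star_right, associatorOf, flexible, sub_self, neg_zero]
  exact sub_eq_zero.1 h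

theorem conjEnd_mul_star (u : Octonion) (h : normSq u = 1) : conjEnd u * conjEnd (star u) = 1 := by
  ext1 x
  rw [Module.End.mul_apply, conjEnd_apply, conjEnd_apply, mul_mul_star_assoc (star u), star_star,
    mul_star_mul, h, one_smul, mul_mul_star, h, one_smul]
  rfl

theorem conjEnd_star_mul (u : Octonion) (h : normSq u = 1) : conjEnd (star u) * conjEnd u = 1 := by
  simpa using conjEnd_mul_star (star u) (by rwa [normSq_star])

theorem conjEnd_star_apply (u x : Octonion) : conjEnd u (star x) = star (conjEnd u x) := by
  rw [conjEnd_apply, conjEnd_apply, star_mul, star_mul, star_star, mul_mul_star_assoc]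

theorem conjEnd_one {u : Octonion} (h : normSq u = 1) : conjEnd u 1 = 1 := by
  rw [conjEnd_apply, mul_one, mul_star_self, h, one_smul]

theorem inv_eq_star {u : Octonion} (h : normSq u = 1) : u⁻¹ = star u := by
  change (normSq u)⁻¹ • star u = _
  rw [h, inv_one, one_smul]

end Octonion

theorem phi_scalarMat {u : Octonion} (h : normSq u = 1) (α β : ℝ) (x : Octonion) :
    phi (scalarMat u) (hm α x β) = hm α (conjEnd u x) β := by
  have h0 : ∀ y, ip (0 : Octonion) y = 0 := fun y => by simp [ip]
  rw [scalarMat, phi_hm, h, conjEnd_apply]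
  simp only [star_zero, mul_zero, zero_mul, smul_zero, add_zero, zero_add, h0, ip_comm _ 0,
    normSq_eq_zero.2, mul_one]
  rw [← mul_mul_star_assoc, ← two_smul ℝ, smul_smul]
  norm_num

/-- The transformation `x ↦ (u x) ū` of the entries, for a unit octonion `u`. -/
def conjGL (u : Octonion) (h : normSq u = 1) : GL10 where
  val := block (1, conjEnd u)
  inv := block (1, conjEnd (star u))
  val_inv := by
    rw [← block_mul, Prod.mk_mul_mk, conjEnd_mul_star u h, one_mul]; exact block_one
  inv_val := by
    rw [← block_mul, Prod.mk_mul_mk, conjEnd_star_mul u h, one_mul]; exact block_one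

theorem represents_conjGL (u : Octonion) (h : normSq u = 1) :
    Represents (conjGL u h) (phi (scalarMat u)) := fun X => by
  obtain ⟨α, x, β, rfl⟩ := exists_hm X
  rw [phi_scalarMat h]
  change block (1, conjEnd u) _ = _
  rw [block_coord_hm, one_mul, one_mul]

theorem Octonion.normSq_conjEnd {u : Octonion} (h : normSq u = 1) (x : Octonion) :
    normSq (conjEnd u x) = normSq x := by
  rw [conjEnd_apply, normSq_mul, normSq_mul, normSq_star, h, one_mul, mul_one]

theorem conjGL_mem (u : Octonion) (h : normSq u = 1) : conjGL u h ∈ SL2O :=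
  Subgroup.subset_closure ⟨scalarMat u, fun X => by
    obtain ⟨α, x, β, rfl⟩ := exists_hm X
    rw [phi_scalarMat h, hdet_hm, hdet_hm, normSq_conjEnd h], represents_conjGL u h⟩

theorem Represents.mul {g g' : GL10} {T T' : h2O →ₗ[ℝ] h2O} (h : Represents g T)
    (h' : Represents g' T') : Represents (g * g') (T ∘ₗ T') := fun X => by
  change g.val (g'.val (coord X)) = _
  rw [h', h]; rfl

/-! ### Tangent vectors of the curves `G^t_{a,b}` -/

/-- A product rule that needs a norm only on the target: the octonion curves enter through their
real coefficients. -/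
theorem hasDerivAt_bilin {V W F : Type*} [AddCommGroup V] [Module ℝ V] [AddCommGroup W]
    [Module ℝ W] [NormedAddCommGroup F] [NormedSpace ℝ F] {ι κ : Type*} [Fintype ι] [Fintype κ]
    (B : V →ₗ[ℝ] W →ₗ[ℝ] F) (e : ι → V) (f : κ → W) {p : ι → ℝ → ℝ} {q : κ → ℝ → ℝ} {p' : ι → ℝ}
    {q' : κ → ℝ} {t : ℝ} (hp : ∀ i, HasDerivAt (p i) (p' i) t)
    (hq : ∀ j, HasDerivAt (q j) (q' j) t) :
    HasDerivAt (fun s => B (∑ i, p i s • e i) (∑ j, q j s • f j))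
      (B (∑ i, p' i • e i) (∑ j, q j t • f j) + B (∑ i, p i t • e i) (∑ j, q' j • f j)) t := by
  have h : HasDerivAt (fun s => ∑ i, ∑ j, (p i s * q j s) • B (e i) (f j))
      (∑ i, ∑ j, (p' i * q j t + p i t * q' j) • B (e i) (f j)) t :=
    HasDerivAt.fun_sum fun i _ => HasDerivAt.fun_sum fun j _ =>
      ((hp i).mul (hq j)).smul_const (B (e i) (f j))
  have e1 : ∀ (a : ι → ℝ) (b : κ → ℝ), B (∑ i, a i • e i) (∑ j, b j • f j) =
      ∑ i, ∑ j, (a i * b j) • B (e i) (f j) := fun a b => by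
    simp only [map_sum, LinearMap.sum_apply, map_smul, LinearMap.smul_apply, smul_smul,
      Finset.smul_sum]
    rw [Finset.sum_comm]
    simp only [mul_comm]
  simp only [e1, ← Finset.sum_add_distrib, ← add_smul]
  exact h

namespace Octonion

/-- A case of the right Moufang identity. -/
theorem mul_mul_mul_mul_im {a : Octonion} (ha : re a = 0) (b x : Octonion) :
    (b * ((a * x) * a)) * a = -(normSq a • ((b * a) * x)) := by
  have hs := star_eq_neg ha
  have h1 : (a * x) * a = -((2 * ip a x) • a) - normSq a • star x := by
    have e3 := mul_star_add x (star a)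
    rw [star_star] at e3
    have e4 : x * a = (2 * ip x (star a)) • (1 : Octonion) - star a * star x :=
      eq_sub_of_add_eq e3
    rw [flexible, e4, mul_sub, mul_star_mul, mul_smul_comm, mul_one, hs, ip_neg_right, ip_comm x a,
      mul_neg, neg_smul]
  have h2 : (b * star x) * a = (2 * ip a x) • b + (b * a) * x := by
    have e := mul_mul_star_add (star a) (star x) b
    rw [star_star, star_star, ip_star, hs, mul_neg, neg_mul] at e
    exact sub_eq_iff_eq_add.1 ((sub_eq_add_neg _ _).trans e)
  have h3 : (b * a) * a = -(normSq a • b) := by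
    have e := mul_mul_star a b
    rwa [hs, mul_neg, neg_eq_iff_eq_neg] at e
  rw [h1, mul_sub, sub_mul, mul_neg, neg_mul, mul_smul_comm, smul_mul_assoc, mul_smul_comm,
    smul_mul_assoc, h2, h3]
  module

/-- The derivative of `G^t` at `0` in closed form: `u = u(0)`, `v = ū`, and `l b` is the velocity
`u'(0)`. All products are reduced to `(ab)x`, `x(ab)`, `(bx)a` and `[a,b,x]`. -/
theorem tangent_identity {a b x u v : Octonion} {k l : ℝ} (ha : re a = 0) (hab : a * b = -(b * a))
    (hk : k ^ 2 * normSq a = 3 / 4) (hkl : l * k = 1) (hu : u = (1 / 2 : ℝ) • 1 + k • a)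
    (hv : v = (1 / 2 : ℝ) • 1 - k • a) :
    l • (-((b * ((u * x) * v)) * u) + (x * v) * b + ((b * ((v * x) * u)) * v - (x * u) * b)) =
      canonicalEnd a b x := by
  have hba : b * a = -(a * b) := by rw [hab, neg_neg]
  have h1 : b * (a * x) = -((a * b) * x) + associatorOf a b x := by
    rw [associatorOf_swap_left, associatorOf, hba, neg_mul]; abel
  have h2 : b * (x * a) = (b * x) * a - associatorOf a b x := by
    rw [associatorOf_rotate, associatorOf]; abel
  have h3 : (x * a) * b = x * (a * b) + associatorOf a b x := by
    rw [← associatorOf_rotate, associatorOf]; abel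
  have h4 := mul_mul_mul_mul_im ha b x
  rw [hba, neg_mul, smul_neg, neg_neg] at h4
  have h5 : canonicalEnd a b x = (2 : ℝ) • ((a * b) * x) - (2 : ℝ) • (x * (a * b)) -
      (3 : ℝ) • associatorOf a b x := by
    rw [canonicalEnd_apply, commutatorOf, commutatorOf, hba, sub_neg_eq_add, add_mul, mul_add,
      two_smul, two_smul]
  have y1 : (u * x) * v = (1 / 4 : ℝ) • x + (k / 2) • (a * x) - (k / 2) • (x * a) -
      k ^ 2 • ((a * x) * a) := by
    rw [hu, hv]
    simp only [add_mul, mul_sub, smul_mul_assoc, mul_smul_comm, one_mul, mul_one]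
    module
  have z1 : (v * x) * u = (1 / 4 : ℝ) • x - (k / 2) • (a * x) + (k / 2) • (x * a) -
      k ^ 2 • ((a * x) * a) := by
    rw [hu, hv]
    simp only [sub_mul, mul_add, smul_mul_assoc, mul_smul_comm, one_mul, mul_one]
    module
  have hu' : ∀ s, s * u = (1 / 2 : ℝ) • s + k • (s * a) := fun s => by
    rw [hu, mul_add, mul_smul_comm, mul_smul_comm, mul_one]
  have hv' : ∀ s, s * v = (1 / 2 : ℝ) • s - k • (s * a) := fun s => by
    rw [hv, mul_sub, mul_smul_comm, mul_smul_comm, mul_one]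
  let p : Octonion := (1 / 4 : ℝ) • x - k ^ 2 • ((a * x) * a)
  let q : Octonion := (1 / 2 : ℝ) • (a * x) - (1 / 2 : ℝ) • (x * a)
  have aux1 : ∀ s t w m : Octonion, s + (k / 2) • t - (k / 2) • w - m =
      (s - m) + k • ((1 / 2 : ℝ) • t - (1 / 2 : ℝ) • w) := by intros; module
  have aux2 : ∀ s t w m : Octonion, s - (k / 2) • t + (k / 2) • w - m =
      (s - m) - k • ((1 / 2 : ℝ) • t - (1 / 2 : ℝ) • w) := by intros; module
  -- Exchanging `u` and `v` changes the sign of `k`, so `p` and `q` are the even and odd parts.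
  have y2 : (u * x) * v = p + k • q := y1.trans (aux1 _ _ _ _)
  have z2 : (v * x) * u = p - k • q := z1.trans (aux2 _ _ _ _)
  have aux3 : ∀ s t sa ta w wa : Octonion,
      -((1 / 2 : ℝ) • (s + k • t) + k • (sa + k • ta)) + ((1 / 2 : ℝ) • w - k • wa) +
        ((1 / 2 : ℝ) • (s - k • t) - k • (sa - k • ta) - ((1 / 2 : ℝ) • w + k • wa)) =
      -(k • t) - (2 * k) • sa - (2 * k) • wa := by intros; module
  have key : -((b * ((u * x) * v)) * u) + (x * v) * b + ((b * ((v * x) * u)) * v - (x * u) * b) =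
      -(k • (b * q)) - (2 * k) • ((b * p) * a) - (2 * k) • ((x * a) * b) := by
    rw [y2, z2]
    simp only [hu', hv', mul_add b, mul_sub b, mul_smul_comm, add_mul _ _ a, sub_mul _ _ a,
      smul_mul_assoc, add_mul _ _ b, sub_mul _ _ b]
    exact aux3 _ _ _ _ _ _
  have hq : b * q = (1 / 2 : ℝ) • (-((a * b) * x) + associatorOf a b x) -
      (1 / 2 : ℝ) • ((b * x) * a - associatorOf a b x) := by
    rw [mul_sub, mul_smul_comm, mul_smul_comm, h1, h2]
  have hp : (b * p) * a = (1 / 4 : ℝ) • ((b * x) * a) - (k ^ 2 * normSq a) • ((a * b) * x) := by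
    rw [mul_sub, mul_smul_comm, mul_smul_comm, sub_mul, smul_mul_assoc, smul_mul_assoc, h4,
      smul_smul]
  -- The value `1/4`, from the real part `1/2` of `u`, cancels the terms `(bx)a`; the value `k²‖a‖²
  -- = 3/4` gives `(ab)x` the coefficient `2`.
  have aux4 : ∀ c x' d A : Octonion,
      l • (-(k • ((1 / 2 : ℝ) • (-c + A) - (1 / 2 : ℝ) • (d - A))) -
        (2 * k) • ((1 / 4 : ℝ) • d - (3 / 4 : ℝ) • c) - (2 * k) • (x' + A)) =
      (l * k) • ((2 : ℝ) • c - (2 : ℝ) • x' - (3 : ℝ) • A) := by intros; module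
  rw [key, hq, hp, h3, h5, hk, aux4, hkl, one_smul]

end Octonion

/-- The coefficient of `r(t)` in `u(t)`. -/
def uCoeff (a b : Octonion) (t : ℝ) : ℝ :=
  √3 / (2 * √(normSq (a + (4 / 3 * normSq a * t) • b)))

namespace AnticommutingImaginary

variable {a b : Octonion}

theorem ip_eq_zero (h : AnticommutingImaginary a b) : ip a b = 0 := by
  obtain ⟨-, -, ha, hb, hab⟩ := h
  have h1 := mul_star_add a b
  rw [star_eq_neg ha, star_eq_neg hb, mul_neg, mul_neg, hab, neg_neg, add_neg_cancel] at h1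
  have h2 := (smul_eq_zero.1 h1.symm).resolve_right fun h => one_ne_zero (congrArg x0 h)
  linarith

theorem normSq_direction (h : AnticommutingImaginary a b) (s : ℝ) :
    normSq (a + s • b) = normSq a + s ^ 2 * normSq b := by
  rw [normSq_add, ip_smul_right, h.ip_eq_zero, normSq_smul]
  ring

theorem normSq_direction_pos (h : AnticommutingImaginary a b) (s : ℝ) :
    0 < normSq (a + s • b) := by
  rw [h.normSq_direction]
  have := normSq_pos h.1
  have := normSq_nonneg b
  positivity

theorem uCoeff_sq (h : AnticommutingImaginary a b) (t : ℝ) :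
    uCoeff a b t ^ 2 * normSq (a + (4 / 3 * normSq a * t) • b) = 3 / 4 := by
  have hp := h.normSq_direction_pos (4 / 3 * normSq a * t)
  rw [uCoeff, div_pow, mul_pow, Real.sq_sqrt hp.le, Real.sq_sqrt (by norm_num)]
  have e : ∀ q : ℝ, 0 < q → 3 / (2 ^ 2 * q) * q = 3 / 4 := fun q hq => by
    field_simp
    norm_num
  exact e _ hp

theorem re_direction (h : AnticommutingImaginary a b) (s : ℝ) : re (a + s • b) = 0 := by
  change re a + s * re b = 0
  rw [h.2.2.1, h.2.2.2.1]; ring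

theorem normSq_uCurve (h : AnticommutingImaginary a b) (t : ℝ) : normSq (uCurve a b t) = 1 := by
  have h1 : ip 1 (a + (4 / 3 * normSq a * t) • b) = 0 := by
    rw [ip_comm, ← re_eq_ip, h.re_direction]
  have h2 : normSq (1 : Octonion) = 1 := by simp [normSq]
  have h3 := h.uCoeff_sq t
  change normSq ((1 / 2 : ℝ) • (1 : Octonion) + uCoeff a b t • (a + (4 / 3 * normSq a * t) • b)) = 1
  rw [normSq_add, normSq_smul, normSq_smul, ip_smul_left, ip_smul_right, h1, h2, h3]
  norm_num

theorem inv_uCurve (h : AnticommutingImaginary a b) (t : ℝ) :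
    (uCurve a b t)⁻¹ = star (uCurve a b t) := inv_eq_star (h.normSq_uCurve t)

/-- Since `a ⊥ b`, the norm of `r(t)` is an even function of `t`. -/
theorem hasDerivAt_uCoeff (h : AnticommutingImaginary a b) : HasDerivAt (uCoeff a b) 0 0 := by
  have h1 : HasDerivAt (fun t => normSq (a + (4 / 3 * normSq a * t) • b)) 0 0 := by
    have e : (fun t => normSq (a + (4 / 3 * normSq a * t) • b)) =
        fun t => normSq a + (4 / 3 * normSq a) ^ 2 * normSq b * t ^ 2 := by
      ext t
      rw [h.normSq_direction]; ring
    rw [e]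
    simpa using ((hasDerivAt_pow 2 (0 : ℝ)).const_mul
      ((4 / 3 * normSq a) ^ 2 * normSq b)).const_add (normSq a)
  have hp := h.normSq_direction_pos (4 / 3 * normSq a * 0)
  have h2 := ((h1.sqrt hp.ne').const_mul 2).inv (by positivity)
  have e : uCoeff a b = fun t => √3 * (2 * √(normSq (a + (4 / 3 * normSq a * t) • b)))⁻¹ :=
    funext fun t => div_eq_mul_inv _ _
  rw [e]
  exact (h2.const_mul √3).congr_deriv (by simp)

/-- `u(t)` in terms of `1`, `a`, `b`. -/
def coeffs (a b : Octonion) (i : Fin 3) (t : ℝ) : ℝ :=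
  ![1 / 2, uCoeff a b t, uCoeff a b t * (4 / 3 * normSq a * t)] i

theorem uCurve_eq_sum (a b : Octonion) (t : ℝ) :
    uCurve a b t = ∑ i, coeffs a b i t • ![1, a, b] i := by
  rw [Fin.sum_univ_three]
  change (1 / 2 : ℝ) • (1 : Octonion) + uCoeff a b t • (a + (4 / 3 * normSq a * t) • b) =
    (1 / 2 : ℝ) • (1 : Octonion) + uCoeff a b t • a +
      (uCoeff a b t * (4 / 3 * normSq a * t)) • b
  rw [smul_add, smul_smul, add_assoc]

theorem star_uCurve_eq_sum (h : AnticommutingImaginary a b) (t : ℝ) :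
    star (uCurve a b t) = ∑ i, coeffs a b i t • ![1, -a, -b] i := by
  rw [uCurve_eq_sum, Fin.sum_univ_three, Fin.sum_univ_three, star_add, star_add, star_smul,
    star_smul, star_smul, star_trivial (coeffs a b 0 t), star_trivial (coeffs a b 1 t),
    star_trivial (coeffs a b 2 t)]
  change _ • star (1 : Octonion) + _ • star a + _ • star b = _ • (1 : Octonion) + _ • -a + _ • -b
  rw [star_one, star_eq_neg h.2.2.1, star_eq_neg h.2.2.2.1]

theorem hasDerivAt_coeffs (h : AnticommutingImaginary a b) (i : Fin 3) :
    HasDerivAt (coeffs a b i) (![0, 0, uCoeff a b 0 * (4 / 3 * normSq a)] i) 0 := by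
  fin_cases i
  · exact hasDerivAt_const _ _
  · exact h.hasDerivAt_uCoeff
  · have h1 : HasDerivAt (fun t : ℝ => 4 / 3 * normSq a * t) (4 / 3 * normSq a) 0 := by
      simpa using (hasDerivAt_id (0 : ℝ)).const_mul (4 / 3 * normSq a)
    exact (h.hasDerivAt_uCoeff.mul h1).congr_deriv (by simp)

/-- `block (1, ·)` is affine with linear part `offBlock`. -/
theorem block_eq_add (f : Module.End ℝ Octonion) :
    block (1, f) = block (1, 0) + (block.comp (LinearMap.inr ℝ ℝ _)) f := by
  change _ = _ + block (0, f)
  rw [← map_add, Prod.mk_add_mk, add_zero, zero_add]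

theorem hasDerivAt_block_conjEnd (h : AnticommutingImaginary a b) :
    HasDerivAt (fun t => block (1, conjEnd (uCurve a b t)))
      (block (0, (uCoeff a b 0 * (4 / 3 * normSq a)) •
        (sandwich b (star (uCurve a b 0)) - sandwich (uCurve a b 0) b))) 0 := by
  have := (hasDerivAt_bilin (sandwich.compr₂ (block.comp (LinearMap.inr ℝ ℝ _))) ![1, a, b]
    ![1, -a, -b] h.hasDerivAt_coeffs h.hasDerivAt_coeffs).const_add (block (1, 0))
  simp only [← uCurve_eq_sum, ← h.star_uCurve_eq_sum, LinearMap.compr₂_apply,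
    ← block_eq_add] at this
  refine this.congr_deriv ?_
  rw [← map_add]
  change block (0, _) = _
  congr 2
  simp [Fin.sum_univ_three, sub_eq_add_neg]

theorem hasDerivAt_block_conjEnd_star (h : AnticommutingImaginary a b) :
    HasDerivAt (fun t => block (1, conjEnd (star (uCurve a b t))))
      (block (0, (uCoeff a b 0 * (4 / 3 * normSq a)) •
        (sandwich (star (uCurve a b 0)) b - sandwich b (uCurve a b 0)))) 0 := by
  have := (hasDerivAt_bilin (sandwich.compr₂ (block.comp (LinearMap.inr ℝ ℝ _))) ![1, -a, -b]
    ![1, a, b] h.hasDerivAt_coeffs h.hasDerivAt_coeffs).const_add (block (1, 0))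
  simp only [← uCurve_eq_sum, ← h.star_uCurve_eq_sum, LinearMap.compr₂_apply,
    ← block_eq_add] at this
  simp only [conjEnd, star_star]
  refine this.congr_deriv ?_
  rw [← map_add]
  change block (0, _) = _
  congr 2
  simp [Fin.sum_univ_three, sub_eq_add_neg]
  abel

/-- The transformation `G^t_{a,b}` of the entries. -/
def groupCurve (h : AnticommutingImaginary a b) (t : ℝ) : SL2O :=
  ⟨conjGL (star (uCurve a b t)) (by rw [normSq_star, h.normSq_uCurve]) *
    (conjGL (uCurve a b 0) (h.normSq_uCurve 0) *
      (conjGL (uCurve a b t) (h.normSq_uCurve t) *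
        conjGL (star (uCurve a b 0)) (by rw [normSq_star, h.normSq_uCurve]))),
    mul_mem (conjGL_mem _ _) (mul_mem (conjGL_mem _ _) (mul_mem (conjGL_mem _ _) (conjGL_mem _ _)))⟩

theorem represents_groupCurve (h : AnticommutingImaginary a b) (t : ℝ) :
    Represents (h.groupCurve t)
      (phi (scalarMat (uCurve a b t)⁻¹) ∘ₗ phi (scalarMat (uCurve a b 0)) ∘ₗ
        phi (scalarMat (uCurve a b t)) ∘ₗ phi (scalarMat (uCurve a b 0)⁻¹)) := by
  rw [h.inv_uCurve, h.inv_uCurve]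
  exact (represents_conjGL _ _).mul ((represents_conjGL _ _).mul
    ((represents_conjGL _ _).mul (represents_conjGL _ _)))

theorem gCurve_eq (h : AnticommutingImaginary a b) (t : ℝ) (x : Octonion) :
    gCurve a b t x = conjEnd (star (uCurve a b t)) (conjEnd (uCurve a b 0)
      (conjEnd (uCurve a b t) (conjEnd (star (uCurve a b 0)) x))) := by
  simp only [gCurve, h.inv_uCurve, conjEnd_apply, star_star]

theorem hermOf_groupCurve (h : AnticommutingImaginary a b) (t : ℝ) (X : h2O) :
    hermOf (((h.groupCurve t : GL10) : (Fin 10 → ℝ) →L[ℝ] (Fin 10 → ℝ)) (coord X))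
      = (X : M2O).map (gCurve a b t) := by
  obtain ⟨α, x, β, rfl⟩ := exists_hm X
  have hs : normSq (star (uCurve a b t)) = 1 := by rw [normSq_star, h.normSq_uCurve]
  have hs0 : normSq (star (uCurve a b 0)) = 1 := by rw [normSq_star, h.normSq_uCurve]
  have hr : ∀ r : ℝ, gCurve a b t (r • 1) = r • 1 := fun r => by
    rw [h.gCurve_eq, map_smul, map_smul, map_smul, map_smul, conjEnd_one hs0,
      conjEnd_one (h.normSq_uCurve t), conjEnd_one (h.normSq_uCurve 0), conjEnd_one hs]
  have hx : gCurve a b t (star x) = star (gCurve a b t x) := by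
    rw [h.gCurve_eq, h.gCurve_eq, conjEnd_star_apply, conjEnd_star_apply, conjEnd_star_apply,
      conjEnd_star_apply]
  rw [h.represents_groupCurve, h.inv_uCurve, h.inv_uCurve, LinearMap.comp_apply,
    LinearMap.comp_apply, LinearMap.comp_apply, phi_scalarMat hs0,
    phi_scalarMat (h.normSq_uCurve t), phi_scalarMat (h.normSq_uCurve 0), phi_scalarMat hs,
    hermOf_coord_hm, ← h.gCurve_eq]
  ext i j : 1
  fin_cases i <;> fin_cases j <;> simp [hm, hr, hx]

theorem coe_groupCurve (h : AnticommutingImaginary a b) (t : ℝ) :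
    ((h.groupCurve t : GL10) : (Fin 10 → ℝ) →L[ℝ] (Fin 10 → ℝ)) =
      block (1, conjEnd (star (uCurve a b t))) * block (1, conjEnd (uCurve a b 0)) *
        (block (1, conjEnd (uCurve a b t)) * block (1, conjEnd (star (uCurve a b 0)))) :=
  (mul_assoc _ _ _).symm

theorem groupCurve_zero (h : AnticommutingImaginary a b) : h.groupCurve 0 = 1 := by
  refine Subtype.ext (Units.ext ?_)
  rw [h.coe_groupCurve]
  simp only [← block_mul, Prod.mk_mul_mk, conjEnd_star_mul _ (h.normSq_uCurve 0),
    conjEnd_mul_star _ (h.normSq_uCurve 0), mul_one]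
  exact block_one

theorem _root_.Octonion.re_zero : re 0 = 0 := rfl

theorem toEnd_ofDer (D : derO) :
    sl2O.toEnd (sl2O.ofDer D) = block (0, (D : Module.End ℝ Octonion)) := by
  have e : sl2O.ofDer D = sl2O.mk 0 0 0 0 re_zero D := by
    refine Prod.ext (Subtype.ext ?_) (Prod.ext (Subtype.ext ?_) rfl)
    · ext i j : 1
      fin_cases i <;> fin_cases j <;> simp [sl2O.mk] <;> rfl
    · exact (map_zero commMap).symm
  refine ext_coord_hm fun α x β => ?_
  rw [sl2O.toEnd_coord, e, sl2O.act_mk, block_coord_hm, map_zero commMap]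
  have h0 : ∀ y, ip (0 : Octonion) y = 0 := fun y => by simp [ip]
  simp [h0, re_zero]

theorem exists_hasDerivAt_groupCurve (h : AnticommutingImaginary a b) :
    ∃ D : derO, IsCanonicalDer a b D ∧
      HasDerivAt (fun t => ((h.groupCurve t : GL10) : (Fin 10 → ℝ) →L[ℝ] (Fin 10 → ℝ)))
        (sl2O.toEnd (sl2O.ofDer D)) 0 := by
  refine ⟨⟨canonicalEnd a b, canonicalEnd_mem_derO a b⟩, fun x => rfl, ?_⟩
  -- Only two of the four factors depend on `t`; they are the first and the third.
  have hd := (h.hasDerivAt_block_conjEnd_star.mul_const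
    (block (1, conjEnd (uCurve a b 0)))).mul (h.hasDerivAt_block_conjEnd.mul_const
      (block (1, conjEnd (star (uCurve a b 0)))))
  simp only [coe_groupCurve]
  refine hd.congr_deriv ?_
  rw [toEnd_ofDer]
  simp only [← block_mul, Prod.mk_mul_mk, ← map_add, mul_one, mul_zero, Prod.mk_add_mk,
    add_zero, conjEnd_star_mul _ (h.normSq_uCurve 0), conjEnd_mul_star _ (h.normSq_uCurve 0),
    one_mul]
  congr 2
  symm
  ext1 x
  have hN := normSq_pos h.1
  have hk := h.uCoeff_sq 0
  rw [mul_zero, zero_smul, add_zero] at hk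
  have hu : uCurve a b 0 = (1 / 2 : ℝ) • 1 + uCoeff a b 0 • a := by
    change (1 / 2 : ℝ) • 1 + uCoeff a b 0 • (a + (4 / 3 * normSq a * 0) • b) = _
    rw [mul_zero, zero_smul, add_zero]
  have hv : star (uCurve a b 0) = (1 / 2 : ℝ) • 1 - uCoeff a b 0 • a := by
    rw [hu, star_add, star_smul, star_smul, star_trivial (1 / 2 : ℝ), star_trivial (uCoeff a b 0), star_one,
      star_eq_neg h.2.2.1, smul_neg, sub_eq_add_neg]
  -- The factor `4/3 ‖a‖²` in `r(t)` is chosen for this: it makes the tangent vector exactly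
  -- `D_{a,b}`, without a scalar.
  have hkl : uCoeff a b 0 * (4 / 3 * normSq a) * uCoeff a b 0 = 1 := by
    linear_combination (4 / 3) * hk
  have hid := tangent_identity (x := x) h.2.2.1 h.2.2.2.2 hk hkl hu hv
  have hn := h.normSq_uCurve 0
  set u := uCurve a b 0
  have e1 : star u * (conjEnd u x) = x * star u := by
    rw [conjEnd_apply, mul_mul_star_assoc, star_mul_mul, hn, one_smul]
  have e2 : u * (conjEnd (star u) x) = x * u := by
    rw [conjEnd_apply, mul_mul_star_assoc, mul_star_mul, hn, one_smul, star_star]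
  have e3 : conjEnd u x = (u * x) * star u := rfl
  have e4 : conjEnd (star u) x = (star u * x) * u := by rw [conjEnd_apply, star_star]
  change canonicalEnd a b x =
    (uCoeff a b 0 * (4 / 3 * normSq a)) • ((star u * conjEnd u x) * b - (b * conjEnd u x) * u) +
      (uCoeff a b 0 * (4 / 3 * normSq a)) • ((b * conjEnd (star u) x) * star u - (u * conjEnd (star u) x) * b)
  rw [e1, e2, e3, e4, ← smul_add, ← hid, neg_add_eq_sub]

end AnticommutingImaginary

end

theorem mainTheorem1 :
    -- the transformations whose matrices share one imaginary direction
    (∀ M : M2O, SharesDirection M →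
      ((Function.Bijective (phi M) ∧ PreservesDet M) ↔
        Octonion.normSq (M 0 0 * M 1 1 - M 0 1 * M 1 0) = 1)) ∧
    -- finite compositions of these already form the whole group
    (Submonoid.closure directedGenerators : Set GL10) = (SL2O : Set GL10) ∧
    -- `φ` is a linear bijection of `𝔰𝔩(2,𝕆)` onto `𝔰𝔬(9,1)` that respects the brackets
    Function.Injective sl2O.toMat ∧
    Set.range sl2O.toMat = (so91 : Set (Matrix (Fin 10) (Fin 10) ℝ)) ∧
    (∀ m n : sl2O, sl2O.toMat ⁅m, n⁆ = sl2O.toMat m * sl2O.toMat n - sl2O.toMat n * sl2O.toMat m) ∧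
    -- the group is an embedded Lie subgroup of `GL(10,ℝ)` with Lie algebra `𝔰𝔩(2,𝕆)`
    (∃ (_ : ChartedSpace E45 SL2O) (_ : LieGroup 𝓘(ℝ, E45) ∞ SL2O),
      Manifold.IsSmoothEmbedding 𝓘(ℝ, E45) 𝓘(ℝ, (Fin 10 → ℝ) →L[ℝ] (Fin 10 → ℝ)) ∞
        (Subtype.val : SL2O → GL10) ∧
      ∃ e : GroupLieAlgebra 𝓘(ℝ, E45) SL2O ≃ₗ[ℝ] sl2O,
        (∀ v w : GroupLieAlgebra 𝓘(ℝ, E45) SL2O, e ⁅v, w⁆ = ⁅e v, e w⁆) ∧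
        ∀ v : GroupLieAlgebra 𝓘(ℝ, E45) SL2O,
          mfderiv 𝓘(ℝ, E45) 𝓘(ℝ, (Fin 10 → ℝ) →L[ℝ] (Fin 10 → ℝ))
            (fun g : SL2O => ((g : GL10) : (Fin 10 → ℝ) →L[ℝ] (Fin 10 → ℝ))) 1 v
              = sl2O.toEnd (e v)) ∧
    -- the derivations are the tangent vectors of the curves `G^t_{a,b}` in the group
    (∀ a b : Octonion, AnticommutingImaginary a b →
      ∃ γ : ℝ → SL2O,
        (∀ t, Represents (γ t)
          (phi (scalarMat (uCurve a b t)⁻¹) ∘ₗ phi (scalarMat (uCurve a b 0)) ∘ₗ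
            phi (scalarMat (uCurve a b t)) ∘ₗ phi (scalarMat (uCurve a b 0)⁻¹))) ∧
        (∀ t, ∀ X : h2O,
          hermOf (((γ t : GL10) : (Fin 10 → ℝ) →L[ℝ] (Fin 10 → ℝ)) (coord X))
            = (X : M2O).map (gCurve a b t)) ∧
        γ 0 = 1 ∧
        ∃ D : derO, IsCanonicalDer a b D ∧
          HasDerivAt (fun t => ((γ t : GL10) : (Fin 10 → ℝ) →L[ℝ] (Fin 10 → ℝ)))
            (sl2O.toEnd (sl2O.ofDer D)) 0) ∧
    Submodule.span ℝ {D : derO | ∃ a b, AnticommutingImaginary a b ∧ IsCanonicalDer a b D} = ⊤ := by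
  exact ⟨fun M h => bijective_and_preservesDet_iff h, closure_directedGenerators,
    sl2O.toMat_injective, sl2O.range_toMat, sl2O.toMat_bracket, exists_lieGroup_SL2O,
    fun a b h => ⟨h.groupCurve, h.represents_groupCurve, h.hermOf_groupCurve, h.groupCurve_zero,
      h.exists_hasDerivAt_groupCurve⟩, span_canonical_eq_top⟩
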